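/- Let $\mathbb{C}[G]$ denote the group algebra of a finite group $G$. For a normal subgroup $N\neq\{1\}$ of $G$ and positive integers $d,e$, call the following the structure conditions for $(G,N,d,e)$: for every $x\in N\setminus\{1\}$, with $C$ the centralizer of $x$ in $G$, there are a prime $p$, an integer $k\ge 1$ and an integer $m\ge 0$ such that (1) $N$ is elementary abelian of order $p^k$; (2) $|C|=p^ke^2$, $d=e(p^k-1)$ and $|G|=e^2p^k(p^k-1)$; (3) $C$ is a Sylow $p$-subgroup of $G$ and $e=p^m$; (4) every subgroup $H$ with $N\subseteq H\subseteq C$ and $|H|>p^{k+m}$ satisfies $N\subseteq[H,H]$. Theorem. Up to isomorphism there are exactly two groups of order $54$ that have a normal subgroup $N\ne\{1\}$ satisfying the structure conditions for some $d,e$. Each of these two groups has a simple $\mathbb{C}[G]$-module $V$ of dimension $6$ and a normal subgroup $N\neq\{1\}$ acting trivially on every simple $\mathbb{C}[G]$-module not isomorphic to $V$ such that the structure conditions hold for $(G,N,6,3)$. Let $G$ be a finite group with a simple $\mathbb{C}[G]$-module $V$ of dimension $d$ such that $d(d+3)=|G|$. Then one of the following holds: (a) $G$ is one of the two abelian groups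 of order $4$, i.e. $G\cong\mathbb{Z}/4$ or $G\cong\mathbb{Z}/2\times\mathbb{Z}/2$; (b) $G$ is isomorphic to the dihedral group of order $10$; (c) $|G|=54$, $G$ has a normal subgroup $N\neq\{1\}$ that acts trivially on every simple $\mathbb{C}[G]$-module not isomorphic to $V$ and satisfies the structure conditions for $(G,N,d,3)$, and $G$ is isomorphic to one of the two groups of order $54$ above. -/

import Mathlib

universe u v

/-- The subgroup `N` of `G` acts trivially on every simple `ℂ[G]`-module that is not
isomorphic to `V`. -/
def ActsTriviallyOffModule {G : Type u} [Group G] (N : Subgroup G)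
    (V : Type v) [AddCommGroup V] [Module (MonoidAlgebra ℂ G) V] : Prop :=
  ∀ (W : Type v) [AddCommGroup W] [Module (MonoidAlgebra ℂ G) W],
    IsSimpleModule (MonoidAlgebra ℂ G) W →
    ¬ Nonempty (W ≃ₗ[MonoidAlgebra ℂ G] V) →
    ∀ g ∈ N, ∀ w : W, MonoidAlgebra.of ℂ G g • w = w

/-- `N` is elementary abelian of order `p ^ k`. -/
def IsElementaryAbelianOfOrder {G : Type u} [Group G] (N : Subgroup G) (p k : ℕ) : Prop :=
  (∀ a ∈ N, ∀ b ∈ N, a * b = b * a) ∧ (∀ a ∈ N, a ^ p = 1) ∧ Nat.card N = p ^ k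

/-- The purely group theoretic structure conditions on a finite group `G` with a nontrivial
normal subgroup `N`, for the parameters `d` and `e`.  For every nontrivial `x ∈ N`, with
`C` the centralizer of `x` in `G`, there are a prime `p` and integers `k > 0`, `m ≥ 0` with:
(1) `N` is elementary abelian of order `p ^ k`;
(2) `#C = p ^ k * e ^ 2`, `d = e * (p ^ k - 1)` and `#G = e ^ 2 * p ^ k * (p ^ k - 1)`;
(3) `C` is a Sylow `p`-subgroup of `G` and `e = p ^ m`;
(4) every `H` with `N ≤ H ≤ C` and `#H > p ^ (k + m)` satisfies `N ≤ [H, H]`.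
The subtractions are harmless, since `p ^ k ≥ 1`. -/
def StructureConditions {G : Type u} [Group G] (N : Subgroup G) (d e : ℕ) : Prop :=
  N.Normal ∧ N ≠ ⊥ ∧
  ∀ x ∈ N, x ≠ 1 → ∃ p k m : ℕ, p.Prime ∧ 0 < k ∧
    IsElementaryAbelianOfOrder N p k ∧
    (Nat.card (Subgroup.centralizer ({x} : Set G)) = p ^ k * e ^ 2 ∧
      d = e * (p ^ k - 1) ∧
      Nat.card G = e ^ 2 * p ^ k * (p ^ k - 1)) ∧
    ((∃ P : Sylow p G, (P : Subgroup G) = Subgroup.centralizer ({x} : Set G)) ∧ e = p ^ m) ∧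
    (∀ H : Subgroup G, N ≤ H → H ≤ Subgroup.centralizer ({x} : Set G) →
      p ^ (k + m) < Nat.card H → N ≤ ⁅H, H⁆)

/-- `G` has a simple `ℂ[G]`-module `V` of complex dimension `d` and a nontrivial normal
subgroup `N` that acts trivially on all simple modules other than `V` and satisfies the
structure conditions for `d` and `e`. -/
def HasModuleWithStructure (G : Type u) [Group G] (d e : ℕ) : Prop :=
  ∃ (V : Type u) (_ : AddCommGroup V) (_ : Module ℂ V) (_ : Module (MonoidAlgebra ℂ G) V),
    IsScalarTower ℂ (MonoidAlgebra ℂ G) V ∧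
    IsSimpleModule (MonoidAlgebra ℂ G) V ∧
    Module.finrank ℂ V = d ∧
    ∃ N : Subgroup G, ActsTriviallyOffModule N V ∧ StructureConditions N d e

/-! Let `χ` be the character of `V`, and write the regular module as the `V`-isotypic part plus a
complement `J`, the complementary ideal. Since `|G| = d(d+3)`, the dimension of `J` is `3d`, and its
character at `g ≠ 1` is `-d χ(g)`. Hence `|χ(g)| ≤ 3`, and `χ(g) = -3` exactly when `g` acts
trivially on `J`.

For `d ≥ 3` the character takes only the values `0` and `-3` off the identity
(`moduleCharacter_eq_zero_or`). When `d ≥ 9`, the trace of the idempotent of `V` on `End(J)` is a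
natural number below `9d²`, and this pins down the multiplicity of `V` in `V ⊗ V`; a sum of terms
`|χ|²(χ+3)` with nonnegative real parts then vanishes. For smaller `d`, every order but `54` is
excluded by an abelian subgroup of index less than `d`, and order `54` is handled through the centre
of a subgroup of order `27`.

Let `N` be the kernel of the action on `J` and `n = |N|`. The norm of `χ` gives `d + 3 = 3n`, so
`|G| = 9n(n-1)`. The nontrivial elements of `N` are all conjugate, and a subgroup `H` for which `N ∩
H` is not inside `[H,H]` has order dividing `3n`. `IsFusedNormalSubgroup` records these facts, and
from there on the argument is pure group theory: `N` is an elementary abelian `3`-group, the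
centralizer `C` of a nontrivial `x ∈ N` is a `3`-group of order `9n` with `[C,C] = N`, and an
involution inverts `N`. Comparing the centralizer `D` of `N` with `N` and `C`, the index `|D:N|` is
`1`, `3` or `9`; index `1` is impossible and the others force `n = 3`
(`IsFusedNormalSubgroup.card_eq_three`). So `|G| = 54` and `d = 6`.

In order `54` the structure conditions yield generators `a, b, z` and an involution `t` with
explicit relations, where `b³` is `1`, `z` or `z⁻¹`. These identify `G` with the affine group of
`F₃[ε]` or of `ℤ/9`. Conversely, both affine groups have an irreducible representation of dimension
`6` on the functions on the units, and the first half of the argument, applied to it, supplies their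
structure conditions. -/

open Module
open scoped MonoidAlgebra DualNumber

/-! ### Traces and eigenspaces of operators of finite order -/

section FiniteOrderOperators

variable {M : Type*} [AddCommGroup M] [Module ℂ M] [FiniteDimensional ℂ M]

theorem iSup_eigenspace_eq_top_of_pow_eq_one {T : End ℂ M} {n : ℕ} (hn : n ≠ 0) (hT : T ^ n = 1) :
    ⨆ μ, T.eigenspace μ = ⊤ := by
  have h : (Polynomial.X ^ n - 1 : Polynomial ℂ).Separable :=
    Polynomial.X_pow_sub_one_separable_iff.mpr (by exact_mod_cast hn)
  exact (End.isSemisimple_of_squarefree_aeval_eq_zero h.squarefree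
    (by simp [hT])).iSup_eigenspace_eq_top

/-- The powers of an operator of finite order have traces given by its eigenvalues. -/
theorem exists_trace_pow_eq_sum {T : End ℂ M} {n : ℕ} (hn : n ≠ 0) (hT : T ^ n = 1) :
    ∃ (S : Finset ℂ), (∀ μ ∈ S, μ ^ n = 1) ∧ (∀ μ ∈ S, 0 < finrank ℂ (T.eigenspace μ)) ∧
      (∀ μ ∉ S, T.eigenspace μ = ⊥) ∧
      ∀ k : ℕ, LinearMap.trace ℂ M (T ^ k) = ∑ μ ∈ S, (finrank ℂ (T.eigenspace μ) : ℂ) * μ ^ k := by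
  classical
  have hint : DirectSum.IsInternal T.eigenspace :=
    (DirectSum.isInternal_submodule_iff_iSupIndep_and_iSup_eq_top _).mpr
      ⟨T.eigenspaces_iSupIndep, iSup_eigenspace_eq_top_of_pow_eq_one hn hT⟩
  have hfin : {μ | T.eigenspace μ ≠ ⊥}.Finite :=
    WellFoundedGT.finite_ne_bot_of_iSupIndep T.eigenspaces_iSupIndep
  have hpow : ∀ (k : ℕ) (μ : ℂ) (v : M), v ∈ T.eigenspace μ → (T ^ k) v = μ ^ k • v := by
    intro k μ v hv
    rw [End.mem_eigenspace_iff] at hv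
    induction k with
    | zero => simp
    | succ k ih => rw [pow_succ', Module.End.mul_apply, ih, map_smul, hv, smul_smul, pow_succ]
  refine ⟨hfin.toFinset, ?_, ?_, ?_, ?_⟩
  · intro μ hμ
    obtain ⟨v, hv, hv0⟩ := Submodule.exists_mem_ne_zero_of_ne_bot (hfin.mem_toFinset.mp hμ)
    have h := hpow n μ v hv
    rw [hT, Module.End.one_apply] at h
    by_contra hne
    apply hv0
    have h2 : (1 - μ ^ n) • v = 0 := by rw [sub_smul, one_smul, ← h, sub_self]
    exact (smul_eq_zero.mp h2).resolve_left (sub_ne_zero.mpr (Ne.symm hne))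
  · intro μ hμ
    have := hfin.mem_toFinset.mp hμ
    exact Nat.pos_of_ne_zero fun h0 => this (Submodule.finrank_eq_zero.mp h0)
  · intro μ hμ
    by_contra h
    exact hμ (hfin.mem_toFinset.mpr h)
  · intro k
    have hmaps : ∀ μ, Set.MapsTo (T ^ k) (T.eigenspace μ) (T.eigenspace μ) := by
      intro μ v hv
      rw [SetLike.mem_coe, hpow k μ v hv]
      exact Submodule.smul_mem _ _ hv
    rw [LinearMap.trace_eq_sum_trace_restrict' hint hfin hmaps]
    refine Finset.sum_congr rfl fun μ _ => ?_
    have : (T ^ k).restrict (hmaps μ) = μ ^ k • LinearMap.id := by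
      ext v
      exact hpow k μ v v.2
    rw [this, map_smul, LinearMap.trace_id, smul_eq_mul, mul_comm]

theorem sum_finrank_eigenspace_eq {T : End ℂ M} {S : Finset ℂ}
    (hS : ∀ k : ℕ, LinearMap.trace ℂ M (T ^ k) =
      ∑ μ ∈ S, (finrank ℂ (T.eigenspace μ) : ℂ) * μ ^ k) :
    (∑ μ ∈ S, finrank ℂ (T.eigenspace μ)) = finrank ℂ M := by
  have h := hS 0
  simp only [pow_zero, LinearMap.trace_one, mul_one] at h
  exact_mod_cast h.symm

theorem norm_trace_le_of_pow_eq_one {T : End ℂ M} {n : ℕ} (hn : n ≠ 0) (hT : T ^ n = 1) :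
    ‖LinearMap.trace ℂ M T‖ ≤ finrank ℂ M := by
  obtain ⟨S, hroot, -, -, htr⟩ := exists_trace_pow_eq_sum hn hT
  have h1 := htr 1
  rw [pow_one] at h1
  rw [h1, ← sum_finrank_eigenspace_eq htr, Nat.cast_sum]
  refine (norm_sum_le _ _).trans (Finset.sum_le_sum fun μ hμ => ?_)
  rw [pow_one, norm_mul, Complex.norm_natCast, Complex.norm_eq_one_of_pow_eq_one (hroot μ hμ) hn,
    mul_one]

theorem trace_eq_conj_of_mul_eq_one {T T' : End ℂ M} {n : ℕ} (hn : n ≠ 0) (hT : T ^ n = 1)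
    (hT' : T * T' = 1) :
    LinearMap.trace ℂ M T' = (starRingEnd ℂ) (LinearMap.trace ℂ M T) := by
  obtain ⟨S, hroot, -, -, htr⟩ := exists_trace_pow_eq_sum hn hT
  have h1 := htr 1
  rw [pow_one] at h1
  obtain ⟨k, rfl⟩ := Nat.exists_eq_succ_of_ne_zero hn
  have : T' = T ^ k := by
    calc T' = T ^ k.succ * T' := by rw [hT, one_mul]
      _ = T ^ k := by rw [pow_succ, mul_assoc, hT', mul_one]
  rw [this, htr, h1, map_sum]
  refine Finset.sum_congr rfl fun μ hμ => ?_
  have hr := hroot μ hμ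
  have hn1 := Complex.norm_eq_one_of_pow_eq_one hr hn
  rw [map_mul, pow_one, map_natCast, ← Complex.inv_eq_conj hn1]
  congr 1
  rw [pow_succ] at hr
  exact eq_inv_of_mul_eq_one_left hr

/-- The trace is a sum of `finrank ℂ M` roots of unity, and its real part reaches that number only
if every eigenvalue is `1`. As `T` is diagonalizable, it is then the identity. -/
theorem eq_one_of_trace_eq_finrank {T : End ℂ M} {n : ℕ} (hn : n ≠ 0) (hT : T ^ n = 1)
    (htrace : LinearMap.trace ℂ M T = finrank ℂ M) : T = 1 := by
  obtain ⟨S, hroot, hpos, hbot, htr⟩ := exists_trace_pow_eq_sum hn hT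
  have h1 := htr 1
  rw [pow_one, htrace, ← sum_finrank_eigenspace_eq htr, Nat.cast_sum] at h1
  have hre : ∑ μ ∈ S, (finrank ℂ (T.eigenspace μ) : ℝ) * (1 - μ.re) = 0 := by
    have := congrArg Complex.re h1
    simp only [Complex.re_sum, Complex.natCast_re, pow_one, Complex.mul_re, Complex.natCast_im,
      zero_mul, sub_zero] at this
    simp only [mul_sub, mul_one, Finset.sum_sub_distrib, this, sub_self]
  have hnorm : ∀ μ ∈ S, ‖μ‖ = 1 := fun μ hμ => Complex.norm_eq_one_of_pow_eq_one (hroot μ hμ) hn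
  have hone : ∀ μ ∈ S, μ = 1 := by
    intro μ hμ
    have h2 := (Finset.sum_eq_zero_iff_of_nonneg (fun ν hν => mul_nonneg (Nat.cast_nonneg _)
      (by have := Complex.re_le_norm ν; rw [hnorm ν hν] at this; linarith))).mp hre μ hμ
    have h3 : μ.re = 1 := by
      rcases mul_eq_zero.mp h2 with h | h
      · exact absurd (by exact_mod_cast h) (hpos μ hμ).ne'
      · linarith
    have h4 := Complex.sq_norm μ
    rw [hnorm μ hμ, Complex.normSq_apply, h3] at h4
    apply Complex.ext h3
    simpa using (by nlinarith : μ.im * μ.im = 0)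
  have htop := iSup_eigenspace_eq_top_of_pow_eq_one hn hT
  have hle : (⊤ : Submodule ℂ M) ≤ T.eigenspace 1 := by
    rw [← htop]
    refine iSup_le fun μ => ?_
    by_cases hμ : μ ∈ S
    · rw [hone μ hμ]
    · rw [hbot μ hμ]; exact bot_le
  ext v
  have := End.mem_eigenspace_iff.mp (hle (Submodule.mem_top (x := v)))
  simpa using this

theorem exists_trace_eq_natCast_lt_finrank {P : End ℂ M} (hP : IsIdempotentElem P) {x : M}
    (hx : P x = 0) (hx0 : x ≠ 0) :
    ∃ r : ℕ, LinearMap.trace ℂ M P = r ∧ r < finrank ℂ M := by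
  refine ⟨_, ((LinearMap.isProj_range_iff_isIdempotentElem P).mpr hP).trace, ?_⟩
  have hker : 0 < finrank ℂ (LinearMap.ker P) := by
    have : Nontrivial (LinearMap.ker P) := ⟨⟨⟨x, hx⟩, 0, fun h => hx0 (congrArg Subtype.val h)⟩⟩
    exact finrank_pos
  have := LinearMap.finrank_range_add_finrank_ker P
  omega

/-- Pairwise commuting operators on a nonzero complex space have a common eigenvector. -/
theorem exists_common_eigenvector {ι : Type*} [Nontrivial M] (f : ι → End ℂ M)
    (hf : ∀ i j, Commute (f i) (f j)) :
    ∃ v : M, v ≠ 0 ∧ ∀ i, ∃ c : ℂ, f i v = c • v := by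
  let P : Submodule ℂ M → Prop := fun S => S ≠ ⊥ ∧ ∀ i, ∀ v ∈ S, f i v ∈ S
  -- A minimal nonzero invariant subspace lies in a single eigenspace of each `f i`: its
  -- intersection with an eigenspace is again invariant, because the operators commute.
  obtain ⟨S, ⟨hS0, hSf⟩, hmin⟩ := wellFounded_lt.has_min {S | P S}
    ⟨⊤, top_ne_bot, fun _ _ _ => Submodule.mem_top⟩
  obtain ⟨v, hv, hv0⟩ := Submodule.exists_mem_ne_zero_of_ne_bot hS0
  refine ⟨v, hv0, fun i => ?_⟩
  have : Nontrivial S := Submodule.nontrivial_iff_ne_bot.mpr hS0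
  obtain ⟨c, hc⟩ := End.exists_eigenvalue ((f i).restrict (hSf i))
  obtain ⟨w, hw⟩ := hc.exists_hasEigenvector
  have hw1 : f i w = c • (w : M) := congrArg Subtype.val hw.apply_eq_smul
  have hP : P (S ⊓ (f i).eigenspace c) := by
    refine ⟨fun h => hw.2 ?_, fun j u hu => ⟨hSf j u hu.1, ?_⟩⟩
    · have : (w : M) ∈ S ⊓ (f i).eigenspace c := ⟨w.2, End.mem_eigenspace_iff.mpr hw1⟩
      rw [h] at this
      exact Subtype.ext this
    · have h2 := End.mem_eigenspace_iff.mp hu.2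
      rw [SetLike.mem_coe, End.mem_eigenspace_iff]
      have := congrArg (· u) (hf i j).eq
      simp only [Module.End.mul_apply] at this
      rw [this, h2, map_smul]
  have hnot := hmin _ hP
  have heq : S ⊓ (f i).eigenspace c = S := by
    by_contra h
    exact hnot (lt_of_le_of_ne inf_le_left h)
  rw [← heq] at hv
  exact ⟨c, End.mem_eigenspace_iff.mp hv.2⟩

end FiniteOrderOperators

/-! ### Characters of modules over the complex group algebra -/

section GroupModules

variable {G : Type*} [Group G]

/-- The character of a module over the complex group algebra. -/
noncomputable def moduleCharacter (V : Type*) [AddCommGroup V] [Module ℂ V] [Module ℂ[G] V]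
    [IsScalarTower ℂ ℂ[G] V] (g : G) : ℂ :=
  (Representation.ofModule' (k := ℂ) (G := G) V).character g

section General

variable {V : Type*} [AddCommGroup V] [Module ℂ V] [Module ℂ[G] V] [IsScalarTower ℂ ℂ[G] V]

theorem ofModule'_asAlgebraHom (a : ℂ[G]) (v : V) :
    (Representation.ofModule' (k := ℂ) (G := G) V).asAlgebraHom a v = a • v := by
  have : (Representation.ofModule' (k := ℂ) (G := G) V).asAlgebraHom = Algebra.lsmul ℂ ℂ V :=
    (MonoidAlgebra.lift ℂ (End ℂ V) G).apply_symm_apply _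
  rw [this]; rfl

instance isIrreducible_ofModule' [IsSimpleModule ℂ[G] V] :
    (Representation.ofModule' (k := ℂ) (G := G) V).IsIrreducible := by
  rw [Representation.irreducible_iff_isSimpleModule_asModule]
  let ρ := Representation.ofModule' (k := ℂ) (G := G) V
  let e : ρ.asModule ≃ₗ[ℂ[G]] V :=
    { ρ.asModuleEquiv.toAddEquiv with
      map_smul' := fun a v => by
        change ρ.asModuleEquiv (a • v) = a • ρ.asModuleEquiv v
        rw [Representation.asModuleEquiv_map_smul, ofModule'_asAlgebraHom] }
  exact IsSimpleModule.congr e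

theorem linearEquiv_of_equiv_ofModule' {W : Type*} [AddCommGroup W] [Module ℂ W] [Module ℂ[G] W]
    [IsScalarTower ℂ ℂ[G] W]
    (φ : (Representation.ofModule' (k := ℂ) (G := G) V).Equiv
      (Representation.ofModule' (k := ℂ) (G := G) W)) : Nonempty (V ≃ₗ[ℂ[G]] W) := by
  refine ⟨{ φ.toLinearEquiv.toAddEquiv with map_smul' := fun a v => ?_ }⟩
  change φ.toLinearEquiv (a • v) = a • φ.toLinearEquiv v
  induction a using MonoidAlgebra.induction_on with
  | of g => exact Representation.IntertwiningMap.isIntertwining _ _ φ.toIntertwiningMap g v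
  | add a b ha hb => rw [add_smul, map_add, ha, hb, add_smul]
  | smul r a ha => rw [smul_assoc, map_smul, ha, smul_assoc]

theorem moduleCharacter_eq_trace (g : G) :
    moduleCharacter V g =
      LinearMap.trace ℂ V (Algebra.lsmul ℂ ℂ V (MonoidAlgebra.of ℂ G g)) := rfl

theorem moduleCharacter_one [FiniteDimensional ℂ V] :
    moduleCharacter V (1 : G) = finrank ℂ V := Representation.char_one _

theorem ofModule'_pow_card [Finite G] (g : G) :
    (Representation.ofModule' (k := ℂ) (G := G) V g) ^ Nat.card G = 1 := by
  rw [← map_pow, pow_card_eq_one', map_one]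

theorem moduleCharacter_inv [Finite G] [FiniteDimensional ℂ V] (g : G) :
    moduleCharacter V g⁻¹ = (starRingEnd ℂ) (moduleCharacter V g) := by
  refine trace_eq_conj_of_mul_eq_one (n := Nat.card G) Nat.card_pos.ne' (ofModule'_pow_card g) ?_
  rw [← map_mul, mul_inv_cancel, map_one]

theorem norm_moduleCharacter_le [Finite G] [FiniteDimensional ℂ V] (g : G) :
    ‖moduleCharacter V g‖ ≤ finrank ℂ V :=
  norm_trace_le_of_pow_eq_one (n := Nat.card G) Nat.card_pos.ne' (ofModule'_pow_card g)

theorem smul_eq_of_moduleCharacter_eq [Finite G] [FiniteDimensional ℂ V] {g : G}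
    (h : moduleCharacter V g = finrank ℂ V) (v : V) : MonoidAlgebra.of ℂ G g • v = v := by
  have := eq_one_of_trace_eq_finrank (n := Nat.card G) Nat.card_pos.ne' (ofModule'_pow_card g) h
  exact congrArg (· v) this

variable (V) in
theorem finiteDimensional_of_isSimpleModule [Finite G] [IsSimpleModule ℂ[G] V] :
    FiniteDimensional ℂ V :=
  Module.Finite.trans ℂ[G] V

theorem sum_character_inner [Fintype G] {W : Type*} [AddCommGroup W] [Module ℂ W] [Module ℂ[G] W]
    [IsScalarTower ℂ ℂ[G] W] [IsSimpleModule ℂ[G] V] [IsSimpleModule ℂ[G] W]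
    (h : ¬ Nonempty (W ≃ₗ[ℂ[G]] V)) :
    ∑ g : G, moduleCharacter V g⁻¹ * moduleCharacter W g = 0 := by
  classical
  have := finiteDimensional_of_isSimpleModule (G := G) V
  have := finiteDimensional_of_isSimpleModule (G := G) W
  have hne : (Nat.card G : ℂ) ≠ 0 := by exact_mod_cast Nat.card_pos.ne'
  let _ : Invertible (Nat.card G : ℂ) := invertibleOfNonzero hne
  have := Representation.char_orthonormal (Representation.ofModule' (k := ℂ) (G := G) W)
    (Representation.ofModule' (k := ℂ) (G := G) V)
  rw [if_neg (fun ⟨φ⟩ => h (linearEquiv_of_equiv_ofModule' φ.symm))] at this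
  simp only [mul_comm (moduleCharacter V _⁻¹)]
  exact (mul_eq_zero.mp this).resolve_left (inv_ne_zero hne)

variable (V) in
theorem sum_character_norm [Fintype G] [IsSimpleModule ℂ[G] V] :
    ∑ g : G, moduleCharacter V g⁻¹ * moduleCharacter V g = Nat.card G := by
  classical
  have := finiteDimensional_of_isSimpleModule (G := G) V
  have hne : (Nat.card G : ℂ) ≠ 0 := by exact_mod_cast Nat.card_pos.ne'
  let _ : Invertible (Nat.card G : ℂ) := invertibleOfNonzero hne
  have := Representation.char_orthonormal (Representation.ofModule' (k := ℂ) (G := G) V)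
    (Representation.ofModule' (k := ℂ) (G := G) V)
  rw [if_pos ⟨.refl _⟩] at this
  simp only [mul_comm (moduleCharacter V _⁻¹)]
  rw [inv_mul_eq_one₀ hne] at this
  exact this.symm

-- Here `m` is the dimension of the space of intertwining maps from `V` to `V ⊗ V`; only its being a
-- natural number is needed.
variable (V) in
theorem exists_sum_character_cube [Fintype G] [FiniteDimensional ℂ V] :
    ∃ m : ℕ, ∑ g : G, moduleCharacter V g * moduleCharacter V g * moduleCharacter V g⁻¹ =
      Nat.card G * m := by
  have hne : (Nat.card G : ℂ) ≠ 0 := by exact_mod_cast Nat.card_pos.ne'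
  let _ : Invertible (Nat.card G : ℂ) := invertibleOfNonzero hne
  let ρ := Representation.ofModule' (k := ℂ) (G := G) V
  have := Representation.card_inv_mul_sum_char_mul_char_eq_finrank ρ (ρ.tprod ρ)
  rw [Representation.char_tensor, inv_mul_eq_iff_eq_mul₀ hne] at this
  exact ⟨_, this⟩

/-- A linear character of a subgroup has natural multiplicity in a module. -/
theorem exists_sum_character_linear [FiniteDimensional ℂ V] (H : Subgroup G) [Fintype H]
    (μ : H →* ℂˣ) :
    ∃ m : ℕ, ∑ h : H, (μ h : ℂ) * moduleCharacter V (h : G) = Nat.card H * m := by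
  have hne : (Nat.card H : ℂ) ≠ 0 := by exact_mod_cast Nat.card_pos.ne'
  let _ : Invertible (Nat.card H : ℂ) := invertibleOfNonzero hne
  let ρ := Representation.ofModule' (k := ℂ) (G := G) V
  -- The restriction of `V` to `H`, twisted by `μ`; the required `m` is the dimension of its
  -- invariants.
  let σ : Representation ℂ H V :=
    { toFun := fun h => (μ h : ℂ) • ρ (h : G)
      map_one' := by simp
      map_mul' := fun a b => by
        simp only [map_mul, Units.val_mul, Subgroup.coe_mul, smul_mul_smul_comm] }
  have := σ.card_inv_mul_sum_char_eq_finrank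
  rw [inv_mul_eq_iff_eq_mul₀ hne] at this
  refine ⟨_, (Finset.sum_congr rfl fun h _ => ?_).trans this⟩
  exact (map_smul (LinearMap.trace ℂ V) (μ h : ℂ) (ρ (h : G))).symm

/-- The line through `v` is stable under `H`, so one translate per coset suffices to span the
submodule generated by `v`, which is all of `V`. -/
theorem finrank_le_index_of_eigenvector [IsSimpleModule ℂ[G] V] (H : Subgroup G)
    [H.FiniteIndex] {v : V} (hv : v ≠ 0)
    (h : ∀ g ∈ H, ∃ c : ℂ, MonoidAlgebra.of ℂ G g • v = c • v) : finrank ℂ V ≤ H.index := by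
  classical
  let f : G ⧸ H → V := fun q => MonoidAlgebra.of ℂ G q.out • v
  have hmem : ∀ g : G, MonoidAlgebra.of ℂ G g • v ∈ Submodule.span ℂ (Set.range f) := by
    intro g
    obtain ⟨c, hc⟩ := h _ (QuotientGroup.eq.mp (QuotientGroup.out_eq' (g : G ⧸ H)))
    have : MonoidAlgebra.of ℂ G g • v = c • f (g : G ⧸ H) := by
      rw [← smul_comm, ← hc, ← mul_smul, ← map_mul, mul_inv_cancel_left]
    rw [this]
    exact Submodule.smul_mem _ _ (Submodule.subset_span ⟨_, rfl⟩)
  have htop : Submodule.span ℂ (Set.range f) = ⊤ := by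
    rw [eq_top_iff]
    rintro w -
    obtain ⟨a, rfl⟩ := IsSimpleModule.toSpanSingleton_surjective ℂ[G] hv w
    rw [LinearMap.toSpanSingleton_apply]
    induction a using MonoidAlgebra.induction_on with
    | of g => exact hmem g
    | add a b ha hb => rw [add_smul]; exact add_mem ha hb
    | smul r a ha => rw [smul_assoc]; exact Submodule.smul_mem _ _ ha
  rw [← finrank_top ℂ V, ← htop]
  have : Fintype (G ⧸ H) := H.fintypeQuotientOfFiniteIndex
  refine (finrank_range_le_card f).trans ?_
  rw [Subgroup.index_eq_card, Nat.card_eq_fintype_card]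

/-- If the operators coming from `H` commute, then the dimension is at most the index of `H`. -/
theorem finrank_le_index_of_commute [Finite G] [IsSimpleModule ℂ[G] V] (H : Subgroup G)
    (h : ∀ a ∈ H, ∀ b ∈ H, ∀ v : V,
      MonoidAlgebra.of ℂ G (a * b) • v = MonoidAlgebra.of ℂ G (b * a) • v) :
    finrank ℂ V ≤ H.index := by
  have := finiteDimensional_of_isSimpleModule (G := G) V
  have := IsSimpleModule.nontrivial ℂ[G] V
  obtain ⟨v, hv, hc⟩ := exists_common_eigenvector
    (fun a : H => Representation.ofModule' (k := ℂ) (G := G) V a) (fun a b => by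
      rw [Commute, SemiconjBy, ← map_mul, ← map_mul]
      exact LinearMap.ext fun v => h a a.2 b b.2 v)
  exact finrank_le_index_of_eigenvector H hv fun g hg => hc ⟨g, hg⟩

theorem finrank_le_index_of_isMulCommutative [Finite G] [IsSimpleModule ℂ[G] V] (H : Subgroup G)
    (h : ∀ a ∈ H, ∀ b ∈ H, a * b = b * a) : finrank ℂ V ≤ H.index :=
  finrank_le_index_of_commute H fun a ha b hb v => by rw [h a ha b hb]

/-- A nonzero vector fixed by a normal subgroup forces that subgroup to act trivially. -/
theorem smul_eq_of_exists_fixed [IsSimpleModule ℂ[G] V] (N : Subgroup G) [N.Normal] {v : V}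
    (hv : v ≠ 0) (h : ∀ g ∈ N, MonoidAlgebra.of ℂ G g • v = v) (w : V) :
    ∀ g ∈ N, MonoidAlgebra.of ℂ G g • w = w := by
  obtain ⟨a, rfl⟩ := IsSimpleModule.toSpanSingleton_surjective ℂ[G] hv w
  rw [LinearMap.toSpanSingleton_apply]
  induction a using MonoidAlgebra.induction_on with
  | of x =>
    intro g hg
    have h1 := h _ ((inferInstance : N.Normal).conj_mem g hg x⁻¹)
    rw [← mul_smul, ← map_mul]
    conv_rhs => rw [← h1, ← mul_smul, ← map_mul]
    congr 2
    group
  | add a b ha hb => intro g hg; rw [add_smul, smul_add, ha g hg, hb g hg]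
  | smul r a ha => intro g hg; rw [smul_assoc, smul_comm, ha g hg]

end General

end GroupModules

/-! ### The central idempotent of a simple module and the complementary ideal -/

section CentralIdempotent

variable {G : Type*} [Group G]

/-- An element of the group algebra that kills all simple left ideals is zero. -/
theorem eq_zero_of_kills_simple [Finite G] {a : ℂ[G]}
    (h : ∀ (S : Submodule ℂ[G] ℂ[G]), IsSimpleModule ℂ[G] S → ∀ x ∈ S, a * x = 0) : a = 0 := by
  -- By Maschke's theorem `1` is a sum of elements of simple left ideals, so `a = a * 1` vanishes.
  have htop := IsSemisimpleModule.sSup_simples_eq_top (R := ℂ[G]) (M := ℂ[G])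
  have hmem : (1 : ℂ[G]) ∈ sSup {m : Submodule ℂ[G] ℂ[G] | IsSimpleModule ℂ[G] m} := by
    rw [htop]; trivial
  suffices ∀ y ∈ sSup {m : Submodule ℂ[G] ℂ[G] | IsSimpleModule ℂ[G] m}, a * y = 0 by
    simpa using this 1 hmem
  intro y hy
  rw [sSup_eq_iSup'] at hy
  induction hy using Submodule.iSup_induction' with
  | mem S x hx => exact h S S.2 x hx
  | zero => exact mul_zero _
  | add x y _ _ hx hy => rw [mul_add, hx, hy, add_zero]

theorem trace_lsmul_groupAlgebra [Finite G] (a : ℂ[G]) :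
    LinearMap.trace ℂ ℂ[G] (Algebra.lsmul ℂ ℂ ℂ[G] a) = Nat.card G * a.coeff 1 := by
  classical
  have := Fintype.ofFinite G
  rw [LinearMap.trace_eq_matrix_trace ℂ (MonoidAlgebra.basis G ℂ), Matrix.trace]
  have : ∀ g : G, (LinearMap.toMatrix (MonoidAlgebra.basis G ℂ) (MonoidAlgebra.basis G ℂ)
      (Algebra.lsmul ℂ ℂ ℂ[G] a)).diag g = a.coeff 1 := by
    intro g
    rw [Matrix.diag_apply, LinearMap.toMatrix_apply, MonoidAlgebra.basis_apply]
    change (a * MonoidAlgebra.single g 1).coeff g = _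
    simp
  rw [Finset.sum_congr rfl fun g _ => this g]
  simp

section Fintype

variable [Fintype G]

theorem exists_scalar_of_commute {W : Type*} [AddCommGroup W] [Module ℂ W] [Module ℂ[G] W]
    [IsScalarTower ℂ ℂ[G] W] [IsSimpleModule ℂ[G] W] {z : ℂ[G]} (hz : ∀ a, z * a = a * z) :
    ∃ c : ℂ, ∀ w : W, z • w = c • w := by
  have := finiteDimensional_of_isSimpleModule (G := G) W
  let f : End ℂ[G] W :=
    { toFun := fun w => z • w
      map_add' := smul_add z
      map_smul' := fun a w => by rw [RingHom.id_apply, ← mul_smul, hz, mul_smul] }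
  obtain ⟨c, hc⟩ := (IsSimpleModule.algebraMap_end_bijective_of_isAlgClosed ℂ
    (A := ℂ[G]) (V := W)).surjective f
  exact ⟨c, fun w => (congrArg (· w) hc).symm⟩

theorem mul_comm_of_conj_invariant {f : G → ℂ} (hf : ∀ g h, f (h * g * h⁻¹) = f g) (a : ℂ[G]) :
    (∑ g, f g • MonoidAlgebra.of ℂ G g) * a = a * ∑ g, f g • MonoidAlgebra.of ℂ G g := by
  induction a using MonoidAlgebra.induction_on with
  | of h =>
    rw [Finset.sum_mul, Finset.mul_sum, ← (MulAut.conj h).toEquiv.sum_comp]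
    refine Finset.sum_congr rfl fun g _ => ?_
    change f (h * g * h⁻¹) • MonoidAlgebra.of ℂ G (h * g * h⁻¹) * _ = _
    rw [hf, smul_mul_assoc, mul_smul_comm, ← map_mul, ← map_mul, inv_mul_cancel_right]
  | add a b ha hb => rw [mul_add, add_mul, ha, hb]
  | smul r a ha => rw [mul_smul_comm, smul_mul_assoc, ha]

/-- A class function acts on a simple module by a scalar determined by its character. -/
theorem trace_sum_smul {W : Type*} [AddCommGroup W] [Module ℂ W] [Module ℂ[G] W]
    [IsScalarTower ℂ ℂ[G] W] [IsSimpleModule ℂ[G] W] {f : G → ℂ}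
    (hf : ∀ g h, f (h * g * h⁻¹) = f g) :
    ∃ c : ℂ, (∀ w : W, (∑ g, f g • MonoidAlgebra.of ℂ G g) • w = c • w) ∧
      c * finrank ℂ W = ∑ g, f g * moduleCharacter W g := by
  have := finiteDimensional_of_isSimpleModule (G := G) W
  obtain ⟨c, hc⟩ := exists_scalar_of_commute (W := W) (mul_comm_of_conj_invariant hf)
  refine ⟨c, hc, ?_⟩
  have h1 : Algebra.lsmul ℂ ℂ W (∑ g, f g • MonoidAlgebra.of ℂ G g) = c • LinearMap.id :=
    LinearMap.ext hc
  have h2 := congrArg (LinearMap.trace ℂ W) h1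
  rw [map_smul, LinearMap.trace_id, smul_eq_mul, map_sum, map_sum] at h2
  rw [← h2]
  refine Finset.sum_congr rfl fun g _ => ?_
  rw [map_smul, map_smul, smul_eq_mul, moduleCharacter_eq_trace]

variable (V : Type*) [AddCommGroup V] [Module ℂ V] [Module ℂ[G] V] [IsScalarTower ℂ ℂ[G] V]

/-- The central idempotent of a simple module over the complex group algebra. -/
noncomputable def characterIdempotent : ℂ[G] :=
  ∑ g : G, ((finrank ℂ V : ℂ) / Nat.card G * moduleCharacter V g⁻¹) • MonoidAlgebra.of ℂ G g

omit [Fintype G] in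
theorem moduleCharacter_conj (g h : G) :
    moduleCharacter V (h * g * h⁻¹) = moduleCharacter V g :=
  Representation.char_conj _ _ _

omit [Fintype G] in
theorem characterIdempotent_coeff_conj (g h : G) :
    (finrank ℂ V : ℂ) / Nat.card G * moduleCharacter V (h * g * h⁻¹)⁻¹ =
      (finrank ℂ V : ℂ) / Nat.card G * moduleCharacter V g⁻¹ := by
  rw [mul_inv_rev, mul_inv_rev, inv_inv, ← mul_assoc, moduleCharacter_conj]

theorem characterIdempotent_comm (a : ℂ[G]) :
    characterIdempotent V * a = a * characterIdempotent (G := G) V :=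
  mul_comm_of_conj_invariant (characterIdempotent_coeff_conj V) a

theorem characterIdempotent_coeff (g : G) :
    (characterIdempotent (G := G) V).coeff g =
      (finrank ℂ V : ℂ) / Nat.card G * moduleCharacter V g⁻¹ := by
  classical
  simp [characterIdempotent, MonoidAlgebra.coeff_sum, MonoidAlgebra.of_apply,
    MonoidAlgebra.coeff_single, Finsupp.single_apply]

variable {V} [IsSimpleModule ℂ[G] V]

theorem finrank_pos_of_isSimpleModule (V : Type*) [AddCommGroup V] [Module ℂ V] [Module ℂ[G] V]
    [IsScalarTower ℂ ℂ[G] V] [IsSimpleModule ℂ[G] V] : 0 < finrank ℂ V := by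
  have := finiteDimensional_of_isSimpleModule (G := G) V
  have := IsSimpleModule.nontrivial ℂ[G] V
  exact finrank_pos

theorem characterIdempotent_smul_self (v : V) : characterIdempotent (G := G) V • v = v := by
  obtain ⟨c, hc, hc'⟩ := trace_sum_smul (W := V) 
    (f := fun g => (finrank ℂ V : ℂ) / Nat.card G * moduleCharacter V g⁻¹)
    (characterIdempotent_coeff_conj V)
  have hpos : (finrank ℂ V : ℂ) ≠ 0 := by
    exact_mod_cast (finrank_pos_of_isSimpleModule (G := G) V).ne'
  have hne : (Nat.card G : ℂ) ≠ 0 := by exact_mod_cast Nat.card_pos.ne'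
  simp only [mul_assoc, ← Finset.mul_sum, sum_character_norm] at hc'
  rw [div_mul_cancel₀ _ hne] at hc'
  have : c = 1 := mul_right_cancel₀ hpos (hc'.trans (one_mul _).symm)
  have h := hc v
  rw [this, one_smul] at h
  exact h

theorem characterIdempotent_smul_eq_zero {W : Type*} [AddCommGroup W] [Module ℂ[G] W]
    [IsSimpleModule ℂ[G] W] (h : ¬ Nonempty (W ≃ₗ[ℂ[G]] V)) (w : W) :
    characterIdempotent (G := G) V • w = 0 := by
  -- No complex structure is given on `W`, in agreement with `ActsTriviallyOffModule`, so it is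
  -- pulled back from the group algebra.
  let _ : Module ℂ W := Module.compHom W (algebraMap ℂ ℂ[G])
  have : IsScalarTower ℂ ℂ[G] W := ⟨fun r a w => by
    rw [Algebra.smul_def, mul_smul]; rfl⟩
  obtain ⟨c, hc, hc'⟩ := trace_sum_smul (W := W) 
    (f := fun g => (finrank ℂ V : ℂ) / Nat.card G * moduleCharacter V g⁻¹)
    (characterIdempotent_coeff_conj V)
  have hpos : (finrank ℂ W : ℂ) ≠ 0 := by
    exact_mod_cast (finrank_pos_of_isSimpleModule (G := G) W).ne'
  simp only [mul_assoc, ← Finset.mul_sum, sum_character_inner h, mul_zero] at hc'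
  have h := hc w
  rw [(mul_eq_zero.mp hc').resolve_right hpos, zero_smul] at h
  exact h

/-- An element of the group algebra that kills `V` and the complementary ideal is zero. -/
theorem eq_zero_of_smul_eq_zero {z : ℂ[G]} (hV : ∀ v : V, z • v = 0)
    (hz : z * characterIdempotent V = z) : z = 0 := by
  refine eq_zero_of_kills_simple fun S hS x hx => ?_
  by_cases h : Nonempty (S ≃ₗ[ℂ[G]] V)
  · obtain ⟨φ⟩ := h
    have h1 : z • (⟨x, hx⟩ : S) = 0 := by
      apply φ.injective
      rw [map_smul, hV, map_zero]
    exact congrArg Subtype.val h1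
  · have h1 := characterIdempotent_smul_eq_zero (V := V) h (⟨x, hx⟩ : S)
    have h2 : characterIdempotent (G := G) V * x = 0 := congrArg Subtype.val h1
    rw [← hz, mul_assoc, h2, mul_zero]

/-- The element acts as `1` on simple left ideals isomorphic to `V` and as `0` on the others, so its
square minus itself kills them all. -/
theorem characterIdempotent_isIdempotentElem :
    IsIdempotentElem (characterIdempotent (G := G) V) := by
  refine sub_eq_zero.mp (eq_zero_of_kills_simple fun S hS x hx => ?_)
  by_cases h : Nonempty (S ≃ₗ[ℂ[G]] V)
  · obtain ⟨φ⟩ := h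
    have h1 : (characterIdempotent (G := G) V * characterIdempotent V - characterIdempotent V) •
        (⟨x, hx⟩ : S) = 0 := by
      apply φ.injective
      rw [map_smul, sub_smul, mul_smul, characterIdempotent_smul_self, sub_self, map_zero]
    exact congrArg Subtype.val h1
  · have h1 := characterIdempotent_smul_eq_zero (V := V) h (⟨x, hx⟩ : S)
    have h2 : characterIdempotent (G := G) V * x = 0 := congrArg Subtype.val h1
    rw [sub_mul, mul_assoc, h2, mul_zero, sub_zero]

variable (V) in
/-- The sum of the minimal two-sided ideals of the group algebra not belonging to `V`. -/
noncomputable def complementaryIdeal : Submodule ℂ[G] ℂ[G] :=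
  LinearMap.ker (LinearMap.toSpanSingleton ℂ[G] ℂ[G] (characterIdempotent V))

omit [IsSimpleModule ℂ[G] V] in
theorem mem_complementaryIdeal {x : ℂ[G]} :
    x ∈ complementaryIdeal (G := G) V ↔ x * characterIdempotent V = 0 := Iff.rfl

instance : FiniteDimensional ℂ (complementaryIdeal (G := G) V) :=
  Module.Finite.of_injective ((complementaryIdeal (G := G) V).subtype.restrictScalars ℂ)
    Subtype.val_injective

/-- Right multiplication by `1 - e` projects the group algebra onto the ideal. As `e` is central,
the trace of `g` on the ideal is the trace on the whole algebra of left multiplication by `g(1 -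
e)`, that is, `|G|` times its coefficient at `1`. -/
theorem moduleCharacter_complementaryIdeal [DecidableEq G] (g : G) :
    moduleCharacter (complementaryIdeal (G := G) V) g =
      (if g = 1 then (Nat.card G : ℂ) else 0) - finrank ℂ V * moduleCharacter V g := by
  set e := characterIdempotent (G := G) V with he
  have hee : e * e = e := characterIdempotent_isIdempotentElem
  let J := complementaryIdeal (G := G) V
  let i : J →ₗ[ℂ] ℂ[G] := J.subtype.restrictScalars ℂ
  let π : ℂ[G] →ₗ[ℂ] J :=
    { toFun := fun x => ⟨x * (1 - e), by
        rw [mem_complementaryIdeal, ← he, mul_assoc, sub_mul, hee, one_mul, sub_self, mul_zero]⟩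
      map_add' := fun x y => Subtype.ext (add_mul _ _ _)
      map_smul' := fun r x => Subtype.ext (smul_mul_assoc _ _ _) }
  let T : J →ₗ[ℂ] J := Algebra.lsmul ℂ ℂ J (MonoidAlgebra.of ℂ G g)
  have h1 : (T ∘ₗ π) ∘ₗ i = T := by
    refine LinearMap.ext fun x => Subtype.ext ?_
    have hx : (x : ℂ[G]) * e = 0 := x.2
    change MonoidAlgebra.of ℂ G g * ((x : ℂ[G]) * (1 - e)) = MonoidAlgebra.of ℂ G g * (x : ℂ[G])
    rw [mul_sub, hx, mul_one, sub_zero]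
  have h2 : i ∘ₗ (T ∘ₗ π) = Algebra.lsmul ℂ ℂ ℂ[G] (MonoidAlgebra.of ℂ G g * (1 - e)) := by
    refine LinearMap.ext fun x => ?_
    change MonoidAlgebra.of ℂ G g * (x * (1 - e)) = MonoidAlgebra.of ℂ G g * (1 - e) * x
    rw [mul_assoc, mul_sub, sub_mul, characterIdempotent_comm, mul_one, one_mul]
  have h3 := LinearMap.trace_comp_comm' i (T ∘ₗ π)
  rw [h1, h2, trace_lsmul_groupAlgebra] at h3
  have hne : (Nat.card G : ℂ) ≠ 0 := by exact_mod_cast Nat.card_pos.ne'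
  rw [moduleCharacter_eq_trace]
  change LinearMap.trace ℂ J T = _
  rw [h3, mul_sub, mul_one, MonoidAlgebra.coeff_sub, Finsupp.sub_apply, mul_sub]
  congr 1
  · simp [MonoidAlgebra.of_apply, Finsupp.single_apply]
  · rw [MonoidAlgebra.of_apply, MonoidAlgebra.coeff_single_mul_apply, one_mul, mul_one, he,
      characterIdempotent_coeff, inv_inv]
    field_simp

end Fintype

end CentralIdempotent

/-! ### Character values when the order is `d(d+3)`: large degree -/

theorem eq_neg_three_of_re {z : ℂ} (h : z.re = -3) (hz : ‖z‖ ≤ 3) : z = -3 := by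
  have h1 := Complex.sq_norm z
  rw [Complex.normSq_apply, h] at h1
  have h2 : z.im * z.im = 0 :=
    le_antisymm (by nlinarith [norm_nonneg z]) (mul_self_nonneg _)
  exact Complex.ext (by simpa using h) (by simpa using mul_self_eq_zero.mp h2)

section LargeDegree

variable {G : Type*} [Group G] {V : Type*} [AddCommGroup V] [Module ℂ V] [Module ℂ[G] V]
  [IsScalarTower ℂ ℂ[G] V]

/-- The sum of the elements of `N` sends every vector to a vector fixed by `N`, so it acts on `V` as
zero; the sum of character values is the trace of `g` times this operator. -/
theorem sum_character_coset_eq_zero (N : Subgroup G) [Fintype N]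
    (h : ∀ v : V, (∀ g ∈ N, MonoidAlgebra.of ℂ G g • v = v) → v = 0) (g : G) :
    ∑ z : N, moduleCharacter V (g * z) = 0 := by
  have hz : ∑ z : N, Algebra.lsmul ℂ ℂ V (MonoidAlgebra.of ℂ G (z : G)) = 0 := by
    refine LinearMap.ext fun v => ?_
    rw [LinearMap.zero_apply]
    apply h
    intro x hx
    rw [LinearMap.sum_apply, Finset.smul_sum, ← Equiv.sum_comp (Equiv.mulLeft (⟨x, hx⟩ : N))
      (fun z : N => Algebra.lsmul ℂ ℂ V (MonoidAlgebra.of ℂ G (z : G)) v)]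
    refine Finset.sum_congr rfl fun z _ => ?_
    change MonoidAlgebra.of ℂ G x • MonoidAlgebra.of ℂ G (z : G) • v =
      MonoidAlgebra.of ℂ G (x * z) • v
    rw [map_mul, mul_smul]
  have : ∑ z : N, moduleCharacter V (g * z) = LinearMap.trace ℂ V
      (Algebra.lsmul ℂ ℂ V (MonoidAlgebra.of ℂ G g) *
        ∑ z : N, Algebra.lsmul ℂ ℂ V (MonoidAlgebra.of ℂ G (z : G))) := by
    rw [Finset.mul_sum, map_sum]
    refine Finset.sum_congr rfl fun z _ => ?_
    rw [← map_mul, ← map_mul]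
    rfl
  rw [this, hz, mul_zero, map_zero]

variable [Fintype G] [IsSimpleModule ℂ[G] V]

theorem sum_character_eq_zero (hd : 1 < finrank ℂ V) : ∑ g : G, moduleCharacter V g = 0 := by
  have : Fintype (⊤ : Subgroup G) := Fintype.ofFinite _
  have h := sum_character_coset_eq_zero (V := V) (⊤ : Subgroup G) (fun v hv => by
    by_contra hne
    have := finrank_le_index_of_eigenvector ⊤ hne fun g hg => ⟨1, by rw [hv g hg, one_smul]⟩
    rw [Subgroup.index_top] at this
    omega) 1
  rw [← h]
  refine (Fintype.sum_equiv Subgroup.topEquiv.toEquiv _ _ fun z => ?_).symm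
  rw [one_mul]
  rfl

section

variable (hcard : finrank ℂ V * (finrank ℂ V + 3) = Nat.card G)

include hcard

theorem finrank_complementaryIdeal :
    finrank ℂ (complementaryIdeal (G := G) V) = 3 * finrank ℂ V := by
  classical
  have := finiteDimensional_of_isSimpleModule (G := G) V
  have h := moduleCharacter_complementaryIdeal (V := V) (1 : G)
  rw [moduleCharacter_one, moduleCharacter_one, if_pos rfl, ← hcard] at h
  push_cast at h
  have h2 : (finrank ℂ (complementaryIdeal (G := G) V) : ℂ) = ((3 * finrank ℂ V : ℕ) : ℂ) := by
    rw [h]; push_cast; ring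
  exact_mod_cast h2

omit hcard in
theorem moduleCharacter_complementaryIdeal_of_ne_one {g : G} (hg : g ≠ 1) :
    moduleCharacter (complementaryIdeal (G := G) V) g = -(finrank ℂ V * moduleCharacter V g) := by
  classical
  rw [moduleCharacter_complementaryIdeal, if_neg hg, zero_sub]

/-- A character value is bounded by the degree. On the complementary ideal the value is `-d χ(g)`
and the degree `3d`, and `d` cancels. -/
theorem norm_moduleCharacter_le_three {g : G} (hg : g ≠ 1) : ‖moduleCharacter V g‖ ≤ 3 := by
  have hpos : (0 : ℝ) < finrank ℂ V := by
    exact_mod_cast finrank_pos_of_isSimpleModule (G := G) V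
  have h := norm_moduleCharacter_le (V := complementaryIdeal (G := G) V) g
  rw [moduleCharacter_complementaryIdeal_of_ne_one hg, finrank_complementaryIdeal hcard,
    norm_neg, norm_mul, Complex.norm_natCast] at h
  push_cast at h
  rw [mul_comm (3 : ℝ)] at h
  exact le_of_mul_le_mul_left h hpos

theorem mul_eq_self_of_moduleCharacter_eq {g : G} (hg : g ≠ 1) (h : moduleCharacter V g = -3)
    {x : ℂ[G]} (hx : x ∈ complementaryIdeal (G := G) V) : MonoidAlgebra.of ℂ G g * x = x := by
  have h1 : moduleCharacter (complementaryIdeal (G := G) V) g =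
      finrank ℂ (complementaryIdeal (G := G) V) := by
    rw [moduleCharacter_complementaryIdeal_of_ne_one hg, finrank_complementaryIdeal hcard, h]
    push_cast; ring
  exact congrArg Subtype.val (smul_eq_of_moduleCharacter_eq h1 ⟨x, hx⟩)

theorem moduleCharacter_eq_of_mul_eq_self {g : G} (hg : g ≠ 1)
    (h : ∀ x ∈ complementaryIdeal (G := G) V, MonoidAlgebra.of ℂ G g * x = x) :
    moduleCharacter V g = -3 := by
  have hpos : (finrank ℂ V : ℂ) ≠ 0 := by
    exact_mod_cast (finrank_pos_of_isSimpleModule (G := G) V).ne'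
  have h1 : Algebra.lsmul ℂ ℂ (complementaryIdeal (G := G) V) (MonoidAlgebra.of ℂ G g) =
      LinearMap.id := LinearMap.ext fun x => Subtype.ext (h x x.2)
  have h2 := moduleCharacter_complementaryIdeal_of_ne_one (V := V) hg
  rw [moduleCharacter_eq_trace, h1, LinearMap.trace_id, finrank_complementaryIdeal hcard] at h2
  push_cast at h2
  apply mul_left_cancel₀ hpos
  linear_combination h2

/-- The multiplicity of `V` in `V ⊗ V` determines a small defect. -/
theorem exists_multiplicity_defect (hd : 1 < finrank ℂ V) :
    ∃ s : ℕ, finrank ℂ V * s < 9 ∧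
      ∑ g : G, moduleCharacter V g * moduleCharacter V g * moduleCharacter V g⁻¹ =
        Nat.card G * (finrank ℂ V + s - 3) := by
  classical
  have := finiteDimensional_of_isSimpleModule (G := G) V
  obtain ⟨m, hm⟩ := exists_sum_character_cube (G := G) V
  set d := finrank ℂ V with hd_def
  let J := complementaryIdeal (G := G) V
  let u : G → ℂ := moduleCharacter J
  let σ := Representation.ofModule' (k := ℂ) (G := G) J
  let X := σ.linHom σ
  let e := characterIdempotent (G := G) V
  -- The projection of `End(J)` onto its `V`-isotypic part. Its trace is a rank, and is also
  -- computable from `χ`.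
  let P : End ℂ (J →ₗ[ℂ] J) := X.asAlgebraHom e
  have hdpos : (d : ℂ) ≠ 0 := by exact_mod_cast (by omega : d ≠ 0)
  have hGne : (Nat.card G : ℂ) ≠ 0 := by exact_mod_cast Nat.card_pos.ne'
  have hG : (Nat.card G : ℂ) = d * (d + 3) := by rw [← hcard]; push_cast; ring
  have hJ : finrank ℂ J = 3 * d := finrank_complementaryIdeal hcard
  have hP : IsIdempotentElem P := by
    change _ * _ = _
    rw [← map_mul]
    exact congrArg _ characterIdempotent_isIdempotentElem
  have hPsum : P = ∑ g : G, ((d : ℂ) / Nat.card G * moduleCharacter V g⁻¹) • X g := by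
    change X.asAlgebraHom (∑ g : G, _) = _
    rw [map_sum]
    refine Finset.sum_congr rfl fun g _ => ?_
    rw [map_smul, Representation.asAlgebraHom_of]
  -- Off the identity `u` equals `-d χ`. At the identity the left side is `d (3d)²` where the
  -- general formula gives `d⁵`, hence the correction.
  have hterm : ∀ g : G, moduleCharacter V g⁻¹ * (u g⁻¹ * u g) =
      d ^ 2 * (moduleCharacter V g⁻¹ * moduleCharacter V g⁻¹ * moduleCharacter V g) +
        if g = 1 then (9 * d ^ 3 - d ^ 5 : ℂ) else 0 := by
    intro g
    by_cases hg : g = 1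
    · subst hg
      rw [if_pos rfl, inv_one]
      change moduleCharacter V 1 * (moduleCharacter J 1 * moduleCharacter J 1) = _
      rw [moduleCharacter_one, moduleCharacter_one, hJ]
      push_cast
      ring
    · rw [if_neg hg]
      change _ * (moduleCharacter J g⁻¹ * moduleCharacter J g) = _
      rw [moduleCharacter_complementaryIdeal_of_ne_one hg,
        moduleCharacter_complementaryIdeal_of_ne_one (inv_ne_one.mpr hg)]
      ring
  have hsum : ∑ g : G, moduleCharacter V g⁻¹ * (u g⁻¹ * u g) =
      d ^ 2 * (Nat.card G * m) + (9 * d ^ 3 - d ^ 5) := by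
    rw [Finset.sum_congr rfl fun g _ => hterm g, Finset.sum_add_distrib, ← Finset.mul_sum,
      Finset.sum_ite_eq' Finset.univ (1 : G), if_pos (Finset.mem_univ _), ← hm,
      ← Equiv.sum_comp (Equiv.inv G) (fun g : G =>
        moduleCharacter V g * moduleCharacter V g * moduleCharacter V g⁻¹)]
    simp
  have htrP : LinearMap.trace ℂ _ P = d ^ 3 * (m + 3 - d) := by
    have : LinearMap.trace ℂ _ P =
        (d : ℂ) / Nat.card G * ∑ g : G, moduleCharacter V g⁻¹ * (u g⁻¹ * u g) := by
      rw [hPsum, map_sum, Finset.mul_sum]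
      refine Finset.sum_congr rfl fun g _ => ?_
      rw [map_smul, smul_eq_mul, mul_assoc]
      congr 2
      exact Representation.char_linHom σ σ g
    rw [this, hsum, hG]
    have h3 : (d : ℂ) + 3 ≠ 0 := by exact_mod_cast (by omega : d + 3 ≠ 0)
    field_simp
    ring
  -- The identity of `J` is an invariant vector of `End(J)`, and the idempotent kills invariants
  -- because the values of `χ` sum to zero. This makes the rank strictly less than `9d²`.
  have hPid : P LinearMap.id = 0 := by
    rw [hPsum, LinearMap.sum_apply]
    have : ∀ g : G, X g LinearMap.id = LinearMap.id := by
      intro g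
      refine LinearMap.ext fun x => ?_
      change σ g (σ g⁻¹ x) = x
      rw [← Module.End.mul_apply, ← map_mul, mul_inv_cancel, map_one]
      rfl
    simp only [LinearMap.smul_apply, this, ← Finset.sum_smul, ← Finset.mul_sum]
    have h0 : ∑ g : G, moduleCharacter V g⁻¹ = 0 := by
      rw [← sum_character_eq_zero (G := G) hd]
      exact Equiv.sum_comp (Equiv.inv G) (fun g => moduleCharacter V g)
    rw [h0, mul_zero, zero_smul]
  have hid : (LinearMap.id : J →ₗ[ℂ] J) ≠ 0 := by
    intro h
    have h2 := congrArg (LinearMap.trace ℂ J) h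
    rw [LinearMap.trace_id, map_zero, hJ] at h2
    have : 3 * d = 0 := by exact_mod_cast h2
    omega
  obtain ⟨r, hr, hrlt⟩ := exists_trace_eq_natCast_lt_finrank (M := J →ₗ[ℂ] J) hP hPid hid
  rw [Module.finrank_linearMap, hJ] at hrlt
  rw [htrP] at hr
  have hZ : (d : ℤ) ^ 3 * (m + 3 - d) = r := by exact_mod_cast hr
  have hd3 : (0 : ℤ) < (d : ℤ) ^ 3 := by have : 0 < d := by omega
                                         positivity
  -- The trace `d³(m + 3 - d)` is a rank, so it is nonnegative.
  have hs : (0 : ℤ) ≤ m + 3 - d := by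
    by_contra h
    have := mul_neg_of_pos_of_neg hd3 (not_le.mp h)
    omega
  obtain ⟨s, hs⟩ := Int.eq_ofNat_of_zero_le hs
  refine ⟨s, ?_, ?_⟩
  · rw [hs] at hZ
    have h1 : d ^ 3 * s = r := by exact_mod_cast hZ
    have h2 : d ^ 2 * (d * s) < d ^ 2 * 9 := by
      calc d ^ 2 * (d * s) = r := by rw [← h1]; ring
        _ < d ^ 2 * 9 := by nlinarith
    exact lt_of_mul_lt_mul_left h2 (Nat.zero_le _)
  · rw [hm]
    congr 1
    have : (m : ℂ) + 3 - d = s := by exact_mod_cast hs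
    linear_combination this

/-- For `d ≥ 9` the bound `d s < 9` forces `s = 0`. The sum of `|χ|²(χ+3)` over the whole group then
equals its term at `1`, so the remaining terms sum to zero. Their real parts are nonnegative because
`|χ| ≤ 3`, so each real part vanishes. -/
theorem moduleCharacter_eq_zero_or_of_large (hd : 9 ≤ finrank ℂ V) (g : G) (hg : g ≠ 1) :
    moduleCharacter V g = 0 ∨ moduleCharacter V g = -3 := by
  classical
  have := finiteDimensional_of_isSimpleModule (G := G) V
  obtain ⟨s, hs, hsum⟩ := exists_multiplicity_defect hcard (by omega)
  obtain rfl : s = 0 := by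
    by_contra h
    have : 1 ≤ s := Nat.one_le_iff_ne_zero.mpr h
    nlinarith
  set d := finrank ℂ V with hd_def
  have hG : (Nat.card G : ℂ) = d * (d + 3) := by rw [← hcard]; push_cast; ring
  have hnorm := sum_character_norm (G := G) V
  let F : G → ℂ := fun g => moduleCharacter V g⁻¹ * moduleCharacter V g * (moduleCharacter V g + 3)
  have hF : ∑ g : G, F g = F 1 := by
    have h1 : ∑ g : G, F g =
        ∑ g : G, moduleCharacter V g * moduleCharacter V g * moduleCharacter V g⁻¹ +
        3 * ∑ g : G, moduleCharacter V g⁻¹ * moduleCharacter V g := by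
      rw [Finset.mul_sum, ← Finset.sum_add_distrib]
      refine Finset.sum_congr rfl fun g _ => ?_
      simp only [F]; ring
    rw [h1, hsum, hnorm, hG]
    simp only [F, inv_one, moduleCharacter_one, ← hd_def]
    push_cast; ring
  have hre : ∀ g : G, F g = ((‖moduleCharacter V g‖ ^ 2 : ℝ) : ℂ) * (moduleCharacter V g + 3) := by
    intro g
    simp only [F]
    rw [moduleCharacter_inv, mul_comm ((starRingEnd ℂ) _), Complex.mul_conj,
      Complex.normSq_eq_norm_sq]
  have h0 : ∑ g ∈ Finset.univ.erase (1 : G),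
      ‖moduleCharacter V g‖ ^ 2 * ((moduleCharacter V g).re + 3) = 0 := by
    have h1 := Finset.sum_erase_add Finset.univ F (Finset.mem_univ (1 : G))
    rw [hF] at h1
    have h2 : ∑ g ∈ Finset.univ.erase (1 : G), F g = 0 := by linear_combination h1
    have h3 := congrArg Complex.re h2
    rw [Complex.re_sum] at h3
    rw [← Complex.zero_re, ← h3]
    refine Finset.sum_congr rfl fun g _ => ?_
    rw [hre, Complex.re_ofReal_mul]
    simp
  have hbound : ∀ g : G, g ≠ 1 → -3 ≤ (moduleCharacter V g).re := by
    intro g hg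
    have := (abs_le.mp ((Complex.abs_re_le_norm _).trans (norm_moduleCharacter_le_three hcard hg)))
    exact this.1
  have h4 := (Finset.sum_eq_zero_iff_of_nonneg (fun g hg => mul_nonneg (sq_nonneg _)
    (by linarith [hbound g (Finset.ne_of_mem_erase hg)]))).mp h0 g
    (Finset.mem_erase.mpr ⟨hg, Finset.mem_univ _⟩)
  rcases mul_eq_zero.mp h4 with h | h
  · left
    exact norm_eq_zero.mp (pow_eq_zero_iff two_ne_zero |>.mp h)
  · right
    have h5 : (moduleCharacter V g).re = -3 := by linarith
    have h6 := norm_moduleCharacter_le_three hcard hg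
    exact eq_neg_three_of_re h5 h6

end

end LargeDegree

/-! ### Sylow arguments for small orders -/

section SmallOrders

/-- If the Sylow `p`-subgroup is normal of prime order and its automizer is small, there is an
element of order `p * q`. -/
theorem exists_orderOf_eq_mul {G : Type*} [Group G] [Finite G] {p q m : ℕ} (hp : p.Prime)
    (hq : q.Prime) (hpq : p ≠ q) (hG : Nat.card G = p * m) (hpm : ¬ p ∣ m)
    (hsyl : ∀ k, k ∣ m → k ≡ 1 [MOD p] → k = 1)
    (haut : ∀ i, i ∣ p - 1 → i ∣ m → q ∣ m / i) : ∃ z : G, orderOf z = p * q := by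
  have : Fact p.Prime := ⟨hp⟩
  have : Fact q.Prime := ⟨hq⟩
  have hm0 : m ≠ 0 := fun h => hpm (h ▸ dvd_zero p)
  let P : Sylow p G := default
  have hPcard : Nat.card P = p := by
    have hfac : m.factorization p = 0 := Nat.factorization_eq_zero_of_not_dvd hpm
    rw [P.card_eq_multiplicity, hG, Nat.factorization_mul hp.ne_zero hm0, Finsupp.add_apply,
      hp.factorization_self, hfac, pow_one]
  have hindex : (P : Subgroup G).index = m := by
    have := (P : Subgroup G).card_mul_index
    rw [hPcard, hG] at this
    exact Nat.eq_of_mul_eq_mul_left hp.pos this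
  have hone : Nat.card (Sylow p G) = 1 :=
    hsyl _ (hindex ▸ P.card_dvd_index) (card_sylow_modEq_one p G)
  have : Subsingleton (Sylow p G) := (Nat.card_eq_one_iff_unique.mp hone).1
  have hnormal : (P : Subgroup G).Normal := P.normal_of_subsingleton
  let C := Subgroup.centralizer ((P : Subgroup G) : Set G)
  have hcyc : IsCyclic P := isCyclic_of_prime_card hPcard
  have hker : (MulAut.conjNormal (H := (P : Subgroup G))).ker = C := by
    ext g
    rw [MonoidHom.mem_ker, Subgroup.mem_centralizer_iff, MulEquiv.ext_iff, Subtype.forall]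
    refine forall₂_congr fun x hx => ?_
    rw [Subtype.ext_iff, MulAut.conjNormal_apply, MulAut.one_apply, mul_inv_eq_iff_eq_mul, eq_comm]
  -- The quotient by `C` embeds in the automorphism group of `P`, of order `p - 1`. The index also
  -- divides `m`, so `haut` leaves a factor `q` in the order of `C`.
  have hi1 : C.index ∣ p - 1 := by
    rw [← hker, Subgroup.index_ker, ← Nat.totient_prime hp]
    have := Subgroup.card_subgroup_dvd_card (MulAut.conjNormal (H := (P : Subgroup G))).range
    rwa [IsCyclic.card_mulAut, hPcard] at this
  have hPC : (P : Subgroup G) ≤ C := by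
    intro x hx
    rw [Subgroup.mem_centralizer_iff]
    intro y hy
    exact congrArg Subtype.val (hcyc.isMulCommutative.is_comm.comm (⟨y, hy⟩ : P) ⟨x, hx⟩)
  have hi2 : C.index ∣ m := hindex ▸ Subgroup.index_dvd_of_le hPC
  have hqC : q ∣ Nat.card C := by
    have h1 := C.card_mul_index
    obtain ⟨c, hc⟩ := hi2
    have hci : C.index ≠ 0 := by rintro h; rw [h, zero_mul] at hc; exact hm0 hc
    have h2 : Nat.card C = p * c := by
      rw [hG, hc] at h1
      apply Nat.eq_of_mul_eq_mul_right (Nat.pos_of_ne_zero hci)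
      rw [h1]; ring
    have h3 := haut _ hi1 ⟨c, hc⟩
    rw [hc, Nat.mul_div_cancel_left _ (Nat.pos_of_ne_zero hci)] at h3
    exact h2 ▸ h3.mul_left p
  obtain ⟨y, hy⟩ := exists_prime_orderOf_dvd_card' q hqC
  obtain ⟨x, hx⟩ := exists_prime_orderOf_dvd_card' (G := P) p hPcard.symm.dvd
  have hcomm : Commute (x : G) (y : G) := Subgroup.mem_centralizer_iff.mp y.2 x x.2
  refine ⟨x * y, ?_⟩
  rw [hcomm.orderOf_mul_eq_mul_orderOf_of_coprime, Subgroup.orderOf_coe, Subgroup.orderOf_coe,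
    hx, hy]
  rw [Subgroup.orderOf_coe, Subgroup.orderOf_coe, hx, hy]
  exact (Nat.coprime_primes hp hq).mpr hpq

/-- A noncommutative group of order `p ^ 3` has center of order `p`, containing all
commutators. -/
theorem card_center_of_card_eq_prime_cube {K : Type*} [Group K] {p : ℕ} [hp : Fact p.Prime]
    (hK : Nat.card K = p ^ 3) (hcomm : ¬ ∀ a b : K, a * b = b * a) :
    Nat.card (Subgroup.center K) = p ∧ ∀ a b : K, a * b * a⁻¹ * b⁻¹ ∈ Subgroup.center K := by
  have : Finite K := Nat.finite_of_card_ne_zero (by rw [hK]; exact pow_ne_zero _ hp.out.ne_zero)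
  obtain ⟨k, hk0, hk⟩ := IsPGroup.card_center_eq_prime_pow hK (by norm_num)
  have hmul := (Subgroup.center K).card_mul_index
  have hncyc : ¬ IsCyclic (K ⧸ Subgroup.center K) := fun h => hcomm fun a b =>
    (isMulCommutative_of_isCyclic_quotient_center_self K).is_comm.comm a b
  have hk3 : k ≤ 3 := by
    have := (Subgroup.center K).card_subgroup_dvd_card
    rw [hk, hK] at this
    exact (Nat.pow_dvd_pow_iff_le_right hp.out.one_lt).mp this
  have hindex : (Subgroup.center K).index = p ^ (3 - k) := by
    apply Nat.eq_of_mul_eq_mul_left (pow_pos hp.out.pos k)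
    rw [← hk, hmul, hK, hk, ← pow_add, Nat.add_sub_cancel' hk3]
  -- A larger centre would have a quotient of order at most `p`, hence cyclic, and the group would
  -- be commutative.
  have hk1 : k = 1 := by
    by_contra hne
    apply hncyc
    apply isCyclic_of_card_dvd_prime (p := p)
    rw [← Subgroup.index_eq_card, hindex]
    exact (pow_dvd_pow p (by omega : 3 - k ≤ 1)).trans (pow_one p).dvd
  subst hk1
  refine ⟨by rw [hk, pow_one], fun a b => ?_⟩
  have hq : Nat.card (K ⧸ Subgroup.center K) = p ^ 2 := by
    rw [← Subgroup.index_eq_card, hindex]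
  have h := (IsPGroup.isMulCommutative_of_card_eq_prime_sq hq).is_comm.comm
    (a : K ⧸ Subgroup.center K) b
  rw [← QuotientGroup.eq_one_iff]
  rw [QuotientGroup.mk_mul, QuotientGroup.mk_mul, QuotientGroup.mk_mul, h, QuotientGroup.mk_inv,
    QuotientGroup.mk_inv, mul_inv_cancel_right, mul_inv_cancel]

end SmallOrders

/-! ### Character values in degrees three to eight -/

section SmallDegree

variable {G : Type*} [Group G] {V : Type*} [AddCommGroup V] [Module ℂ V] [Module ℂ[G] V]
  [IsScalarTower ℂ ℂ[G] V] [IsSimpleModule ℂ[G] V]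

theorem finrank_mul_orderOf_le [Finite G] (z : G) : finrank ℂ V * orderOf z ≤ Nat.card G := by
  have h := finrank_le_index_of_isMulCommutative (V := V) (Subgroup.zpowers z) (by
    rintro a ⟨i, rfl⟩ b ⟨j, rfl⟩
    exact (Commute.refl z).zpow_zpow i j)
  calc finrank ℂ V * orderOf z ≤ (Subgroup.zpowers z).index * orderOf z :=
        Nat.mul_le_mul_right _ h
    _ = Nat.card G := by rw [← Nat.card_zpowers, mul_comm, Subgroup.card_mul_index]

variable [Fintype G] (hcard : finrank ℂ V * (finrank ℂ V + 3) = Nat.card G)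

include hcard

/-- If a normal subgroup of order three has no fixed vectors in a module of dimension six, then
the character vanishes off this subgroup. -/
theorem moduleCharacter_eq_zero_or_of_fixed_eq_zero (h6 : finrank ℂ V = 6) (N : Subgroup G)
    (hN : Nat.card N = 3)
    (hfix : ∀ v : V, (∀ g ∈ N, MonoidAlgebra.of ℂ G g • v = v) → v = 0) (g : G) (hg : g ≠ 1) :
    moduleCharacter V g = 0 ∨ moduleCharacter V g = -3 := by
  classical
  have := finiteDimensional_of_isSimpleModule (G := G) V
  have h1 : moduleCharacter V (1 : G) = 6 := by rw [moduleCharacter_one, h6]; norm_num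
  let S : Finset G := Finset.univ.filter (· ∈ N)
  have hScard : S.card = 3 := by
    rw [← hN, Nat.card_eq_fintype_card, Fintype.card_subtype]
  have hS1 : (1 : G) ∈ S := Finset.mem_filter.mpr ⟨Finset.mem_univ _, N.one_mem⟩
  have hsumN : ∑ z ∈ S, moduleCharacter V z = 0 := by
    rw [Finset.sum_subtype S (p := (· ∈ N)) (by simp [S])]
    simpa using sum_character_coset_eq_zero (V := V) N hfix 1
  have hge : ∀ z : G, z ≠ 1 → -3 ≤ (moduleCharacter V z).re := fun z hz =>
    (abs_le.mp ((Complex.abs_re_le_norm _).trans (norm_moduleCharacter_le_three hcard hz))).1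
  -- The values on `N` sum to zero and the value at `1` is `6`. The two others have real part at
  -- least `-3`, so both equal `-3`.
  have hval : ∀ z ∈ S.erase 1, moduleCharacter V z = -3 := by
    have hzero : ∑ z ∈ S.erase 1, ((moduleCharacter V z).re + 3) = 0 := by
      rw [Finset.sum_add_distrib, ← Complex.re_sum, Finset.sum_const, Finset.card_erase_of_mem hS1,
        hScard]
      have := Finset.add_sum_erase S (fun z => moduleCharacter V z) hS1
      rw [hsumN, h1] at this
      rw [show ∑ z ∈ S.erase 1, moduleCharacter V z = -6 by linear_combination this]
      norm_num
    intro z hz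
    have hz1 := Finset.ne_of_mem_erase hz
    have := (Finset.sum_eq_zero_iff_of_nonneg (fun y hy => by
      linarith [hge y (Finset.ne_of_mem_erase hy)])).mp hzero z hz
    exact eq_neg_three_of_re (by linarith) (norm_moduleCharacter_le_three hcard hz1)
  by_cases hgN : g ∈ S
  · exact Or.inr (hval g (Finset.mem_erase.mpr ⟨hg, hgN⟩))
  left
  have hnorm := sum_character_norm (G := G) V
  have hsq : ∀ z : G, moduleCharacter V z⁻¹ * moduleCharacter V z =
      ((‖moduleCharacter V z‖ ^ 2 : ℝ) : ℂ) := by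
    intro z
    rw [moduleCharacter_inv, mul_comm, Complex.mul_conj, Complex.normSq_eq_norm_sq]
  simp only [hsq, ← Complex.ofReal_sum] at hnorm
  rw [← hcard, h6] at hnorm
  have hnorm' : ∑ z : G, ‖moduleCharacter V z‖ ^ 2 = 54 := by exact_mod_cast hnorm
  -- The three elements of `N` contribute `36 + 9 + 9`, the whole norm of the character, so nothing
  -- remains outside `N`.
  have hSsum : ∑ z ∈ S, ‖moduleCharacter V z‖ ^ 2 = 54 := by
    rw [← Finset.add_sum_erase S _ hS1, h1, Finset.sum_congr rfl fun z hz => by rw [hval z hz],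
      Finset.sum_const, Finset.card_erase_of_mem hS1, hScard]
    norm_num
  have hcompl := Finset.sum_add_sum_compl S (fun z => ‖moduleCharacter V z‖ ^ 2)
  rw [hnorm', hSsum] at hcompl
  have := (Finset.sum_eq_zero_iff_of_nonneg (fun z _ => sq_nonneg _)).mp
    (by linarith : ∑ z ∈ Sᶜ, ‖moduleCharacter V z‖ ^ 2 = 0) g (Finset.mem_compl.mpr hgN)
  exact norm_eq_zero.mp (pow_eq_zero_iff two_ne_zero |>.mp this)

/-- A subgroup `P` of order `27` has index `2 < 6`, so it is not abelian, and its centre has order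
`3` and contains all commutators of `P`. If the centre fixed a nonzero vector, it would act
trivially, `P` would act by commuting operators, and the index bound would fail again. -/
theorem moduleCharacter_eq_zero_or_of_six (h6 : finrank ℂ V = 6) (g : G) (hg : g ≠ 1) :
    moduleCharacter V g = 0 ∨ moduleCharacter V g = -3 := by
  have hG : Nat.card G = 54 := by rw [← hcard, h6]
  have : Fact (Nat.Prime 3) := ⟨Nat.prime_three⟩
  obtain ⟨P, hP⟩ := Sylow.exists_subgroup_card_pow_prime (G := G) 3 (n := 3) (by rw [hG]; norm_num)
  have hindex : P.index = 2 := by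
    have := P.card_mul_index
    rw [hP, hG] at this
    omega
  have hPn : P.Normal := Subgroup.normal_of_index_eq_two hindex
  have hPnc : ¬ ∀ a b : P, a * b = b * a := by
    intro h
    have := finrank_le_index_of_isMulCommutative (V := V) P
      fun a ha b hb => congrArg Subtype.val (h ⟨a, ha⟩ ⟨b, hb⟩)
    omega
  obtain ⟨hZ, hcomm⟩ := card_center_of_card_eq_prime_cube hP hPnc
  let N : Subgroup G := (Subgroup.center P).map P.subtype
  have hN : Nat.card N = 3 := by
    rw [← hZ]
    exact Nat.card_congr (Subgroup.equivMapOfInjective _ _ P.subtype_injective).symm.toEquiv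
  have hNn : N.Normal := inferInstance
  refine moduleCharacter_eq_zero_or_of_fixed_eq_zero hcard h6 N hN (fun v hv => ?_) g hg
  by_contra hv0
  have htriv := smul_eq_of_exists_fixed N hv0 hv
  have := finrank_le_index_of_commute (V := V) P fun a ha b hb w => by
    have h1 : a * b = (a * b * a⁻¹ * b⁻¹) * (b * a) := by group
    rw [h1, map_mul, mul_smul, htriv]
    exact ⟨_, hcomm ⟨a, ha⟩ ⟨b, hb⟩, rfl⟩
  omega

/-- A character of large degree takes only the values `0` and `-3` off the identity. -/
theorem moduleCharacter_eq_zero_or (hd : 3 ≤ finrank ℂ V) (g : G) (hg : g ≠ 1) :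
    moduleCharacter V g = 0 ∨ moduleCharacter V g = -3 := by
  rcases le_or_gt 9 (finrank ℂ V) with h9 | h9
  · exact moduleCharacter_eq_zero_or_of_large hcard h9 g hg
  have key : ∀ p q m : ℕ, p.Prime → q.Prime → p ≠ q → Nat.card G = p * m → ¬ p ∣ m →
      (∀ k, k ∣ m → k ≡ 1 [MOD p] → k = 1) → (∀ i, i ∣ p - 1 → i ∣ m → q ∣ m / i) →
      finrank ℂ V * (p * q) ≤ Nat.card G := by
    intro p q m hp hq hpq hG hpm hsyl haut
    obtain ⟨z, hz⟩ := exists_orderOf_eq_mul hp hq hpq hG hpm hsyl haut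
    rw [← hz]
    exact finrank_mul_orderOf_le z
  obtain ⟨d, hd'⟩ : ∃ d, finrank ℂ V = d := ⟨_, rfl⟩
  rw [hd'] at key hd h9 hcard
  have hfin : ∀ p q m : ℕ, 0 < m →
      (∀ k ∈ Finset.range (m + 1), k ∣ m → k ≡ 1 [MOD p] → k = 1) →
      (∀ i ∈ Finset.range (m + 1), i ∣ p - 1 → i ∣ m → q ∣ m / i) →
      (∀ k, k ∣ m → k ≡ 1 [MOD p] → k = 1) ∧ (∀ i, i ∣ p - 1 → i ∣ m → q ∣ m / i) :=
    fun p q m hm h1 h2 => ⟨fun k hk => h1 k (Finset.mem_range_succ_iff.mpr (Nat.le_of_dvd hm hk)) hk,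
      fun i hi hi' => h2 i (Finset.mem_range_succ_iff.mpr (Nat.le_of_dvd hm hi')) hi hi'⟩
  -- The orders are `18, 28, 40, 54, 70, 88`. Apart from `54`, each forces an abelian subgroup of
  -- index less than `d`: of order `9` for `18`, and cyclic of order `14, 10, 35, 22` for the
  -- others.
  interval_cases d
  · exfalso
    have : Fact (Nat.Prime 3) := ⟨Nat.prime_three⟩
    obtain ⟨P, hP⟩ := Sylow.exists_subgroup_card_pow_prime (G := G) 3 (n := 2)
      (by rw [← hcard]; norm_num)
    have hindex := P.card_mul_index
    rw [hP, ← hcard] at hindex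
    have := finrank_le_index_of_isMulCommutative (V := V) P fun a ha b hb =>
      congrArg Subtype.val
        ((IsPGroup.isMulCommutative_of_card_eq_prime_sq hP).is_comm.comm (⟨a, ha⟩ : P) ⟨b, hb⟩)
    omega
  · exfalso
    obtain ⟨h1, h2⟩ := hfin 7 2 4 (by norm_num) (by decide) (by decide)
    have := key 7 2 4 (by norm_num) (by norm_num) (by norm_num) (by omega) (by norm_num) h1 h2
    omega
  · exfalso
    obtain ⟨h1, h2⟩ := hfin 5 2 8 (by norm_num) (by decide) (by decide)
    have := key 5 2 8 (by norm_num) (by norm_num) (by norm_num) (by omega) (by norm_num) h1 h2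
    omega
  · exact moduleCharacter_eq_zero_or_of_six (by rw [hd', ← hcard]) hd' g hg
  · exfalso
    obtain ⟨h1, h2⟩ := hfin 7 5 10 (by norm_num) (by decide) (by decide)
    have := key 7 5 10 (by norm_num) (by norm_num) (by norm_num) (by omega) (by norm_num) h1 h2
    omega
  · exfalso
    obtain ⟨h1, h2⟩ := hfin 11 2 8 (by norm_num) (by decide) (by decide)
    have := key 11 2 8 (by norm_num) (by norm_num) (by norm_num) (by omega) (by norm_num) h1 h2
    omega

end SmallDegree

/-! ### The normal subgroup acting trivially off `V` -/

/-- A nontrivial normal subgroup `N` of `G` whose nontrivial elements are all conjugate, such that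
`G` has order `9 * n * (n - 1)` for `n = #N`, and such that a subgroup `H` with
`N ⊓ H` not contained in `⁅H, H⁆` has order dividing `3 * n`. -/
structure IsFusedNormalSubgroup {G : Type*} [Group G] (N : Subgroup G) : Prop where
  normal : N.Normal
  ne_bot : N ≠ ⊥
  conj : ∀ x ∈ N, ∀ y ∈ N, x ≠ 1 → y ≠ 1 → ∃ g : G, g * x * g⁻¹ = y
  card : Nat.card G = 9 * Nat.card N * (Nat.card N - 1)
  dvd : ∀ (H : Subgroup G), ∀ x ∈ H, x ∈ N → x ∉ ⁅H, H⁆ → Nat.card H ∣ 3 * Nat.card N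

/-- A linear character of a finite group which is nontrivial at a given element outside the
commutator subgroup. -/
theorem exists_linearCharacter_apply_ne_one {H : Type*} [Group H] [Finite H] {x : H}
    (hx : x ∉ commutator H) : ∃ μ : H →* ℂˣ, μ x ≠ 1 := by
  have : Finite (Abelianization H) := inferInstanceAs (Finite (H ⧸ commutator H))
  have hx' : Abelianization.of x ≠ 1 := fun h => hx (by
    rwa [← MonoidHom.mem_ker, Abelianization.ker_of] at h)
  have : NeZero (Monoid.exponent (Abelianization H)) :=
    ⟨Monoid.exponent_ne_zero_of_finite⟩
  obtain ⟨φ, hφ⟩ := CommGroup.exists_apply_ne_one_of_hasEnoughRootsOfUnity (Abelianization H) ℂ hx'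
  exact ⟨φ.comp Abelianization.of, hφ⟩

section OffKernel

variable {G : Type*} [Group G] [Fintype G] (V : Type*) [AddCommGroup V] [Module ℂ V]
  [Module ℂ[G] V] [IsScalarTower ℂ ℂ[G] V]

/-- The elements of `G` acting trivially on all simple modules other than `V`. -/
noncomputable def offKernel : Subgroup G where
  carrier := {g | ∀ x ∈ complementaryIdeal (G := G) V, MonoidAlgebra.of ℂ G g * x = x}
  one_mem' := fun x _ => by rw [map_one, one_mul]
  mul_mem' := fun {a b} ha hb x hx => by rw [map_mul, mul_assoc, hb x hx, ha x hx]
  inv_mem' := fun {a} ha x hx => by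
    conv_lhs => rw [← ha x hx]
    rw [← mul_assoc, ← map_mul, inv_mul_cancel, map_one, one_mul]

theorem offKernel_normal : (offKernel (G := G) V).Normal := by
  refine ⟨fun g hg h x hx => ?_⟩
  rw [map_mul, map_mul, mul_assoc, mul_assoc, 
    hg (MonoidAlgebra.of ℂ G h⁻¹ * x) ((complementaryIdeal V).smul_mem _ hx),
    ← mul_assoc, ← map_mul, mul_inv_cancel, map_one, one_mul]

variable [IsSimpleModule ℂ[G] V]

theorem one_sub_characterIdempotent_mem :
    1 - characterIdempotent V ∈ complementaryIdeal (G := G) V := by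
  rw [mem_complementaryIdeal, sub_mul, one_mul, characterIdempotent_isIdempotentElem.eq, sub_self]

theorem actsTriviallyOffModule_offKernel : ActsTriviallyOffModule (offKernel (G := G) V) V := by
  intro W _ _ _ hW g hg w
  have h1 : w = (1 - characterIdempotent (G := G) V) • w := by
    rw [sub_smul, one_smul, characterIdempotent_smul_eq_zero hW, sub_zero]
  conv_lhs => rw [h1, ← mul_smul, hg _ (one_sub_characterIdempotent_mem V)]
  exact h1.symm

variable {V} (hcard : finrank ℂ V * (finrank ℂ V + 3) = Nat.card G) (hd : 3 ≤ finrank ℂ V)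

include hcard

theorem moduleCharacter_of_mem_offKernel {g : G} (hg : g ∈ offKernel (G := G) V) (hg1 : g ≠ 1) :
    moduleCharacter V g = -3 :=
  moduleCharacter_eq_of_mul_eq_self hcard hg1 hg

include hd

theorem moduleCharacter_of_notMem_offKernel {g : G} (hg : g ∉ offKernel (G := G) V) :
    moduleCharacter V g = 0 := by
  have hg1 : g ≠ 1 := fun h => hg (h ▸ one_mem _)
  refine (moduleCharacter_eq_zero_or hcard hd g hg1).resolve_right fun h => hg ?_
  exact fun x hx => mul_eq_self_of_moduleCharacter_eq hcard hg1 h hx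

/-- The character is `d` at `1`, `-3` on the rest of `N` and `0` elsewhere, so its norm relation
reads `d² + 9(n - 1) = d(d + 3)`. -/
theorem card_offKernel : finrank ℂ V + 3 = 3 * Nat.card (offKernel (G := G) V) := by
  classical
  have := finiteDimensional_of_isSimpleModule (G := G) V
  have hnorm := sum_character_norm (G := G) V
  set d := finrank ℂ V with hd_def
  have hterm : ∀ g : G, moduleCharacter V g⁻¹ * moduleCharacter V g =
      (if g ∈ offKernel (G := G) V then 9 else 0) + if g = 1 then (d : ℂ) ^ 2 - 9 else 0 := by
    intro g
    by_cases h1 : g = 1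
    · subst h1
      rw [if_pos (one_mem _), if_pos rfl, inv_one, moduleCharacter_one]
      ring
    · rw [if_neg h1, add_zero]
      split_ifs with h
      · rw [moduleCharacter_of_mem_offKernel hcard h h1,
          moduleCharacter_of_mem_offKernel hcard (inv_mem h) (inv_ne_one.mpr h1)]
        norm_num
      · rw [moduleCharacter_of_notMem_offKernel hcard hd h, mul_zero]
  rw [Finset.sum_congr rfl fun g _ => hterm g, Finset.sum_add_distrib, ← hcard,
    Finset.sum_ite_eq' Finset.univ (1 : G), if_pos (Finset.mem_univ _), Finset.sum_ite,
    Finset.sum_const, Finset.sum_const_zero, add_zero, nsmul_eq_mul] at hnorm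
  have hc : (Finset.univ.filter (· ∈ offKernel (G := G) V)).card =
      Nat.card (offKernel (G := G) V) := by
    rw [Nat.card_eq_fintype_card, Fintype.card_subtype]
  rw [hc] at hnorm
  have h2 : ((3 * (d + 3) : ℕ) : ℂ) = ((3 * (3 * Nat.card (offKernel (G := G) V)) : ℕ) : ℂ) := by
    push_cast at hnorm ⊢
    linear_combination -hnorm
  have h3 : 3 * (d + 3) = 3 * (3 * Nat.card (offKernel (G := G) V)) := by exact_mod_cast h2
  omega

-- The difference of the conjugation sums of `x` and `y` is central. It kills the complementary
-- ideal, where `N` acts trivially, and on `V` it is a scalar of trace zero because `χ(x) = χ(y)`.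
-- So the two sums coincide, and `y` occurs in that of `x`.
omit hd in
theorem offKernel_conj {x y : G} (hx : x ∈ offKernel (G := G) V) (hy : y ∈ offKernel (G := G) V)
    (hx1 : x ≠ 1) (hy1 : y ≠ 1) : ∃ g : G, g * x * g⁻¹ = y := by
  classical
  have := finiteDimensional_of_isSimpleModule (G := G) V
  let s : G → ℂ[G] := fun x => ∑ h : G, MonoidAlgebra.of ℂ G (h * x * h⁻¹)
  have hs : ∀ x a, s x * a = a * s x := by
    intro x a
    induction a using MonoidAlgebra.induction_on with
    | of k =>
      simp only [s]
      rw [Finset.sum_mul, Finset.mul_sum, ← Equiv.sum_comp (Equiv.mulLeft k)]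
      refine Finset.sum_congr rfl fun h _ => ?_
      rw [← map_mul, ← map_mul]
      congr 1
      change k * h * x * (k * h)⁻¹ * k = _
      group
    | add a b ha hb => rw [mul_add, add_mul, ha, hb]
    | smul r a ha => rw [mul_smul_comm, smul_mul_assoc, ha]
  let z := s x - s y
  have hz : ∀ a, z * a = a * z := fun a => by rw [sub_mul, mul_sub, hs, hs]
  have hsJ : ∀ x ∈ offKernel (G := G) V, ∀ a ∈ complementaryIdeal (G := G) V,
      s x * a = Fintype.card G • a := by
    intro x hx a ha
    simp only [s]
    rw [Finset.sum_mul, Finset.sum_congr rfl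
      fun h _ => (offKernel_normal V).conj_mem x hx h a ha, Finset.sum_const, Finset.card_univ]
  have hzJ : z * (1 - characterIdempotent V) = 0 := by
    rw [sub_mul, hsJ x hx _ (one_sub_characterIdempotent_mem V),
      hsJ y hy _ (one_sub_characterIdempotent_mem V), sub_self]
  have hstr : ∀ x, LinearMap.trace ℂ V (Algebra.lsmul ℂ ℂ V (s x)) =
      Fintype.card G * moduleCharacter V x := by
    intro x
    simp only [s]
    rw [map_sum, map_sum, Finset.sum_congr rfl fun h _ => ?_, Finset.sum_const, Finset.card_univ,
      nsmul_eq_mul]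
    rw [← moduleCharacter_eq_trace, moduleCharacter_conj]
  have hzV : ∀ v : V, z • v = 0 := by
    obtain ⟨c, hc⟩ := exists_scalar_of_commute (W := V) hz
    have h1 : Algebra.lsmul ℂ ℂ V z = c • LinearMap.id := LinearMap.ext hc
    have h2 := congrArg (LinearMap.trace ℂ V) h1
    rw [map_smul, LinearMap.trace_id, map_sub, map_sub, hstr, hstr,
      moduleCharacter_of_mem_offKernel hcard hx hx1, moduleCharacter_of_mem_offKernel hcard hy hy1,
      sub_self, smul_eq_mul] at h2
    have hpos : (finrank ℂ V : ℂ) ≠ 0 := by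
      exact_mod_cast (finrank_pos_of_isSimpleModule (G := G) V).ne'
    intro v
    rw [hc, (mul_eq_zero.mp h2.symm).resolve_right hpos, zero_smul]
  have hz0 : z = 0 := eq_zero_of_smul_eq_zero hzV (by
    rw [mul_sub, mul_one, sub_eq_zero] at hzJ
    exact hzJ.symm)
  have hcoeff : ∀ x, (s x).coeff y = ((Finset.univ.filter fun h : G => h * x * h⁻¹ = y).card : ℂ) := by
    intro x
    simp [s, MonoidAlgebra.coeff_sum, MonoidAlgebra.of_apply, MonoidAlgebra.coeff_single,
      Finsupp.single_apply]
  have h1 : s x = s y := sub_eq_zero.mp hz0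
  have h2 := congrArg (fun a : ℂ[G] => a.coeff y) h1
  simp only [hcoeff] at h2
  have h3 : 0 < (Finset.univ.filter fun h : G => h * y * h⁻¹ = y).card :=
    Finset.card_pos.mpr ⟨1, by simp⟩
  have h4 : 0 < (Finset.univ.filter fun h : G => h * x * h⁻¹ = y).card := by
    rw [Nat.cast_inj.mp h2]; exact h3
  obtain ⟨g, hg⟩ := Finset.card_pos.mp h4
  exact ⟨g, (Finset.mem_filter.mp hg).2⟩

/-- As a function on `G`, `χ` is `3n` times the indicator of `1` minus `3` times that of `N`. For a
linear character `μ` of `H` nontrivial at `x`, the sum of `μ` over `N ∩ H` vanishes, so that of `μ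
χ` over `H` is `3n`; it is a multiple of `|H|`. -/
theorem card_dvd_of_notMem_commutator (H : Subgroup G) {x : G} (hxH : x ∈ H)
    (hxN : x ∈ offKernel (G := G) V) (hx : x ∉ ⁅H, H⁆) :
    Nat.card H ∣ 3 * Nat.card (offKernel (G := G) V) := by
  classical
  have := finiteDimensional_of_isSimpleModule (G := G) V
  set N := offKernel (G := G) V with hN
  obtain ⟨μ, hμ⟩ := exists_linearCharacter_apply_ne_one (x := (⟨x, hxH⟩ : H)) (by
    intro h
    apply hx
    rw [← Subgroup.map_subtype_commutator]
    exact ⟨_, h, rfl⟩)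
  obtain ⟨m, hm⟩ := exists_sum_character_linear (V := V) H μ
  have hn := card_offKernel hcard hd
  have hterm : ∀ h : H, (μ h : ℂ) * moduleCharacter V (h : G) =
      (if h = 1 then (3 * Nat.card N : ℂ) else 0) -
        3 * (if h ∈ N.subgroupOf H then (μ h : ℂ) else 0) := by
    intro h
    by_cases h1 : h = 1
    · subst h1
      rw [if_pos rfl, if_pos (one_mem _), Subgroup.coe_one, moduleCharacter_one, map_one,
        Units.val_one]
      have : (finrank ℂ V : ℂ) + 3 = 3 * Nat.card N := by exact_mod_cast hn
      linear_combination this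
    · have h1' : (h : G) ≠ 1 := fun h' => h1 (Subtype.ext h')
      rw [if_neg h1, Subgroup.mem_subgroupOf]
      split_ifs with h
      · rw [moduleCharacter_of_mem_offKernel hcard h h1']; ring
      · rw [moduleCharacter_of_notMem_offKernel hcard hd h]; ring
  have hzero : ∑ h : H, (if h ∈ N.subgroupOf H then (μ h : ℂ) else 0) = 0 := by
    rw [← Finset.sum_filter, Finset.sum_subtype _ (p := (· ∈ N.subgroupOf H)) (by simp)]
    refine sum_hom_units_eq_zero
      (((Units.coeHom ℂ).comp μ).comp (N.subgroupOf H).subtype) fun h => hμ ?_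
    have := DFunLike.congr_fun h ⟨⟨x, hxH⟩, hxN⟩
    exact Units.ext this
  rw [Finset.sum_congr rfl fun h _ => hterm h, Finset.sum_sub_distrib, ← Finset.mul_sum, hzero,
    Finset.sum_ite_eq' Finset.univ (1 : H), if_pos (Finset.mem_univ _), mul_zero, sub_zero] at hm
  exact ⟨m, by exact_mod_cast hm⟩

theorem isFusedNormalSubgroup_offKernel : IsFusedNormalSubgroup (offKernel (G := G) V) where
  normal := offKernel_normal V
  ne_bot := fun h => by
    have := card_offKernel hcard hd
    rw [h, Subgroup.card_bot] at this
    omega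
  conj := fun _ hx _ hy => offKernel_conj hcard hx hy
  card := by
    have := card_offKernel hcard hd
    have h1 : finrank ℂ V = 3 * (Nat.card (offKernel (G := G) V) - 1) := by omega
    rw [← hcard, this, h1]
    ring
  dvd := fun H _ hxH hxN hx => card_dvd_of_notMem_commutator hcard hd H hxH hxN hx

end OffKernel

/-! ### Commutator subgroups and fixed points in abstract groups -/

section AbstractGroups

open scoped commutatorElement

theorem eq_bot_of_le_commutator {K : Type*} [Group K] [Group.IsNilpotent K] {M : Subgroup K}
    (h : M ≤ ⁅M, ⊤⁆) : M = ⊥ := by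
  obtain ⟨n, hn⟩ := Subgroup.nilpotent_iff_lowerCentralSeries.mp ‹Group.IsNilpotent K›
  rw [eq_bot_iff, ← hn]
  clear hn
  induction n with
  | zero => exact le_top
  | succ n ih => exact h.trans (Subgroup.commutator_mono ih le_top)

/-- A nilpotent group with an endomorphism inverting the commutator subgroup (of exponent three)
and fixing its quotient is commutative. -/
theorem commutator_eq_bot_of_inverting {K : Type*} [Group K] [Group.IsNilpotent K]
    (τ : K →* K) (hcomm : ∀ a ∈ commutator K, ∀ b ∈ commutator K, a * b = b * a)
    (hcube : ∀ a ∈ commutator K, a ^ 3 = 1) (hinv : ∀ a ∈ commutator K, τ a = a⁻¹)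
    (hfix : ∀ c, τ c * c⁻¹ ∈ commutator K) : commutator K = ⊥ := by
  -- By nilpotency it is enough to place every commutator in `[K', K]`. Each `c` splits as `w e`
  -- with `w = τ(c) c⁻¹` in `K'` and `e` fixed by `τ`, using `w³ = 1`. A commutator of fixed
  -- elements is both fixed and inverted, hence trivial, so only commutators involving a `w`
  -- survive.
  apply eq_bot_of_le_commutator
  have hdec : ∀ c : K, ∃ w ∈ commutator K, ∃ e, τ e = e ∧ c = w * e := by
    intro c
    set w := τ c * c⁻¹ with hw
    have hwm : w ∈ commutator K := hfix c
    have hτ : τ c = w * c := by rw [hw, inv_mul_cancel_right]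
    refine ⟨w, hwm, w⁻¹ * c, ?_, (mul_inv_cancel_left w c).symm⟩
    rw [map_mul, map_inv, hinv w hwm, hτ, inv_inv, ← mul_assoc]
    congr 1
    rw [eq_inv_iff_mul_eq_one, ← hcube w hwm, pow_succ, pow_two]
  have hfixcomm : ∀ e f, τ e = e → τ f = f → e * f = f * e := by
    intro e f he hf
    have hmem : ⁅e, f⁆ ∈ commutator K :=
      Subgroup.commutator_mem_commutator (Subgroup.mem_top e) (Subgroup.mem_top f)
    have h1 := hinv _ hmem
    rw [map_commutatorElement, he, hf] at h1
    have h2 := hcube _ hmem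
    rw [pow_succ, pow_two] at h2
    nth_rewrite 1 [h1] at h2
    rw [inv_mul_cancel, one_mul] at h2
    exact commutatorElement_eq_one_iff_mul_comm.mp h2
  change ⁅(⊤ : Subgroup K), ⊤⁆ ≤ _
  rw [Subgroup.commutator_le]
  rintro c - c' -
  obtain ⟨w, hw, e, he, rfl⟩ := hdec c
  obtain ⟨w', hw', f, hf, rfl⟩ := hdec c'
  have hef := hfixcomm e f he hf
  have h1 : ⁅e, w' * f⁆ = ⁅e, w'⁆ := by
    rw [commutatorElement_def, commutatorElement_def, mul_inv_rev]
    have : f * e⁻¹ * f⁻¹ = e⁻¹ := by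
      rw [mul_inv_eq_iff_eq_mul, mul_inv_eq_iff_eq_mul, mul_assoc, ← hef, inv_mul_cancel_left]
    calc e * (w' * f) * e⁻¹ * (f⁻¹ * w'⁻¹) = e * w' * (f * e⁻¹ * f⁻¹) * w'⁻¹ := by group
      _ = e * w' * e⁻¹ * w'⁻¹ := by rw [this]
  have h2 : ⁅w * e, w' * f⁆ = ⁅e, w'⁆ * ⁅w, w' * f⁆ := by
    have hm : ⁅e, w'⁆ ∈ commutator K :=
      Subgroup.commutator_mem_commutator (Subgroup.mem_top e) (Subgroup.mem_top w')
    calc ⁅w * e, w' * f⁆ = w * ⁅e, w' * f⁆ * w⁻¹ * ⁅w, w' * f⁆ := by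
          simp only [commutatorElement_def]; group
      _ = _ := by rw [h1, hcomm w hw _ hm, mul_inv_cancel_right]
  rw [h2]
  refine mul_mem ?_ (Subgroup.commutator_mem_commutator hw (Subgroup.mem_top _))
  rw [← commutatorElement_inv]
  exact inv_mem (Subgroup.commutator_mem_commutator hw' (Subgroup.mem_top _))

/-- The commutator subgroup of an extension of an abelian normal subgroup by a cyclic group. -/
theorem card_commutator_mul_card {K : Type*} [Group K] [Finite K] (A : Subgroup K) [A.Normal]
    (hA : ∀ a ∈ A, ∀ a' ∈ A, a * a' = a' * a) (b : K) (hb : A ⊔ Subgroup.zpowers b = ⊤) :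
    Nat.card (commutator K) * Nat.card {a : A // (a : K) * b = b * a} = Nat.card A := by
  have hAn : A.Normal := inferInstance
  have hfA : ∀ a ∈ A, ∀ g : K, a * g * a⁻¹ * g⁻¹ ∈ A := fun a ha g => by
    have : a * g * a⁻¹ * g⁻¹ = a * (g * a⁻¹ * g⁻¹) := by group
    rw [this]
    exact A.mul_mem ha (hAn.conj_mem _ (inv_mem ha) g)
  -- The map `a ↦ [a, b]` is a homomorphism as `A` is abelian and normal. Its kernel consists of the
  -- elements commuting with `b`. Its range is normal, and modulo it the generators commute, so the
  -- range is the whole commutator subgroup.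
  let f : A →* K :=
    { toFun := fun a => a * b * (a : K)⁻¹ * b⁻¹
      map_one' := by simp
      map_mul' := fun a a' => by
        have h1 := hA _ (hfA a' a'.2 b) a a.2
        calc ((a * a' : A) : K) * b * ((a * a' : A) : K)⁻¹ * b⁻¹
            = (a : K) * (a' * b * (a' : K)⁻¹ * b⁻¹) * b * (a : K)⁻¹ * b⁻¹ := by
              push_cast; group
          _ = (a' * b * (a' : K)⁻¹ * b⁻¹) * (a * b * (a : K)⁻¹ * b⁻¹) := by
              rw [← h1]; group
          _ = _ := hA _ (hfA a' a'.2 b) _ (hfA a a.2 b) }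
  have hfapp : ∀ a : A, f a = a * b * (a : K)⁻¹ * b⁻¹ := fun _ => rfl
  have htop : ∀ T : Subgroup K, A ≤ T → b ∈ T → ∀ g, g ∈ T := by
    intro T h1 h2 g
    have : (⊤ : Subgroup K) ≤ T := hb ▸ sup_le h1 (by rwa [Subgroup.zpowers_le])
    exact this (Subgroup.mem_top g)
  have hconj : ∀ (g : K) (a : A), g * b = b * g →
      g * f a * g⁻¹ = f ⟨g * a * g⁻¹, hAn.conj_mem a a.2 g⟩ := by
    intro g a hg
    rw [hfapp, hfapp]
    have hg' : g * b * g⁻¹ = b := by rw [hg, mul_inv_cancel_right]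
    calc g * (a * b * (a : K)⁻¹ * b⁻¹) * g⁻¹
        = (g * a * g⁻¹) * (g * b * g⁻¹) * (g * a * g⁻¹)⁻¹ * (g * b * g⁻¹)⁻¹ := by group
      _ = _ := by rw [hg']
  have hR : f.range.Normal := by
    rw [← Subgroup.normalizer_eq_top_iff, eq_top_iff]
    rintro g -
    refine htop _ (fun a ha => ?_) ?_ g
    · rw [Subgroup.mem_normalizer_iff]
      have hc : ∀ y ∈ A, a * y * a⁻¹ = y := fun y hy => by
        rw [hA a ha y hy, mul_inv_cancel_right]
      intro y
      constructor
      · rintro ⟨x, rfl⟩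
        exact ⟨x, (hc _ (hfA x x.2 b)).symm⟩
      · rintro ⟨x, hx⟩
        have hy : a * y * a⁻¹ ∈ A := hx ▸ hfA x x.2 b
        have hyA : y ∈ A := by
          have := hAn.conj_mem _ hy a⁻¹
          rwa [show a⁻¹ * (a * y * a⁻¹) * a⁻¹⁻¹ = y by group] at this
        rw [← hc y hyA]
        exact ⟨x, hx⟩
    · rw [Subgroup.mem_normalizer_iff]
      intro y
      constructor
      · rintro ⟨x, rfl⟩
        exact ⟨_, (hconj b x rfl).symm⟩
      · rintro ⟨x, hx⟩
        refine ⟨_, ((hconj b⁻¹ x (by group)).symm.trans ?_)⟩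
        rw [hx]; group
  have hrange : commutator K = f.range := by
    apply le_antisymm
    · let π := QuotientGroup.mk' f.range
      have hAb : ∀ a ∈ A, π a * π b = π b * π a := by
        intro a ha
        have h1 : π (f ⟨a, ha⟩) = 1 := (QuotientGroup.eq_one_iff _).mpr ⟨_, rfl⟩
        rwa [hfapp, map_mul, map_mul, map_mul, map_inv, map_inv, mul_inv_eq_one,
          mul_inv_eq_iff_eq_mul] at h1
      have hAA : ∀ a ∈ A, ∀ a' ∈ A, π a * π a' = π a' * π a := by
        intro a ha a' ha'
        rw [← map_mul, hA a ha a' ha', map_mul]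
      have hb' : ∀ g, π g * π b = π b * π g :=
        htop ((Subgroup.centralizer {π b}).comap π)
          (fun a ha => Subgroup.mem_comap.mpr (Subgroup.mem_centralizer_singleton_iff.mpr
            (hAb a ha)))
          (Subgroup.mem_comap.mpr (Subgroup.mem_centralizer_singleton_iff.mpr rfl)) |> fun h g =>
            Subgroup.mem_centralizer_singleton_iff.mp (h g)
      have ha' : ∀ a ∈ A, ∀ g, π g * π a = π a * π g := fun a ha g =>
        Subgroup.mem_centralizer_singleton_iff.mp <|
          htop ((Subgroup.centralizer {π a}).comap π)
            (fun a' ha' => Subgroup.mem_comap.mpr (Subgroup.mem_centralizer_singleton_iff.mpr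
              (hAA a' ha' a ha)))
            (Subgroup.mem_comap.mpr (Subgroup.mem_centralizer_singleton_iff.mpr (hAb a ha).symm)) g
      have hall : ∀ g h, π g * π h = π h * π g := fun g h =>
        Subgroup.mem_centralizer_singleton_iff.mp <|
          htop ((Subgroup.centralizer {π h}).comap π)
            (fun a ha => Subgroup.mem_comap.mpr (Subgroup.mem_centralizer_singleton_iff.mpr
              (ha' a ha h).symm))
            (Subgroup.mem_comap.mpr (Subgroup.mem_centralizer_singleton_iff.mpr (hb' h).symm)) g
      change ⁅(⊤ : Subgroup K), ⊤⁆ ≤ _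
      rw [Subgroup.commutator_le]
      intro g _ h _
      have h1 : π ⁅g, h⁆ = 1 := by
        rw [map_commutatorElement, commutatorElement_eq_one_iff_mul_comm]
        exact hall g h
      exact (QuotientGroup.eq_one_iff _).mp h1
    · rintro _ ⟨a, rfl⟩
      exact Subgroup.commutator_mem_commutator (Subgroup.mem_top (a : K)) (Subgroup.mem_top b)
  have hker : Nat.card f.ker = Nat.card {a : A // (a : K) * b = b * a} := by
    refine Nat.card_congr (Equiv.subtypeEquivRight fun a => ?_)
    rw [MonoidHom.mem_ker, hfapp, mul_inv_eq_one, mul_inv_eq_iff_eq_mul]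
  rw [hrange, ← hker, ← Subgroup.index_ker, mul_comm, Subgroup.card_mul_index]

theorem sup_zpowers_eq_top_of_index_prime {K : Type*} [Group K] {A : Subgroup K}
    (hA : A.index.Prime) {b : K} (hb : b ∉ A) : A ⊔ Subgroup.zpowers b = ⊤ := by
  have h1 := Subgroup.index_dvd_of_le (le_sup_left : A ≤ A ⊔ Subgroup.zpowers b)
  rcases (Nat.dvd_prime hA).mp h1 with h | h
  · exact Subgroup.index_eq_one.mp h
  · exfalso
    have h2 := Subgroup.relIndex_mul_index (le_sup_left : A ≤ A ⊔ Subgroup.zpowers b)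
    rw [h] at h2
    have h3 : A.relIndex (A ⊔ Subgroup.zpowers b) = 1 :=
      Nat.eq_of_mul_eq_mul_right hA.pos (by rw [h2, one_mul])
    exact hb (Subgroup.relIndex_eq_one.mp h3
      (Subgroup.mem_sup_right (Subgroup.mem_zpowers b)))

/-- A central commutator subgroup of index nine has order at most three. -/
theorem card_commutator_le_three {K : Type*} [Group K] [Finite K]
    (hcenter : commutator K ≤ Subgroup.center K) (hcard : Nat.card K = 9 * Nat.card (commutator K))
    (hne : commutator K ≠ ⊥) : Nat.card (commutator K) ≤ 3 := by
  have hpos : 0 < Nat.card (commutator K) := Nat.card_pos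
  obtain ⟨a, ha⟩ : ∃ a, a ∉ commutator K := by
    by_contra! h
    have h2 : commutator K = ⊤ := eq_top_iff.mpr fun x _ => h x
    have h1 : Nat.card (commutator K) = Nat.card K := by rw [h2, Subgroup.card_top]
    omega
  -- This subgroup is abelian, normal and of index three. For `b` outside it,
  -- `card_commutator_mul_card` says that exactly three of its elements commute with `b`, and the
  -- central subgroup `K'` is among them.
  let A := commutator K ⊔ Subgroup.zpowers a
  have haA : a ∈ A := Subgroup.mem_sup_right (Subgroup.mem_zpowers a)
  have hAcomm : ∀ x ∈ A, ∀ y ∈ A, x * y = y * x := by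
    have h1 : A ≤ Subgroup.centralizer {a} := sup_le
      (fun x hx => Subgroup.mem_centralizer_singleton_iff.mpr
        (Subgroup.mem_center_iff.mp (hcenter hx) a).symm)
      (by rw [Subgroup.zpowers_le]; exact Subgroup.mem_centralizer_singleton_iff.mpr rfl)
    intro x hx y hy
    have h2 : A ≤ Subgroup.centralizer {x} := sup_le
      (fun z hz => Subgroup.mem_centralizer_singleton_iff.mpr
        (Subgroup.mem_center_iff.mp (hcenter hz) x).symm)
      (by
        rw [Subgroup.zpowers_le]
        exact Subgroup.mem_centralizer_singleton_iff.mpr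
          (Subgroup.mem_centralizer_singleton_iff.mp (h1 hx)).symm)
    exact (Subgroup.mem_centralizer_singleton_iff.mp (h2 hy)).symm
  have hAn : A.Normal := ⟨fun x hx g => by
    have h1 : g * x * g⁻¹ = ⁅g, x⁆ * x := by rw [commutatorElement_def, inv_mul_cancel_right]
    rw [h1]
    exact A.mul_mem (Subgroup.mem_sup_left (Subgroup.commutator_mem_commutator
      (Subgroup.mem_top g) (Subgroup.mem_top x))) hx⟩
  have hAtop : A ≠ ⊤ := by
    intro h
    apply hne
    rw [commutator_eq_bot_iff_center_eq_top, eq_top_iff]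
    intro x _
    rw [Subgroup.mem_center_iff]
    intro y
    exact hAcomm y (h ▸ Subgroup.mem_top y) x (h ▸ Subgroup.mem_top x)
  have hle : commutator K ≤ A := le_sup_left
  have hindex : (commutator K).index = 9 := by
    have := (commutator K).card_mul_index
    rw [hcard, mul_comm] at this
    exact Nat.eq_of_mul_eq_mul_right hpos this
  have hAindex : A.index = 3 := by
    have h1 := Subgroup.relIndex_mul_index hle
    rw [hindex] at h1
    have h2 : A.index ≠ 1 := fun h => hAtop (Subgroup.index_eq_one.mp h)
    have h3 : (commutator K).relIndex A ≠ 1 := fun h =>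
      ha (Subgroup.relIndex_eq_one.mp h haA)
    have h4 : A.index ∣ 3 ^ 2 := ⟨_, by rw [mul_comm, h1]; norm_num⟩
    obtain ⟨i, hi, hi'⟩ := (Nat.dvd_prime_pow Nat.prime_three).mp h4
    interval_cases i
    · omega
    · simpa using hi'
    · rw [hi'] at h1; omega
  obtain ⟨b, hb⟩ : ∃ b, b ∉ A := by
    by_contra! h
    exact hAtop (eq_top_iff.mpr fun x _ => h x)
  have hQ := card_commutator_mul_card A hAcomm b
    (sup_zpowers_eq_top_of_index_prime (hAindex ▸ Nat.prime_three) hb)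
  have hAcard : Nat.card A = Nat.card (commutator K) * 3 := by
    have := A.card_mul_index
    rw [hAindex, hcard] at this
    omega
  rw [hAcard] at hQ
  rw [← Nat.eq_of_mul_eq_mul_left hpos hQ]
  refine Nat.card_le_card_of_injective
    (fun y : commutator K => (⟨⟨y, hle y.2⟩, (Subgroup.mem_center_iff.mp (hcenter y.2) b).symm⟩ :
      {a : A // (a : K) * b = b * a})) fun y z h => ?_
  exact Subtype.ext (congrArg (fun w : {a : A // (a : K) * b = b * a} => ((w : A) : K)) h)

theorem card_le_mul_card_map {A : Type*} [AddCommGroup A] [Finite A] (f : A →+ A)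
    (S : AddSubgroup A) : Nat.card S ≤ Nat.card f.ker * Nat.card (S.map f) := by
  have h := AddSubgroup.card_mul_index (f.comp S.subtype).ker
  rw [AddSubgroup.index_ker] at h
  have h1 : (f.comp S.subtype).range = S.map f := by
    rw [AddMonoidHom.range_comp, AddSubgroup.range_subtype]
  rw [h1] at h
  rw [← h]
  refine Nat.mul_le_mul_right _ (Nat.card_le_card_of_injective
    (fun x : (f.comp S.subtype).ker => (⟨((x : S) : A), x.2⟩ : f.ker)) fun x y h => ?_)
  exact Subtype.ext (Subtype.ext (congrArg (fun z : f.ker => (z : A)) h))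

/-- An elementary abelian three-group with an automorphism of order three having at most three
fixed points has order at most `27`. -/
theorem card_le_of_card_fixed_le {A : Type*} [AddCommGroup A] [Finite A] (φ : A →+ A)
    (h3 : ∀ a : A, 3 • a = 0) (hφ : ∀ a, φ (φ (φ a)) = a)
    (hfix : Nat.card {a // φ a = a} ≤ 3) : Nat.card A ≤ 27 := by
  let f : A →+ A := AddMonoidHom.id A - φ
  have hf : ∀ a, f a = a - φ a := fun _ => rfl
  have hker : Nat.card f.ker ≤ 3 := by
    refine le_trans (le_of_eq (Nat.card_congr (Equiv.subtypeEquivRight fun a => ?_))) hfix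
    rw [AddMonoidHom.mem_ker, hf, sub_eq_zero, eq_comm]
  -- In exponent three `(1 - φ)³ = 1 - φ³ = 0`, and each application of `1 - φ` shrinks a subgroup
  -- by a factor of at most `3`.
  have hcube : ((((⊤ : AddSubgroup A).map f).map f).map f) = ⊥ := by
    rw [eq_bot_iff]
    rintro _ ⟨_, ⟨_, ⟨a, -, rfl⟩, rfl⟩, rfl⟩
    rw [AddSubgroup.mem_bot]
    simp only [hf, map_sub, hφ]
    have : a - φ a - (φ a - φ (φ a)) - (φ a - φ (φ a) - (φ (φ a) - a)) =
        -(3 • φ a) + 3 • φ (φ a) := by abel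
    rw [this, h3, h3, neg_zero, add_zero]
  have h1 := card_le_mul_card_map f ⊤
  have h2 := card_le_mul_card_map f ((⊤ : AddSubgroup A).map f)
  have h4 := card_le_mul_card_map f (((⊤ : AddSubgroup A).map f).map f)
  rw [hcube, AddSubgroup.card_bot, mul_one] at h4
  rw [AddSubgroup.card_top] at h1
  calc Nat.card A ≤ _ := h1
    _ ≤ 3 * (3 * 3) := Nat.mul_le_mul hker (h2.trans (Nat.mul_le_mul hker (h4.trans hker)))
    _ = 27 := by norm_num

end AbstractGroups

/-! ### Centralizers of elements of a fused normal subgroup -/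

namespace IsFusedNormalSubgroup

open scoped commutatorElement

variable {G : Type*} [Group G] [Finite G] {N : Subgroup G} (hN : IsFusedNormalSubgroup N)

include hN

/-- Conjugate elements have the same order, so all of `N` has exponent a prime `p`. A finite
`p`-group has a nontrivial central element, and its conjugates exhaust the nontrivial elements of
the normal subgroup `N`. -/
theorem exists_isElementaryAbelianOfOrder :
    ∃ p k : ℕ, p.Prime ∧ 0 < k ∧ IsElementaryAbelianOfOrder N p k := by
  have hnontriv : Nontrivial N := N.nontrivial_iff_ne_bot.mpr hN.ne_bot
  have hcard : Nat.card N ≠ 1 := (Finite.one_lt_card_iff_nontrivial.mpr hnontriv).ne'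
  obtain ⟨p, hp, hpN⟩ := Nat.exists_prime_and_dvd hcard
  have : Fact p.Prime := ⟨hp⟩
  obtain ⟨x, hx⟩ := exists_prime_orderOf_dvd_card' p hpN
  have hx1 : (x : G) ≠ 1 := fun h => hp.one_lt.ne' (by
    rw [← hx, orderOf_eq_one_iff]; exact Subtype.ext h)
  have hxp : (x : G) ^ p = 1 := by rw [← hx, ← Subgroup.orderOf_coe, pow_orderOf_eq_one]
  have hpow : ∀ a ∈ N, a ^ p = 1 := by
    intro a ha
    by_cases ha1 : a = 1
    · rw [ha1, one_pow]
    · obtain ⟨g, rfl⟩ := hN.conj x x.2 a ha hx1 ha1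
      rw [conj_pow, hxp, mul_one, mul_inv_cancel]
  have hpg : IsPGroup p N := fun a => ⟨1, Subtype.ext (by simpa using hpow a a.2)⟩
  obtain ⟨k, hk⟩ := IsPGroup.iff_card.mp hpg
  have hnt : Nontrivial (Subgroup.center N) := hpg.center_nontrivial
  obtain ⟨z, hz⟩ := exists_ne (1 : Subgroup.center N)
  have hz1 : ((z : N) : G) ≠ 1 := fun h => hz (Subtype.ext (Subtype.ext h))
  refine ⟨p, k, hp, Nat.pos_of_ne_zero fun h => hcard (by rw [hk, h, pow_zero]), ?_, hpow, hk⟩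
  intro a ha b hb
  by_cases ha1 : a = 1
  · rw [ha1, one_mul, mul_one]
  · obtain ⟨g, rfl⟩ := hN.conj z z.1.2 a ha hz1 ha1
    have hb' : g⁻¹ * b * g ∈ N := by simpa using hN.normal.conj_mem b hb g⁻¹
    have h1 : (g⁻¹ * b * g) * z = z * (g⁻¹ * b * g) :=
      congrArg Subtype.val (Subgroup.mem_center_iff.mp z.2 ⟨_, hb'⟩)
    calc g * z * g⁻¹ * b = g * (z * (g⁻¹ * b * g)) * g⁻¹ := by group
      _ = b * (g * z * g⁻¹) := by rw [← h1]; group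

/-- The conjugacy class of `x` is `N` without `1`, so orbit-stabilizer cancels the factor `n - 1` of
`|G|`. -/
theorem card_centralizer {x : G} (hx : x ∈ N) (hx1 : x ≠ 1) :
    Nat.card (Subgroup.centralizer ({x} : Set G)) = 9 * Nat.card N := by
  have horbit : MulAction.orbit (ConjAct G) x = (N : Set G) \ {1} := by
    ext y
    rw [ConjAct.mem_orbit_conjAct, isConj_comm, isConj_iff]
    constructor
    · rintro ⟨g, rfl⟩
      refine ⟨hN.normal.conj_mem x hx g, fun h => hx1 ?_⟩
      rwa [Set.mem_singleton_iff, conj_eq_one_iff] at h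
    · rintro ⟨hy, hy1⟩
      exact hN.conj x hx y hy hx1 hy1
  have hncard : ((N : Set G) \ {1}).ncard = Nat.card N - 1 := by
    rw [Set.ncard_sdiff_singleton_of_mem N.one_mem]; rfl
  have h1 := (MulAction.stabilizer (ConjAct G) x).card_mul_index
  rw [MulAction.index_stabilizer, horbit, hncard,
    ← Subgroup.nat_card_centralizer_nat_card_stabilizer] at h1
  have h2 : Nat.card (ConjAct G) = Nat.card G := rfl
  rw [h2, hN.card] at h1
  refine Nat.eq_of_mul_eq_mul_right ?_ h1
  have : 1 < Nat.card N :=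
    Finite.one_lt_card_iff_nontrivial.mpr (N.nontrivial_iff_ne_bot.mpr hN.ne_bot)
  omega

theorem le_commutator {H : Subgroup G} (hNH : N ≤ H) (hH : 3 * Nat.card N < Nat.card H) :
    N ≤ ⁅H, H⁆ := by
  intro x hx
  by_contra h
  have := Nat.le_of_dvd (Nat.mul_pos (by norm_num) Nat.card_pos) (hN.dvd H x (hNH hx) hx h)
  omega

/-- The centralizer of `x` has order divisible by `9`. A subgroup of order `9` in it, together with
`x`, generates an abelian group `H`. As `x ∉ [H,H] = 1`, the order of `H` divides `3 p^k`, so `3`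
divides `p^k`. -/
theorem prime_eq_three {p k : ℕ} (hp : p.Prime) (hk : IsElementaryAbelianOfOrder N p k) :
    p = 3 := by
  obtain ⟨x, hx, hx1⟩ := N.ne_bot_iff_exists_ne_one.mp hN.ne_bot |>.elim
    fun a ha => (⟨a, a.2, fun h => ha (Subtype.ext h)⟩ : ∃ x ∈ N, x ≠ 1)
  let C := Subgroup.centralizer ({x} : Set G)
  have : Fact (Nat.Prime 3) := ⟨Nat.prime_three⟩
  obtain ⟨Q, hQ⟩ := Sylow.exists_subgroup_card_pow_prime (G := C) 3 (n := 2)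
    (by rw [hN.card_centralizer hx hx1]; exact ⟨_, rfl⟩)
  have hQcomm := (IsPGroup.isMulCommutative_of_card_eq_prime_sq hQ).is_comm.comm
  let Q' := Q.map C.subtype
  have hQ' : Nat.card Q' = 9 := by
    rw [← Nat.card_congr (Subgroup.equivMapOfInjective Q _ C.subtype_injective).toEquiv, hQ]
    norm_num
  have hQ'comm : ∀ a ∈ Q', ∀ b ∈ Q', a * b = b * a := by
    rintro _ ⟨a, ha, rfl⟩ _ ⟨b, hb, rfl⟩
    exact congrArg (fun z : Q => ((z : C) : G)) (hQcomm ⟨a, ha⟩ ⟨b, hb⟩)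
  have hQ'x : ∀ a ∈ Q', a * x = x * a := by
    rintro _ ⟨a, -, rfl⟩
    exact Subgroup.mem_centralizer_singleton_iff.mp a.2
  let H := Q' ⊔ Subgroup.zpowers x
  have hxc : H ≤ Subgroup.centralizer {x} := sup_le
    (fun a ha => Subgroup.mem_centralizer_singleton_iff.mpr (hQ'x a ha))
    (by rw [Subgroup.zpowers_le]; exact Subgroup.mem_centralizer_singleton_iff.mpr rfl)
  have hQc : ∀ a ∈ Q', H ≤ Subgroup.centralizer {a} := fun a ha => sup_le
    (fun b hb => Subgroup.mem_centralizer_singleton_iff.mpr (hQ'comm b hb a ha))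
    (by rw [Subgroup.zpowers_le]
        exact Subgroup.mem_centralizer_singleton_iff.mpr (hQ'x a ha).symm)
  have hHcomm : ⁅H, H⁆ = ⊥ := by
    rw [Subgroup.commutator_eq_bot_iff_le_centralizer]
    intro h hh
    rw [Subgroup.mem_centralizer_iff]
    intro g hg
    have h1 : H ≤ Subgroup.centralizer {h} := sup_le
      (fun a ha => Subgroup.mem_centralizer_singleton_iff.mpr
        (Subgroup.mem_centralizer_singleton_iff.mp (hQc a ha hh)).symm)
      (by rw [Subgroup.zpowers_le]
          exact Subgroup.mem_centralizer_singleton_iff.mpr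
            (Subgroup.mem_centralizer_singleton_iff.mp (hxc hh)).symm)
    exact Subgroup.mem_centralizer_singleton_iff.mp (h1 hg)
  have h9 : 9 ∣ 3 * Nat.card N :=
    (hQ' ▸ Subgroup.card_dvd_of_le (le_sup_left : Q' ≤ H)).trans
      (hN.dvd H x (Subgroup.mem_sup_right (Subgroup.mem_zpowers x)) hx
        (by rw [hHcomm, Subgroup.mem_bot]; exact hx1))
  rw [hk.2.2] at h9
  have h3 : 3 ∣ p ^ k := by omega
  exact ((Nat.prime_dvd_prime_iff_eq Nat.prime_three hp).mp (Nat.prime_three.dvd_of_dvd_pow h3)).symm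

/-- The facts about `N` used throughout: it is commutative of exponent three. -/
theorem exists_card_eq : ∃ k : ℕ, 0 < k ∧ IsElementaryAbelianOfOrder N 3 k := by
  obtain ⟨p, k, hp, hk0, hk⟩ := hN.exists_isElementaryAbelianOfOrder
  obtain rfl := hN.prime_eq_three hp hk
  exact ⟨k, hk0, hk⟩

theorem mul_comm_of_mem {a b : G} (ha : a ∈ N) (hb : b ∈ N) : a * b = b * a :=
  hN.exists_card_eq.elim fun _ h => h.2.1 a ha b hb

theorem pow_three_of_mem {a : G} (ha : a ∈ N) : a ^ 3 = 1 :=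
  hN.exists_card_eq.elim fun _ h => h.2.2.1 a ha

theorem le_centralizer_singleton {x : G} (hx : x ∈ N) : N ≤ Subgroup.centralizer ({x} : Set G) :=
  fun _ hy => Subgroup.mem_centralizer_singleton_iff.mpr (hN.mul_comm_of_mem hy hx)

theorem isPGroup_centralizer {x : G} (hx : x ∈ N) (hx1 : x ≠ 1) :
    IsPGroup 3 (Subgroup.centralizer ({x} : Set G)) := by
  obtain ⟨k, -, hk⟩ := hN.exists_card_eq
  refine IsPGroup.of_card (n := k + 2) ?_
  rw [hN.card_centralizer hx hx1, hk.2.2]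
  ring

/-- The quotient `C/N` has order `9` and is therefore abelian; conversely `|C| = 9n > 3n` puts `N`
into `[C,C]`. -/
theorem commutator_centralizer {x : G} (hx : x ∈ N) (hx1 : x ≠ 1) :
    commutator (Subgroup.centralizer ({x} : Set G)) =
      N.subgroupOf (Subgroup.centralizer ({x} : Set G)) := by
  have := hN.normal
  have : Fact (Nat.Prime 3) := ⟨Nat.prime_three⟩
  set C := Subgroup.centralizer ({x} : Set G) with hC
  have hNC : N ≤ C := hN.le_centralizer_singleton hx
  have hcard : Nat.card C = 9 * Nat.card N := hN.card_centralizer hx hx1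
  apply le_antisymm
  · have hq : Nat.card (C ⧸ N.subgroupOf C) = 3 ^ 2 := by
      have h1 := (N.subgroupOf C).card_mul_index
      rw [Nat.card_congr (Subgroup.subgroupOfEquivOfLe hNC).toEquiv, hcard, mul_comm] at h1
      rw [← Subgroup.index_eq_card]
      exact Nat.eq_of_mul_eq_mul_right Nat.card_pos h1
    have hcomm := (IsPGroup.isMulCommutative_of_card_eq_prime_sq hq).is_comm.comm
    change ⁅(⊤ : Subgroup C), ⊤⁆ ≤ _
    rw [Subgroup.commutator_le]
    intro g _ h _
    have h1 : QuotientGroup.mk' (N.subgroupOf C) ⁅g, h⁆ = 1 := by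
      rw [map_commutatorElement, commutatorElement_eq_one_iff_mul_comm]
      exact hcomm _ _
    exact (QuotientGroup.eq_one_iff _).mp h1
  · intro y hy
    have h1 : (y : G) ∈ ⁅C, C⁆ :=
      hN.le_commutator hNC (by rw [hcard]; have := Nat.card_pos (α := N); omega) hy
    rw [← Subgroup.map_subtype_commutator] at h1
    obtain ⟨z, hz, hzy⟩ := h1
    obtain rfl : z = y := Subtype.ext hzy
    exact hz

/-- An involution commutes with no nontrivial `w ∈ N`, because the centralizer of `w` is a
`3`-group. The element `x * (t * x * t⁻¹)` of `N` does commute with `t`, so it is `1`. -/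
theorem conj_eq_inv_of_involution {t : G} (ht : t * t = 1) (ht1 : t ≠ 1) {x : G} (hx : x ∈ N) :
    t * x * t⁻¹ = x⁻¹ := by
  have hnotcomm : ∀ w ∈ N, t * w = w * t → w = 1 := by
    intro w hw h
    by_contra hw1
    let t' : Subgroup.centralizer ({w} : Set G) :=
      ⟨t, Subgroup.mem_centralizer_singleton_iff.mpr h⟩
    obtain ⟨n, hn⟩ := hN.isPGroup_centralizer hw hw1 t'
    have h1 : t ^ 3 ^ n = 1 := congrArg Subtype.val hn
    have hodd : Odd (3 ^ n) := Odd.pow (by decide)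
    obtain ⟨m, hm⟩ := hodd
    rw [hm, pow_succ, pow_mul, pow_two, ht, one_pow, one_mul] at h1
    exact ht1 h1
  have hinv : t⁻¹ = t := inv_eq_of_mul_eq_one_left ht
  have hx' : t * x * t⁻¹ ∈ N := hN.normal.conj_mem x hx t
  have h1 : x * (t * x * t⁻¹) = 1 := by
    apply hnotcomm _ (mul_mem hx hx')
    have h2 := hN.mul_comm_of_mem hx hx'
    rw [hinv] at h2 ⊢
    calc t * (x * (t * x * t)) = t * x * t * x * t := by group
      _ = x * (t * x * t) * t := by rw [← h2]
  exact eq_inv_of_mul_eq_one_right h1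

end IsFusedNormalSubgroup

/-! ### Bounding the order of a fused normal subgroup -/

/-- The square of any element centralizes a normal subgroup of order three. -/
theorem mul_self_conj_eq_of_card_eq_three {Q : Type*} [Group Q] (S : Subgroup Q) [S.Normal]
    (hS : Nat.card S = 3) (g : Q) {u : Q} (hu : u ∈ S) : g * g * u * (g * g)⁻¹ = u := by
  have : Fact (Nat.Prime 3) := ⟨Nat.prime_three⟩
  have : Finite S := Nat.finite_of_card_ne_zero (by rw [hS]; norm_num)
  have : IsCyclic S := isCyclic_of_prime_card hS
  have hcard : Nat.card (MulAut S) = 2 := by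
    rw [IsCyclic.card_mulAut, hS, Nat.totient_prime Nat.prime_three]
  have h1 : (MulAut.conjNormal g : MulAut S) ^ 2 = 1 := by
    rw [← hcard]; exact pow_card_eq_one'
  rw [pow_two, ← map_mul] at h1
  have h2 := DFunLike.congr_fun h1 ⟨u, hu⟩
  have h3 := MulAut.conjNormal_apply (H := S) (g * g) ⟨u, hu⟩
  rw [h2] at h3
  exact h3.symm

/-- A group of order eight with at most one involution has an involution which is a square. -/
theorem exists_mul_self_involution {S : Type*} [Group S] (hS : Nat.card S = 8)
    (huniq : ∀ s t : S, s * s = 1 → t * t = 1 → s ≠ 1 → t ≠ 1 → s = t) :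
    ∃ g : S, g * g ≠ 1 ∧ (g * g) * (g * g) = 1 := by
  have : Finite S := Nat.finite_of_card_ne_zero (by rw [hS]; norm_num)
  -- If every square were trivial, uniqueness of the involution would leave at most two elements.
  obtain ⟨s, hs⟩ : ∃ s : S, s * s ≠ 1 := by
    by_contra! h
    obtain ⟨t, ht⟩ : ∃ t : S, t ≠ 1 := by
      have : Nontrivial S := Finite.one_lt_card_iff_nontrivial.mp (by omega)
      exact exists_ne 1
    have hle : Nat.card S ≤ Nat.card Bool := by
      refine Nat.card_le_card_of_surjective (fun b : Bool => if b then t else 1) fun s => ?_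
      by_cases hs : s = 1
      · exact ⟨false, by simp [hs]⟩
      · exact ⟨true, by simp [huniq s t (h s) (h t) hs ht]⟩
    rw [hS, Nat.card_eq_fintype_card, Fintype.card_bool] at hle
    omega
  have h8 : s ^ 8 = 1 := by rw [← hS]; exact pow_card_eq_one'
  by_cases h4 : (s * s) * (s * s) = 1
  · exact ⟨s, hs, h4⟩
  · refine ⟨s * s, h4, ?_⟩
    rw [← h8]
    simp only [pow_succ, pow_zero, one_mul, mul_assoc]

namespace IsFusedNormalSubgroup

variable {G : Type*} [Group G] [Finite G] {N : Subgroup G} (hN : IsFusedNormalSubgroup N)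

include hN

/-- Otherwise conjugation by `t` would act on the nilpotent group `C`, inverting `[C,C] = N` and
fixing `C/N` pointwise. By `commutator_eq_bot_of_inverting` the group `[C,C]` would be trivial, yet
it contains `x`. -/
theorem not_forall_conj_mul_inv_mem {t : G} (ht : t * t = 1) (ht1 : t ≠ 1) {x : G} (hx : x ∈ N)
    (hx1 : x ≠ 1) :
    ¬ ∀ c ∈ Subgroup.centralizer ({x} : Set G), t * c * t⁻¹ * c⁻¹ ∈ N := by
  intro h
  set C := Subgroup.centralizer ({x} : Set G) with hC
  have hNC : N ≤ C := hN.le_centralizer_singleton hx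
  have hcommC := hN.commutator_centralizer hx hx1
  have hmaps : ∀ c ∈ C, t * c * t⁻¹ ∈ C := fun c hc => by
    have := C.mul_mem (hNC (h c hc)) hc
    rwa [inv_mul_cancel_right] at this
  let τ : C →* C :=
    { toFun := fun c => ⟨t * c * t⁻¹, hmaps c c.2⟩
      map_one' := Subtype.ext (by simp)
      map_mul' := fun a b => Subtype.ext (by simp [mul_assoc]) }
  have : Fact (Nat.Prime 3) := ⟨Nat.prime_three⟩
  have : Group.IsNilpotent C := (hN.isPGroup_centralizer hx hx1).isNilpotent
  have hbot : commutator C = ⊥ := by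
    refine commutator_eq_bot_of_inverting τ ?_ ?_ ?_ ?_ <;> rw [hcommC]
    · exact fun a ha b hb => Subtype.ext (hN.mul_comm_of_mem ha hb)
    · exact fun a ha => Subtype.ext (hN.pow_three_of_mem ha)
    · exact fun a ha => Subtype.ext (hN.conj_eq_inv_of_involution ht ht1 ha)
    · exact fun c => h c c.2
  have hxC : (⟨x, hNC hx⟩ : C) ∈ commutator C := by rw [hcommC]; exact hx
  rw [hbot, Subgroup.mem_bot] at hxC
  exact hx1 (congrArg Subtype.val hxC)

theorem card_commutator_centralizer {x : G} (hx : x ∈ N) (hx1 : x ≠ 1) :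
    Nat.card (commutator (Subgroup.centralizer ({x} : Set G))) = Nat.card N := by
  rw [hN.commutator_centralizer hx hx1]
  exact Nat.card_congr (Subgroup.subgroupOfEquivOfLe (hN.le_centralizer_singleton hx)).toEquiv

theorem card_le_three_of_central {x : G} (hx : x ∈ N) (hx1 : x ≠ 1)
    (h : Subgroup.centralizer ({x} : Set G) ≤ Subgroup.centralizer (N : Set G)) :
    Nat.card N ≤ 3 := by
  rw [← hN.card_commutator_centralizer hx hx1]
  apply card_commutator_le_three
  · rw [hN.commutator_centralizer hx hx1]
    intro y hy
    rw [Subgroup.mem_center_iff]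
    intro c
    exact Subtype.ext (Subgroup.mem_centralizer_iff.mp (h c.2) y hy).symm
  · rw [hN.card_commutator_centralizer hx hx1, hN.card_centralizer hx hx1]
  · intro hbot
    have h1 := hN.card_commutator_centralizer hx hx1
    rw [hbot, Subgroup.card_bot] at h1
    exact hN.ne_bot (Subgroup.card_eq_one.mp h1.symm)

/-- On `N` the involution acts by inversion, which commutes with every automorphism; so `t` is
central modulo the centralizer of `N`. -/
theorem conj_mul_inv_mem_centralizer {t : G} (ht : t * t = 1) (ht1 : t ≠ 1) (g : G) :
    t * g * t⁻¹ * g⁻¹ ∈ Subgroup.centralizer (N : Set G) := by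
  rw [Subgroup.mem_centralizer_iff]
  intro y hy
  have hg : g⁻¹ * y * g ∈ N := by simpa using hN.normal.conj_mem y hy g⁻¹
  have h1 := hN.conj_eq_inv_of_involution ht ht1 hg
  have hinv : t⁻¹ = t := inv_eq_of_mul_eq_one_left ht
  have h2 := hN.conj_eq_inv_of_involution ht ht1 (inv_mem hy)
  rw [inv_inv] at h2
  have h4 : t⁻¹ * (g⁻¹ * y * g) * t = (g⁻¹ * y * g)⁻¹ := by rw [← h1, hinv]
  symm
  calc t * g * t⁻¹ * g⁻¹ * y = t * g * (t⁻¹ * (g⁻¹ * y * g) * t) * t⁻¹ * g⁻¹ := by group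
    _ = (t * y⁻¹ * t⁻¹) * (t * g * t⁻¹ * g⁻¹) := by rw [h4]; group
    _ = y * (t * g * t⁻¹ * g⁻¹) := by rw [h2]

theorem le_centralizer : N ≤ Subgroup.centralizer (N : Set G) := fun x hx => by
  rw [Subgroup.mem_centralizer_iff]
  exact fun y hy => hN.mul_comm_of_mem hy hx

/-! ### The case where `N` has index three in its centralizer -/

section IndexThree

variable (hD : Nat.card (Subgroup.centralizer (N : Set G)) = 3 * Nat.card N)

include hD

theorem card_map_centralizer [N.Normal] :
    Nat.card ((Subgroup.centralizer (N : Set G)).map (QuotientGroup.mk' N)) = 3 := by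
  set D := Subgroup.centralizer (N : Set G)
  let f : D →* G ⧸ N := (QuotientGroup.mk' N).comp D.subtype
  have hker : f.ker = N.subgroupOf D := by
    rw [← MonoidHom.comap_ker, QuotientGroup.ker_mk']
    rfl
  have hrange : f.range = D.map (QuotientGroup.mk' N) := by
    rw [MonoidHom.range_comp, Subgroup.range_subtype]
  have h1 := f.ker.card_mul_index
  rw [Subgroup.index_ker, hrange, hker,
    Nat.card_congr (Subgroup.subgroupOfEquivOfLe hN.le_centralizer).toEquiv, hD, mul_comm 3] at h1
  exact Nat.eq_of_mul_eq_mul_left Nat.card_pos h1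

theorem pow_three_mem_of_mem_centralizer {d : G} (hd : d ∈ Subgroup.centralizer (N : Set G)) :
    d ^ 3 ∈ N := by
  have := hN.normal
  have h1 := hN.card_map_centralizer hD
  rw [← QuotientGroup.eq_one_iff, QuotientGroup.mk_pow, ← h1]
  exact congrArg Subtype.val (pow_card_eq_one'
    (x := (⟨_, Subgroup.mem_map_of_mem (QuotientGroup.mk' N) hd⟩ :
      (Subgroup.centralizer (N : Set G)).map (QuotientGroup.mk' N))))

theorem mul_comm_of_mem_centralizer {a b : G} (ha : a ∈ Subgroup.centralizer (N : Set G))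
    (hb : b ∈ Subgroup.centralizer (N : Set G)) : a * b = b * a := by
  have := hN.normal
  have : Fact (Nat.Prime 3) := ⟨Nat.prime_three⟩
  set D := Subgroup.centralizer (N : Set G)
  have hcyc : IsCyclic (D.map (QuotientGroup.mk' N)) :=
    isCyclic_of_prime_card (hN.card_map_centralizer hD)
  let f : D →* D.map (QuotientGroup.mk' N) := (QuotientGroup.mk' N).subgroupMap D
  have hker : f.ker ≤ Subgroup.center D := by
    intro y hy
    have h1 : QuotientGroup.mk' N (y : G) = 1 := congrArg Subtype.val hy
    have hyN : (y : G) ∈ N := (QuotientGroup.eq_one_iff _).mp h1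
    rw [Subgroup.mem_center_iff]
    exact fun c => Subtype.ext (Subgroup.mem_centralizer_iff.mp c.2 y hyN).symm
  exact congrArg Subtype.val
    ((f.isMulCommutative_of_isCyclic_of_ker_le_center hker).is_comm.comm (⟨a, ha⟩ : D) ⟨b, hb⟩)

/-- On the abelian group `D` cubing is a homomorphism that kills `N`. Its image contains a
nontrivial element of `N`, hence by conjugation all of `N`, so `n² ≤ 3n`. -/
theorem card_le_three_of_pow_three_ne_one {d : G} (hd : d ∈ Subgroup.centralizer (N : Set G))
    (hd3 : d ^ 3 ≠ 1) : Nat.card N ≤ 3 := by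
  have := hN.normal
  set D := Subgroup.centralizer (N : Set G) with hDdef
  let f : D →* G :=
    { toFun := fun a => (a : G) ^ 3
      map_one' := one_pow 3
      map_mul' := fun a b => by
        have : Commute (a : G) b := hN.mul_comm_of_mem_centralizer hD a.2 b.2
        exact this.mul_pow 3 }
  have h1 := f.ker.card_mul_index
  rw [Subgroup.index_ker, hD] at h1
  have h2 : Nat.card N ≤ Nat.card f.ker := by
    rw [← Nat.card_congr (Subgroup.subgroupOfEquivOfLe hN.le_centralizer).toEquiv]
    refine Subgroup.card_le_of_le fun y hy => ?_
    exact hN.pow_three_of_mem hy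
  have h3 : Nat.card N ≤ Nat.card f.range := by
    refine Subgroup.card_le_of_le fun y hy => ?_
    by_cases hy1 : y = 1
    · exact hy1 ▸ one_mem _
    · obtain ⟨g, rfl⟩ := hN.conj _ (hN.pow_three_mem_of_mem_centralizer hD hd) y hy hd3 hy1
      have hDn : D.Normal := inferInstance
      exact ⟨⟨g * d * g⁻¹, hDn.conj_mem d hd g⟩, conj_pow⟩
  have hpos : 0 < Nat.card N := Nat.card_pos
  nlinarith

/-- The abelian group `D` has index three in `C`. For `b ∈ C` outside `D`, the equality `|[C,C]| =
n` leaves exactly three elements of `D` commuting with `b`, and `b³ ∈ D` acts trivially on `D`. So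
`card_le_of_card_fixed_le` applies to conjugation by `b`. -/
theorem card_centralizer_le {x : G} (hx : x ∈ N) (hx1 : x ≠ 1)
    (hexp : ∀ d ∈ Subgroup.centralizer (N : Set G), d ^ 3 = 1) :
    Nat.card (Subgroup.centralizer (N : Set G)) ≤ 27 := by
  have := hN.normal
  set D := Subgroup.centralizer (N : Set G) with hDdef
  set C := Subgroup.centralizer ({x} : Set G) with hCdef
  have hDC : D ≤ C := Subgroup.centralizer_le (Set.singleton_subset_iff.mpr hx)
  have hpos : 0 < Nat.card N := Nat.card_pos
  have hDn : D.Normal := inferInstance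
  let A := D.subgroupOf C
  have hAcard : Nat.card A = 3 * Nat.card N := by
    rw [← hD]; exact Nat.card_congr (Subgroup.subgroupOfEquivOfLe hDC).toEquiv
  have hAindex : A.index = 3 := by
    have h1 := A.card_mul_index
    rw [hAcard, hN.card_centralizer hx hx1] at h1
    have h2 : 3 * Nat.card N * A.index = 3 * Nat.card N * 3 := by rw [h1]; ring
    exact Nat.eq_of_mul_eq_mul_left (by omega) h2
  have hAcomm : ∀ a ∈ A, ∀ b ∈ A, a * b = b * a := fun a ha b hb =>
    Subtype.ext (hN.mul_comm_of_mem_centralizer hD ha hb)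
  obtain ⟨b, hb⟩ : ∃ b, b ∉ A := by
    by_contra! h
    have h2 : A = ⊤ := eq_top_iff.mpr fun x _ => h x
    rw [h2, Subgroup.index_top] at hAindex
    omega
  have hQ := card_commutator_mul_card A hAcomm b
    (sup_zpowers_eq_top_of_index_prime (hAindex ▸ Nat.prime_three) hb)
  rw [hN.card_commutator_centralizer hx hx1, hAcard, mul_comm 3] at hQ
  have hfix := Nat.eq_of_mul_eq_mul_left hpos hQ
  have hb3 : b ^ 3 ∈ A := by
    rw [← QuotientGroup.eq_one_iff, QuotientGroup.mk_pow, ← hAindex, Subgroup.index_eq_card]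
    exact pow_card_eq_one'
  let _ : CommGroup A := { (inferInstance : Group A) with
    mul_comm := fun a b => Subtype.ext (hAcomm a a.2 b b.2) }
  have hAn : A.Normal := inferInstance
  let φ : A →* A :=
    { toFun := fun a => ⟨b * a * b⁻¹, hAn.conj_mem a a.2 b⟩
      map_one' := Subtype.ext (by simp)
      map_mul' := fun a a' => Subtype.ext (by simp [mul_assoc]) }
  have h27 := card_le_of_card_fixed_le (A := Additive A) (MonoidHom.toAdditive φ)
    (fun a => Subtype.ext (Subtype.ext (hexp _ (Additive.toMul a).2)))
    (fun a => Subtype.ext (by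
      have h1 := hAcomm _ hb3 (Additive.toMul a : A) (Additive.toMul a).2
      change b * (b * (b * ((Additive.toMul a : A) : C) * b⁻¹) * b⁻¹) * b⁻¹ = _
      calc b * (b * (b * ((Additive.toMul a : A) : C) * b⁻¹) * b⁻¹) * b⁻¹
          = b ^ 3 * ((Additive.toMul a : A) : C) * (b ^ 3)⁻¹ := by rw [pow_succ, pow_two]; group
        _ = ((Additive.toMul a : A) : C) := by rw [h1, mul_inv_cancel_right]))
    (by
      rw [← hfix]
      refine le_of_eq (Nat.card_congr (Equiv.subtypeEquiv Additive.toMul fun a => ?_))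
      change φ (Additive.toMul a) = Additive.toMul a ↔ _
      rw [Subtype.ext_iff]
      change b * ((Additive.toMul a : A) : C) * b⁻¹ = _ ↔ _
      rw [mul_inv_eq_iff_eq_mul, eq_comm])
  have h3 : Nat.card (Additive A) = Nat.card A := rfl
  rw [h3, hAcard] at h27
  omega

/-- For `n = 9` the order is `648`. A product of two involutions centralizes `N`, so a subgroup of
order `8`, meeting `D` trivially, has at most one involution, and some involution is a square `t =
g²`. As a square, `t` acts trivially on `D/N`, of order three; but it inverts each `[t, c]`, which
lies in `D`. So `[t, c] ∈ N` for all `c`, which is impossible. -/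
theorem card_ne_nine : Nat.card N ≠ 9 := by
  intro h9
  have := hN.normal
  set D := Subgroup.centralizer (N : Set G) with hDdef
  have hG : Nat.card G = 648 := by rw [hN.card, h9]
  have : Fact (Nat.Prime 2) := ⟨Nat.prime_two⟩
  obtain ⟨S, hS⟩ := Sylow.exists_subgroup_card_pow_prime (G := G) 2 (n := 3)
    (by rw [hG]; norm_num)
  have hSD : ∀ s ∈ S, s ∈ D → s = 1 := by
    intro s hs hsD
    have hcop : Nat.Coprime (Nat.card S) (Nat.card D) := by rw [hS, hD, h9]; norm_num
    have := (Subgroup.disjoint_of_coprime_natCard hcop).eq_bot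
    have h1 : s ∈ S ⊓ D := ⟨hs, hsD⟩
    rwa [this, Subgroup.mem_bot] at h1
  obtain ⟨g, hg1, hg2⟩ := exists_mul_self_involution hS (by
    intro s t hs ht hs1 ht1
    have hs' : (s : G) * s = 1 := congrArg Subtype.val hs
    have ht' : (t : G) * t = 1 := congrArg Subtype.val ht
    have hst : (s * t : G) ∈ D := by
      rw [hDdef, Subgroup.mem_centralizer_iff]
      intro y hy
      have h1 := hN.conj_eq_inv_of_involution ht' (fun h => ht1 (Subtype.ext h)) hy
      have h2 := hN.conj_eq_inv_of_involution hs' (fun h => hs1 (Subtype.ext h)) (inv_mem hy)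
      rw [inv_inv, ← h1] at h2
      symm
      rw [← mul_inv_eq_iff_eq_mul]
      calc (s * t : G) * y * (s * t : G)⁻¹ = s * (t * y * (t : G)⁻¹) * (s : G)⁻¹ := by group
        _ = y := h2
    have := hSD _ (S.mul_mem s.2 t.2) hst
    have h3 : s * t = 1 := Subtype.ext this
    rw [eq_inv_of_mul_eq_one_left h3]
    exact inv_eq_of_mul_eq_one_left ht)
  obtain ⟨x, hx, hx1⟩ := N.ne_bot_iff_exists_ne_one.mp hN.ne_bot |>.elim
    fun a ha => (⟨a, a.2, fun h => ha (Subtype.ext h)⟩ : ∃ x ∈ N, x ≠ 1)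
  have ht : ((g : G) * g) * (g * g) = 1 := congrArg Subtype.val hg2
  have ht1 : (g : G) * g ≠ 1 := fun h => hg1 (Subtype.ext h)
  set t : G := g * g with htdef
  refine hN.not_forall_conj_mul_inv_mem ht ht1 hx hx1 fun c _ => ?_
  have hinv : t⁻¹ = t := inv_eq_of_mul_eq_one_left ht
  set δ := t * c * t⁻¹ * c⁻¹ with hδ
  have hδD : δ ∈ D := hN.conj_mul_inv_mem_centralizer ht ht1 c
  have h1 : t * δ * t⁻¹ = δ⁻¹ := by
    rw [hδ]
    calc t * (t * c * t⁻¹ * c⁻¹) * t⁻¹ = (t * t) * c * t⁻¹ * c⁻¹ * t⁻¹ := by group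
      _ = c * t * c⁻¹ * t⁻¹ := by rw [ht, one_mul, hinv]
      _ = _ := by group
  have hq := mul_self_conj_eq_of_card_eq_three (D.map (QuotientGroup.mk' N))
    (hN.card_map_centralizer hD) (QuotientGroup.mk' N g)
    (Subgroup.mem_map_of_mem (QuotientGroup.mk' N) hδD)
  rw [← map_mul, ← map_mul, ← map_inv, ← map_mul, ← htdef, h1, map_inv] at hq
  have h3 : (QuotientGroup.mk' N δ) ^ 3 = 1 := by
    rw [← map_pow]
    exact (QuotientGroup.eq_one_iff _).mpr (hN.pow_three_mem_of_mem_centralizer hD hδD)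
  apply (QuotientGroup.eq_one_iff (N := N) δ).mp
  change QuotientGroup.mk' N δ = 1
  rw [pow_succ, pow_two] at h3
  nth_rewrite 1 [← hq] at h3
  rwa [inv_mul_cancel, one_mul] at h3

end IndexThree

theorem card_eq_three : Nat.card N = 3 := by
  have := hN.normal
  obtain ⟨k, hk0, hk⟩ := hN.exists_card_eq
  obtain ⟨x, hx, hx1⟩ := N.ne_bot_iff_exists_ne_one.mp hN.ne_bot |>.elim
    fun a ha => (⟨a, a.2, fun h => ha (Subtype.ext h)⟩ : ∃ x ∈ N, x ≠ 1)
  have hk1 : 3 ^ 1 ≤ 3 ^ k := Nat.pow_le_pow_right (by norm_num) hk0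
  have hpos : 0 < Nat.card N := Nat.card_pos
  suffices hle : Nat.card N ≤ 3 by rw [hk.2.2] at hle ⊢; omega
  set D := Subgroup.centralizer (N : Set G) with hDdef
  set C := Subgroup.centralizer ({x} : Set G) with hCdef
  have hDC : D ≤ C := Subgroup.centralizer_le (Set.singleton_subset_iff.mpr hx)
  have hND : N ≤ D := hN.le_centralizer
  have hCcard : Nat.card C = 9 * Nat.card N := hN.card_centralizer hx hx1
  obtain ⟨j, hj⟩ := Subgroup.card_dvd_of_le hND
  have hj9 : j ∣ 3 ^ 2 := by
    have h1 := Subgroup.card_dvd_of_le hDC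
    rw [hj, hCcard, mul_comm 9] at h1
    exact Nat.dvd_of_mul_dvd_mul_left hpos h1
  obtain ⟨i, hi, rfl⟩ := (Nat.dvd_prime_pow Nat.prime_three).mp hj9
  have heven : 2 ∣ Nat.card G := by
    have hodd : Odd (Nat.card N) := by rw [hk.2.2]; exact Odd.pow (by decide)
    rw [hN.card]
    obtain ⟨m, hm⟩ := hodd
    exact Dvd.dvd.mul_left ⟨m, by omega⟩ _
  have : Fact (Nat.Prime 2) := ⟨Nat.prime_two⟩
  obtain ⟨t, ht⟩ := exists_prime_orderOf_dvd_card' 2 heven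
  have ht1 : t ≠ 1 := fun h => by rw [h, orderOf_one] at ht; omega
  have ht2 : t * t = 1 := by rw [← pow_two, ← ht, pow_orderOf_eq_one]
  -- The cases are `D = N`, where `t` would be central modulo `N`; index three; and `D = C`, where
  -- `N` is central in `C`.
  interval_cases i
  · exfalso
    rw [pow_zero, mul_one] at hj
    have hDN : N = D := Subgroup.eq_of_le_of_card_ge hND hj.le
    refine hN.not_forall_conj_mul_inv_mem ht2 ht1 hx hx1 fun c _ => ?_
    rw [hDN]
    exact hN.conj_mul_inv_mem_centralizer ht2 ht1 c
  · rw [pow_one, mul_comm] at hj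
    by_cases hexp : ∀ d ∈ D, d ^ 3 = 1
    · have h27 := hN.card_centralizer_le hj hx hx1 hexp
      have h9 := hN.card_ne_nine hj
      rw [← hDdef, hj] at h27
      have hle9 : Nat.card N ≤ 9 := by omega
      rw [hk.2.2] at hle9 h9 ⊢
      have hk2 : k < 3 := (Nat.pow_lt_pow_iff_right (by norm_num : 1 < 3)).mp (by omega)
      interval_cases k <;> omega
    · push Not at hexp
      obtain ⟨d, hd, hd3⟩ := hexp
      exact hN.card_le_three_of_pow_three_ne_one hj hd hd3
  · have hDC' : D = C := Subgroup.eq_of_le_of_card_ge hDC (by rw [hj, hCcard]; omega)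
    exact hN.card_le_three_of_central hx hx1 hDC'.ge

end IsFusedNormalSubgroup

/-! ### Structure conditions in order `54` -/

/-- A subgroup of order `27` in a group of order `54` is a Sylow `3`-subgroup. -/
theorem exists_sylow_eq_of_card {G : Type*} [Group G] (hG : Nat.card G = 54) {H : Subgroup G}
    (hH : Nat.card H = 27) : ∃ P : Sylow 3 G, (P : Subgroup G) = H := by
  have : Finite G := Nat.finite_of_card_ne_zero (by rw [hG]; norm_num)
  have : Fact (Nat.Prime 3) := ⟨Nat.prime_three⟩
  refine ⟨Sylow.ofCard H ?_, rfl⟩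
  have h1 : (54 : ℕ).factorization 3 = 3 := by
    have h2 : (54 : ℕ) = 2 * 3 ^ 3 := by norm_num
    rw [h2, Nat.factorization_mul (by norm_num) (by norm_num), Nat.Prime.factorization_pow
      Nat.prime_three]
    simp only [Finsupp.add_apply, Finsupp.single_eq_same]
    rw [Nat.factorization_eq_zero_of_not_dvd (by norm_num), zero_add]
  rw [hG, hH, h1]
  norm_num

namespace IsFusedNormalSubgroup

variable {G : Type*} [Group G] [Finite G] {N : Subgroup G} (hN : IsFusedNormalSubgroup N)

include hN

theorem card_eq_fiftyFour : Nat.card G = 54 := by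
  rw [hN.card, hN.card_eq_three]

theorem structureConditions : StructureConditions N 6 3 := by
  refine ⟨hN.normal, hN.ne_bot, fun x hx hx1 => ⟨3, 1, 1, Nat.prime_three, one_pos, ?_, ?_, ?_, ?_⟩⟩
  · exact ⟨fun a ha b hb => hN.mul_comm_of_mem ha hb, fun a ha => hN.pow_three_of_mem ha,
      by rw [hN.card_eq_three, pow_one]⟩
  · exact ⟨by rw [hN.card_centralizer hx hx1, hN.card_eq_three]; norm_num, by norm_num,
      by rw [hN.card_eq_fiftyFour]; norm_num⟩
  · exact ⟨exists_sylow_eq_of_card hN.card_eq_fiftyFour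
      (by rw [hN.card_centralizer hx hx1, hN.card_eq_three]), by norm_num⟩
  · intro H hNH _ hcard
    exact hN.le_commutator hNH (by rw [hN.card_eq_three]; simpa using hcard)

end IsFusedNormalSubgroup

/-- A finite group of order `d * (d + 3)` with a simple module of dimension `d ≥ 3` has order `54`
and satisfies the structure conditions. -/
theorem exists_structureConditions {G : Type*} [Group G] [Finite G] (V : Type*) [AddCommGroup V]
    [Module ℂ V] [Module (MonoidAlgebra ℂ G) V] [IsScalarTower ℂ (MonoidAlgebra ℂ G) V]
    [IsSimpleModule (MonoidAlgebra ℂ G) V]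
    (hcard : finrank ℂ V * (finrank ℂ V + 3) = Nat.card G) (hd : 3 ≤ finrank ℂ V) :
    Nat.card G = 54 ∧ finrank ℂ V = 6 ∧
      ∃ N : Subgroup G, ActsTriviallyOffModule N V ∧ StructureConditions N 6 3 := by
  cases nonempty_fintype G
  have hN := isFusedNormalSubgroup_offKernel hcard hd
  have h1 := card_offKernel hcard hd
  rw [hN.card_eq_three] at h1
  exact ⟨hN.card_eq_fiftyFour, by omega, offKernel V, actsTriviallyOffModule_offKernel V,
    hN.structureConditions⟩

/-! ### Affine groups of rings -/

/-- The group of affine transformations `x ↦ scale * x + shift` of a commutative ring. -/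
@[ext]
structure AffineGroup (R : Type*) [CommRing R] where
  /-- The translation part. -/
  shift : R
  /-- The linear part. -/
  scale : Rˣ

namespace AffineGroup

variable {R : Type*} [CommRing R]

instance : Group (AffineGroup R) where
  mul x y := ⟨x.shift + x.scale * y.shift, x.scale * y.scale⟩
  one := ⟨0, 1⟩
  inv x := ⟨-((x.scale⁻¹ : Rˣ) * x.shift), x.scale⁻¹⟩
  mul_assoc x y z := AffineGroup.ext
    (by change x.shift + x.scale * y.shift + ((x.scale * y.scale : Rˣ) : R) * z.shift
            = x.shift + x.scale * (y.shift + y.scale * z.shift)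
        push_cast; ring)
    (mul_assoc x.scale y.scale z.scale)
  one_mul x := AffineGroup.ext
    (by change 0 + ((1 : Rˣ) : R) * x.shift = x.shift
        simp) (one_mul x.scale)
  mul_one x := AffineGroup.ext
    (by change x.shift + x.scale * 0 = x.shift
        simp) (mul_one x.scale)
  inv_mul_cancel x := AffineGroup.ext
    (by change -((x.scale⁻¹ : Rˣ) * x.shift) + (x.scale⁻¹ : Rˣ) * x.shift = 0
        simp) (inv_mul_cancel x.scale)

@[simp] theorem shift_one : (1 : AffineGroup R).shift = 0 := rfl

@[simp] theorem scale_one : (1 : AffineGroup R).scale = 1 := rfl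

@[simp] theorem shift_mul (x y : AffineGroup R) :
    (x * y).shift = x.shift + x.scale * y.shift := rfl

@[simp] theorem scale_mul (x y : AffineGroup R) : (x * y).scale = x.scale * y.scale := rfl

variable (R) in
/-- An affine transformation is determined by its translation part and its linear part. -/
def equivProd : AffineGroup R ≃ R × Rˣ where
  toFun x := (x.shift, x.scale)
  invFun x := ⟨x.1, x.2⟩

theorem card : Nat.card (AffineGroup R) = Nat.card R * Nat.card Rˣ := by
  rw [Nat.card_congr (equivProd R), Nat.card_prod]

instance [Finite R] : Finite (AffineGroup R) := Finite.of_equiv _ (equivProd R).symm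

theorem shift_pow (x : AffineGroup R) (n : ℕ) :
    (x ^ n).shift = (∑ i ∈ Finset.range n, (x.scale : R) ^ i) * x.shift := by
  induction n with
  | zero => simp
  | succ n ih =>
    rw [pow_succ', shift_mul, ih, Finset.sum_range_succ', Finset.sum_mul, Finset.mul_sum,
      add_mul, Finset.sum_mul, pow_zero, one_mul, add_comm]
    simp only [pow_succ', mul_assoc]

theorem scale_pow (x : AffineGroup R) (n : ℕ) : (x ^ n).scale = x.scale ^ n := by
  induction n with
  | zero => simp
  | succ n ih => rw [pow_succ, scale_mul, ih, pow_succ]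

/-- A pair of compatible homomorphisms on translations and on dilations gives a homomorphism on
the affine group. -/
def lift {G : Type*} [Group G] (f : Multiplicative R →* G) (χ : Rˣ →* G)
    (h : ∀ (u : Rˣ) (r : R), χ u * f (.ofAdd r) = f (.ofAdd (u * r)) * χ u) :
    AffineGroup R →* G where
  toFun x := f (.ofAdd x.shift) * χ x.scale
  map_one' := by simp
  map_mul' x y := by
    rw [shift_mul, scale_mul, ofAdd_add, map_mul f, map_mul χ, mul_assoc (f _), ← mul_assoc (f _)
      (χ x.scale), ← h]
    simp only [mul_assoc]

/-- Recognition of the affine group of a finite ring whose group of units is generated by a unit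
`u` for which `u - 1` is a unit too. -/
theorem nonempty_mulEquiv {G : Type*} [Group G] [Finite G] [Finite R]
    (hcard : Nat.card (AffineGroup R) = Nat.card G) (f : Multiplicative R →* G)
    (hf : Function.Injective f) {u : Rˣ} (hu : ∀ v : Rˣ, v ∈ Subgroup.zpowers u)
    (hu1 : IsUnit ((u : R) - 1)) {c : G} (hc : orderOf c = orderOf u)
    (h : ∀ r : R, c * f (.ofAdd r) * c⁻¹ = f (.ofAdd (u * r))) :
    Nonempty (G ≃* AffineGroup R) := by
  let χ : Rˣ →* G := monoidHomOfForallMemZpowers hu hc.dvd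
  have hχ : χ u = c := monoidHomOfForallMemZpowers_apply_gen hu hc.dvd
  have hfχ : ∀ (v : Rˣ) (r : R), χ v * f (.ofAdd r) = f (.ofAdd (v * r)) * χ v := by
    intro v r
    obtain ⟨n, rfl⟩ := (mem_powers_iff_mem_zpowers.mpr (hu v) : v ∈ Submonoid.powers u)
    induction n generalizing r with
    | zero => simp
    | succ n ih =>
      change χ (u ^ (n + 1)) * f (.ofAdd r) = f (.ofAdd (((u ^ (n + 1) : Rˣ) : R) * r)) * χ (u ^ (n + 1))
      have h1 := ih (r := u * r)
      change χ (u ^ n) * f (.ofAdd (u * r)) = f (.ofAdd (((u ^ n : Rˣ) : R) * (u * r))) * χ (u ^ n) at h1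
      rw [← h r] at h1
      rw [pow_succ, map_mul, hχ]
      calc χ (u ^ n) * c * f (.ofAdd r) = χ (u ^ n) * (c * f (.ofAdd r) * c⁻¹) * c := by group
        _ = _ := by rw [h1]; push_cast; simp only [mul_assoc]
  have hinj : Function.Injective (lift f χ hfχ) := by
    rw [injective_iff_map_eq_one]
    intro x hx
    change f (.ofAdd x.shift) * χ x.scale = 1 at hx
    have hcomm : c * χ x.scale = χ x.scale * c := by
      rw [← hχ, ← map_mul, ← map_mul, mul_comm]
    have hfx : f (.ofAdd x.shift) = (χ x.scale)⁻¹ := eq_inv_of_mul_eq_one_left hx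
    -- The translation equals `(χ x.scale)⁻¹`, which commutes with `c`. So `u` fixes `x.shift`, and
    -- `u - 1` is invertible.
    have h0 : x.shift = 0 := by
      have h1 := h x.shift
      have h2 : c * f (.ofAdd x.shift) * c⁻¹ = f (.ofAdd x.shift) := by
        rw [hfx, mul_inv_eq_iff_eq_mul, eq_inv_mul_iff_mul_eq, ← mul_assoc, ← hcomm, mul_assoc,
          mul_inv_cancel, mul_one]
      have h3 : x.shift = u * x.shift := Multiplicative.ofAdd.injective (hf (h2.symm.trans h1))
      rw [← hu1.mul_right_eq_zero, sub_mul, ← h3, one_mul, sub_self]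
    rw [h0, ofAdd_zero, map_one, one_mul] at hx
    obtain ⟨n, hn⟩ := Subgroup.mem_zpowers_iff.mp (hu x.scale)
    refine AffineGroup.ext h0 ?_
    rw [← hn, map_zpow, hχ, ← orderOf_dvd_iff_zpow_eq_one, hc, orderOf_dvd_iff_zpow_eq_one, hn] at hx
    exact hx
  exact ⟨(MulEquiv.ofBijective _ ((Nat.bijective_iff_injective_and_card _).mpr ⟨hinj, hcard⟩)).symm⟩

end AffineGroup

/-! ### Nonabelian groups of order `27` -/

/-- Two nontrivial elements of a group of order three are equal or inverse to each other. -/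
theorem mul_eq_one_or_mul_inv_eq_one_of_card_eq_three {Q : Type*} [Group Q] (hQ : Nat.card Q = 3)
    {a b : Q} (ha : a ≠ 1) (hb : b ≠ 1) : a * b = 1 ∨ a * b⁻¹ = 1 := by
  by_contra! h
  have : Finite Q := Nat.finite_of_card_ne_zero (by rw [hQ]; norm_num)
  cases nonempty_fintype Q
  classical
  have h1 : ({1, a, b, a * b} : Finset Q).card = 4 := by
    have hab : a ≠ b := fun e => h.2 (by rw [e, mul_inv_cancel])
    rw [Finset.card_insert_of_notMem, Finset.card_insert_of_notMem, Finset.card_insert_of_notMem,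
      Finset.card_singleton]
    · simpa using ha
    · simpa [hab] using hb
    · simpa using ⟨ha.symm, hb.symm, h.1.symm⟩
  have h2 := Finset.card_le_univ ({1, a, b, a * b} : Finset Q)
  rw [h1, ← Nat.card_eq_fintype_card, hQ] at h2
  omega

/-- The version of `mul_eq_one_or_mul_inv_eq_one_of_card_eq_three` for a subgroup. -/
theorem mul_eq_one_or_mul_inv_eq_one_of_mem {G : Type*} [Group G] {M : Subgroup G}
    (hM : Nat.card M = 3) {a b : G} (ha : a ∈ M) (hb : b ∈ M) (ha1 : a ≠ 1) (hb1 : b ≠ 1) :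
    a * b = 1 ∨ a * b⁻¹ = 1 := by
  have := mul_eq_one_or_mul_inv_eq_one_of_card_eq_three hM (a := ⟨a, ha⟩) (b := ⟨b, hb⟩)
    (fun h => ha1 (congrArg Subtype.val h)) (fun h => hb1 (congrArg Subtype.val h))
  exact this.imp (congrArg Subtype.val) (congrArg Subtype.val)

section NonabelianOrder27

variable {K : Type*} [Group K] {M : Subgroup K} (hK : Nat.card K = 27) (hM : Nat.card M = 3)
  (hMc : M ≤ Subgroup.center K)

include hK hM

theorem card_quotient_eq_nine : Nat.card (K ⧸ M) = 3 ^ 2 := by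
  have h1 := M.card_mul_index
  rw [hM, hK] at h1
  rw [← Subgroup.index_eq_card]
  omega

include hMc

theorem center_eq_of_card_eq {c d : K} (hcd : c * d ≠ d * c) : Subgroup.center K = M := by
  have : Fact (Nat.Prime 3) := ⟨Nat.prime_three⟩
  have : Finite K := Nat.finite_of_card_ne_zero (by rw [hK]; norm_num)
  have h1 := card_center_of_card_eq_prime_cube (K := K) (p := 3) (by rw [hK]; norm_num)
    fun h => hcd (h c d)
  exact (Subgroup.eq_of_le_of_card_ge hMc (by rw [h1.1, hM])).symm

theorem commutator_mem_of_card_eq {c d : K} (hcd : c * d ≠ d * c) (x y : K) :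
    x * y * x⁻¹ * y⁻¹ ∈ M := by
  have : Fact (Nat.Prime 3) := ⟨Nat.prime_three⟩
  rw [← center_eq_of_card_eq hK hM hMc hcd]
  exact (card_center_of_card_eq_prime_cube (K := K) (p := 3) (by rw [hK]; norm_num)
    fun h => hcd (h c d)).2 x y

theorem pow_three_mem_of_card_eq {c d : K} (hcd : c * d ≠ d * c) (x : K) : x ^ 3 ∈ M := by
  have : M.Normal := ⟨fun n hn g => by
    rw [(Subgroup.mem_center_iff.mp (hMc hn) g), mul_assoc, mul_inv_cancel, mul_one]; exact hn⟩
  have : Finite K := Nat.finite_of_card_ne_zero (by rw [hK]; norm_num)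
  have hq := card_quotient_eq_nine hK hM
  rw [← QuotientGroup.eq_one_iff, QuotientGroup.mk_pow, ← orderOf_dvd_iff_pow_eq_one]
  obtain ⟨i, hi, h⟩ := (Nat.dvd_prime_pow Nat.prime_three).mp (hq ▸ orderOf_dvd_natCard (x : K ⧸ M))
  rw [h]
  by_cases hi2 : i = 2
  · exfalso
    have : IsCyclic (K ⧸ M) := isCyclic_of_orderOf_eq_card (x : K ⧸ M) (by rw [h, hi2, hq])
    have hker : (QuotientGroup.mk' M).ker ≤ Subgroup.center K := by
      rw [QuotientGroup.ker_mk']; exact hMc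
    exact hcd (((QuotientGroup.mk' M).isMulCommutative_of_isCyclic_of_ker_le_center
      hker).is_comm.comm c d)
  · exact (pow_dvd_pow 3 (by omega : i ≤ 1)).trans (by norm_num)

/-- The centralizer of `a` lies strictly between `M`, which is the centre, and `K`. Its quotient by
`M` has order three, so the classes of `a` and `b` there are equal or inverse. -/
theorem mul_mem_or_of_commute {c d : K} (hcd : c * d ≠ d * c) {a b : K} (ha : a ∉ M)
    (hb : b ∉ M) (hab : a * b = b * a) : a * b ∈ M ∨ a * b⁻¹ ∈ M := by
  have hMn : M.Normal := ⟨fun n hn g => by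
    rw [(Subgroup.mem_center_iff.mp (hMc hn) g), mul_assoc, mul_inv_cancel, mul_one]; exact hn⟩
  have : Finite K := Nat.finite_of_card_ne_zero (by rw [hK]; norm_num)
  set H := Subgroup.centralizer ({a} : Set K) with hH
  have hMH : M ≤ H := hMc.trans (Subgroup.center_le_centralizer _)
  have hHtop : H ≠ ⊤ := by
    intro h
    refine ha ?_
    rw [← center_eq_of_card_eq hK hM hMc hcd, Subgroup.mem_center_iff]
    intro g
    exact Subgroup.mem_centralizer_singleton_iff.mp (h ▸ Subgroup.mem_top g : g ∈ H)
  have haH : a ∈ H := Subgroup.mem_centralizer_singleton_iff.mpr rfl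
  have hbH : b ∈ H := Subgroup.mem_centralizer_singleton_iff.mpr hab.symm
  have hcard : Nat.card (H ⧸ M.subgroupOf H) = 3 := by
    have h1 := (M.subgroupOf H).card_mul_index
    rw [Nat.card_congr (Subgroup.subgroupOfEquivOfLe hMH).toEquiv, hM,
      Subgroup.index_eq_card] at h1
    have h2 : Nat.card H ∣ 3 ^ 3 := (Subgroup.card_subgroup_dvd_card H).trans (by rw [hK]; norm_num)
    obtain ⟨i, hi, h⟩ := (Nat.dvd_prime_pow Nat.prime_three).mp h2
    have hi3 : i ≠ 3 := fun e => hHtop (Subgroup.eq_top_of_card_eq _ (by rw [h, e, hK]; norm_num))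
    have hne : Nat.card (H ⧸ M.subgroupOf H) ≠ 1 := by
      rw [← Subgroup.index_eq_card, Ne, Subgroup.index_eq_one]
      intro e
      exact ha ((e ▸ Subgroup.mem_top (⟨a, haH⟩ : H) : (⟨a, haH⟩ : H) ∈ M.subgroupOf H))
    interval_cases i <;> omega
  have hq := mul_eq_one_or_mul_inv_eq_one_of_card_eq_three hcard
    (a := ((⟨a, haH⟩ : H) : H ⧸ M.subgroupOf H)) (b := ((⟨b, hbH⟩ : H) : H ⧸ M.subgroupOf H))
    (fun h => ha ((QuotientGroup.eq_one_iff (N := M.subgroupOf H) ⟨a, haH⟩).mp h))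
    (fun h => hb ((QuotientGroup.eq_one_iff (N := M.subgroupOf H) ⟨b, hbH⟩).mp h))
  exact hq.imp (fun h => (QuotientGroup.eq_one_iff (N := M.subgroupOf H) (⟨a, haH⟩ * ⟨b, hbH⟩)).mp h)
    (fun h => (QuotientGroup.eq_one_iff (N := M.subgroupOf H) (⟨a, haH⟩ * ⟨b, hbH⟩⁻¹)).mp h)

end NonabelianOrder27

/-- An involutive automorphism of a nonabelian group of order `27` that inverts the centre has an
eigenvector for each of the two eigenvalues outside the centre. -/
theorem exists_fixed_and_inverted {K : Type*} [Group K] {M : Subgroup K} (hK : Nat.card K = 27)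
    (hM : Nat.card M = 3) (hMc : M ≤ Subgroup.center K) {c₀ d₀ : K} (hcd : c₀ * d₀ ≠ d₀ * c₀)
    (σ : K →* K) (hσ : ∀ c, σ (σ c) = c) (hσM : ∀ y ∈ M, σ y = y⁻¹) :
    (∃ a, a ∉ M ∧ σ a = a) ∧ ∃ b, b ∉ M ∧ σ b = b⁻¹ := by
  have hcent : ∀ y ∈ M, ∀ c : K, c * y = y * c := fun y hy => Subgroup.mem_center_iff.mp (hMc hy)
  have hM3 : ∀ y ∈ M, y ^ 3 = 1 := fun y hy => by
    have h1 := pow_card_eq_one' (x := (⟨y, hy⟩ : M))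
    rw [hM] at h1
    exact congrArg Subtype.val h1
  set w := c₀ * d₀ * c₀⁻¹ * d₀⁻¹ with hw
  have hwM : w ∈ M := commutator_mem_of_card_eq hK hM hMc hcd c₀ d₀
  -- If `σ` acted on `K/M` as `1` or as `-1`, the commutator `w` would be fixed. But `w` is inverted
  -- and has order three, so both eigenvalues must occur.
  have hσw : σ w ≠ w := by
    intro h
    rw [hσM w hwM, inv_eq_iff_mul_eq_one, ← pow_two] at h
    have h3 := hM3 w hwM
    rw [pow_succ, h, one_mul, hw, mul_inv_eq_one, mul_inv_eq_iff_eq_mul] at h3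
    exact hcd h3
  constructor
  · obtain ⟨c, hc⟩ : ∃ c, c * σ c ∉ M := by
      by_contra! h
      refine hσw ?_
      have h1 : ∀ c, ∃ y ∈ M, σ c = c⁻¹ * y := fun c => ⟨c * σ c, h c, by group⟩
      obtain ⟨y, hy, h2⟩ := h1 c₀
      obtain ⟨y', hy', h3⟩ := h1 d₀
      have h4 : c₀ * d₀ = w * (d₀ * c₀) := by rw [hw]; group
      rw [hw, map_mul, map_mul, map_mul, map_inv, map_inv, h2, h3, ← hw]
      calc c₀⁻¹ * y * (d₀⁻¹ * y') * (c₀⁻¹ * y)⁻¹ * (d₀⁻¹ * y')⁻¹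
          = c₀⁻¹ * (y * d₀⁻¹) * (y' * y⁻¹ * c₀) * y'⁻¹ * d₀ := by group
        _ = c₀⁻¹ * (d₀⁻¹ * y) * (c₀ * (y' * y⁻¹)) * y'⁻¹ * d₀ := by
            rw [hcent y hy, hcent _ (M.mul_mem hy' (M.inv_mem hy))]
        _ = c₀⁻¹ * d₀⁻¹ * (y * c₀) * (y' * y⁻¹) * y'⁻¹ * d₀ := by group
        _ = c₀⁻¹ * d₀⁻¹ * c₀ * y * (y' * y⁻¹) * y'⁻¹ * d₀ := by rw [← hcent y hy]; group
        _ = c₀⁻¹ * d₀⁻¹ * c₀ * y * (y⁻¹ * y') * y'⁻¹ * d₀ := by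
            rw [hcent _ (M.inv_mem hy) y']
        _ = (d₀ * c₀)⁻¹ * (c₀ * d₀) := by group
        _ = (d₀ * c₀)⁻¹ * (w * (d₀ * c₀)) := by rw [← h4]
        _ = w := by rw [← hcent w hwM]; group
    set v := c * σ c with hv
    set y := v⁻¹ * σ v with hy
    have hyM : y ∈ M := by
      have h1 := commutator_mem_of_card_eq hK hM hMc hcd (σ c)⁻¹ c⁻¹
      rw [hy, hv, map_mul, hσ]
      convert h1 using 1
      group
    have hσv : σ v = v * y := by rw [hy]; group
    -- The class of `v` modulo `M` is fixed, with `σ v = v y`. Multiplying by `y⁻¹` makes it fixed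
    -- exactly, since `σ` inverts `y` and `y³ = 1`.
    refine ⟨v * y⁻¹, fun h => hc ?_, ?_⟩
    · simpa using M.mul_mem h hyM
    · rw [map_mul, map_inv, hσM y hyM, hσv, inv_inv, mul_assoc]
      congr 1
      have h1 := hM3 y hyM
      rw [pow_succ, pow_two] at h1
      exact eq_inv_of_mul_eq_one_left h1
  · obtain ⟨c, hc⟩ : ∃ c, c * (σ c)⁻¹ ∉ M := by
      by_contra! h
      refine hσw ?_
      have h1 : ∀ c, ∃ y ∈ M, σ c = y * c := fun c =>
        ⟨σ c * c⁻¹, by simpa using M.inv_mem (h c), by group⟩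
      obtain ⟨y, hy, h2⟩ := h1 c₀
      obtain ⟨y', hy', h3⟩ := h1 d₀
      rw [hw, map_mul, map_mul, map_mul, map_inv, map_inv, h2, h3]
      calc y * c₀ * (y' * d₀) * (y * c₀)⁻¹ * (y' * d₀)⁻¹
          = y * (c₀ * y') * d₀ * c₀⁻¹ * (y⁻¹ * d₀⁻¹) * y'⁻¹ := by group
        _ = y * (y' * c₀) * d₀ * c₀⁻¹ * (d₀⁻¹ * y⁻¹) * y'⁻¹ := by
            rw [hcent y' hy', ← hcent _ (M.inv_mem hy)]
        _ = (y * y') * w * (y * y')⁻¹ * (y * (y' * y⁻¹) * y'⁻¹) := by rw [hw]; group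
        _ = w * (y * y') * (y * y')⁻¹ * (y * (y⁻¹ * y') * y'⁻¹) := by
            rw [hcent w hwM (y * y'), hcent _ (M.inv_mem hy) y']
        _ = w := by group
    refine ⟨c * (σ c)⁻¹, hc, ?_⟩
    rw [map_mul, map_inv, hσ, mul_inv_rev, inv_inv]

/-! ### Generators and relations from the structure conditions -/

/-- The numerical content of the structure conditions in order `54`. -/
theorem eq_three_of_structure_equations {p k m e : ℕ} (hp : p.Prime) (hk : 0 < k)
    (h : 54 = e ^ 2 * p ^ k * (p ^ k - 1)) (he : e = p ^ m) : p = 3 ∧ k = 1 ∧ e = 3 ∧ m = 1 := by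
  have hq2 : 2 ≤ p ^ k := hp.two_le.trans (Nat.le_self_pow hk.ne' p)
  have he1 : 0 < e := by rw [he]; exact pow_pos hp.pos _
  obtain ⟨q, hq⟩ : ∃ q, p ^ k = q := ⟨_, rfl⟩
  rw [hq] at h hq2
  have hq8 : q ≤ 8 := by
    by_contra! h9
    have h1 : 1 * 9 * 8 ≤ e ^ 2 * q * (q - 1) :=
      Nat.mul_le_mul (Nat.mul_le_mul (Nat.one_le_pow _ _ he1) h9) (by omega)
    omega
  have he7 : e ≤ 7 := by
    by_contra! h8
    have h1 : 8 ^ 2 * 1 * 1 ≤ e ^ 2 * q * (q - 1) :=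
      Nat.mul_le_mul (Nat.mul_le_mul (Nat.pow_le_pow_left h8 2) (by omega)) (by omega)
    omega
  have hqe : q = 3 ∧ e = 3 := by
    interval_cases q <;> first | omega | (interval_cases e <;> omega)
  obtain ⟨rfl, rfl⟩ := hqe
  have hp3 : p = 3 := (Nat.prime_dvd_prime_iff_eq hp Nat.prime_three).mp
    (hq ▸ dvd_pow_self p hk.ne')
  subst hp3
  refine ⟨rfl, Nat.pow_right_injective (le_refl 2 |>.trans (by norm_num : 2 ≤ 3)) ?_, rfl,
    Nat.pow_right_injective (le_refl 2 |>.trans (by norm_num : 2 ≤ 3)) ?_⟩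
  · simpa using hq
  · simpa using he.symm

namespace StructureConditions

variable {G : Type*} [Group G] {N : Subgroup G} {d e : ℕ}

theorem exists_card_centralizer (h : StructureConditions N d e) (hG : Nat.card G = 54) :
    Nat.card N = 3 ∧ ∃ x ∈ N, x ≠ 1 ∧ N ≤ Subgroup.centralizer ({x} : Set G) ∧
      Nat.card (Subgroup.centralizer ({x} : Set G)) = 27 ∧
      N ≤ ⁅Subgroup.centralizer ({x} : Set G), Subgroup.centralizer ({x} : Set G)⁆ := by
  obtain ⟨-, hne, h⟩ := h
  obtain ⟨x, hx, hx1⟩ := N.ne_bot_iff_exists_ne_one.mp hne |>.elim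
    fun a ha => (⟨a, a.2, fun h => ha (Subtype.ext h)⟩ : ∃ x ∈ N, x ≠ 1)
  obtain ⟨p, k, m, hp, hk, ⟨hcomm, -, hN⟩, ⟨hC, -, hcard⟩, ⟨-, he⟩, hH⟩ := h x hx hx1
  obtain ⟨rfl, rfl, rfl, rfl⟩ := eq_three_of_structure_equations hp hk (hG ▸ hcard) he
  have hNC : N ≤ Subgroup.centralizer ({x} : Set G) := fun y hy =>
    Subgroup.mem_centralizer_singleton_iff.mpr (hcomm y hy x hx)
  exact ⟨by rw [hN, pow_one], x, hx, hx1, hNC, by rw [hC]; norm_num,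
    hH _ hNC le_rfl (by rw [hC]; norm_num)⟩

open scoped commutatorElement in
/-- Generators and relations for a group of order `54` satisfying the structure conditions. -/
theorem exists_generators (h : StructureConditions N d e) (hG : Nat.card G = 54) :
    ∃ a b t z : G, orderOf t = 2 ∧ orderOf a = 3 ∧ orderOf z = 3 ∧ t * a = a * t ∧
      t * b * t⁻¹ = b⁻¹ ∧ t * z * t⁻¹ = z⁻¹ ∧ a * b * a⁻¹ = z * b ∧ a * z = z * a ∧
      b * z = z * b ∧ b ∉ Subgroup.zpowers z ∧ (b ^ 3 = 1 ∨ b ^ 3 = z ∨ b ^ 3 = z⁻¹) := by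
  have hNn : N.Normal := h.1
  have : Finite G := Nat.finite_of_card_ne_zero (by rw [hG]; norm_num)
  have : Fact (Nat.Prime 2) := ⟨Nat.prime_two⟩
  have : Fact (Nat.Prime 3) := ⟨Nat.prime_three⟩
  obtain ⟨hN3, x, hx, hx1, hNC, hC, hcomm⟩ := h.exists_card_centralizer hG
  set C := Subgroup.centralizer ({x} : Set G) with hCdef
  have hpow : ∀ y ∈ N, ∃ n : ℤ, x ^ n = y := by
    intro y hy
    obtain ⟨n, hn⟩ := Subgroup.mem_zpowers_iff.mp (mem_zpowers_of_prime_card hN3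
      (g := (⟨x, hx⟩ : N)) (g' := ⟨y, hy⟩) (fun e => hx1 (congrArg Subtype.val e)))
    exact ⟨n, by simpa using congrArg Subtype.val hn⟩
  have hNc : ∀ y ∈ N, ∀ c ∈ C, c * y = y * c := by
    intro y hy c hc
    obtain ⟨n, rfl⟩ := hpow y hy
    exact (Commute.zpow_right (Subgroup.mem_centralizer_singleton_iff.mp hc) n).eq
  have hM3 : ∀ y ∈ N, y ^ 3 = 1 := fun y hy => by
    have h1 := pow_card_eq_one' (x := (⟨y, hy⟩ : N))
    rw [hN3] at h1
    exact congrArg Subtype.val h1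
  have hCn : C.Normal := Subgroup.normal_of_index_eq_two (by
    have h1 := C.card_mul_index
    rw [hC, hG] at h1
    omega)
  obtain ⟨t, ht⟩ := exists_prime_orderOf_dvd_card' (G := G) 2 (by rw [hG]; norm_num)
  have htt : t * t = 1 := by rw [← pow_two, ← ht, pow_orderOf_eq_one]
  have htC : t ∉ C := by
    intro htC
    have h1 : orderOf (⟨t, htC⟩ : C) ∣ Nat.card C := orderOf_dvd_natCard _
    rw [Subgroup.orderOf_mk, ht, hC] at h1
    omega
  have htx : t * x * t⁻¹ = x⁻¹ := by
    rcases mul_eq_one_or_mul_inv_eq_one_of_mem hN3 (hNn.conj_mem x hx t) hx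
      (by rwa [Ne, conj_eq_one_iff]) hx1 with h1 | h1
    · exact eq_inv_of_mul_eq_one_left h1
    · rw [mul_inv_eq_one, mul_inv_eq_iff_eq_mul] at h1
      exact absurd (Subgroup.mem_centralizer_singleton_iff.mpr h1) htC
  have htN : ∀ y ∈ N, t * y * t⁻¹ = y⁻¹ := by
    intro y hy
    obtain ⟨n, rfl⟩ := hpow y hy
    rw [← conj_zpow, htx, inv_zpow]
  let M : Subgroup C := N.subgroupOf C
  have hM : Nat.card M = 3 := by
    rw [Nat.card_congr (Subgroup.subgroupOfEquivOfLe hNC).toEquiv, hN3]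
  have hMc : M ≤ Subgroup.center C := fun y hy => Subgroup.mem_center_iff.mpr fun c =>
    Subtype.ext (hNc y hy c c.2)
  obtain ⟨c₀, d₀, hcd⟩ : ∃ c₀ d₀ : C, c₀ * d₀ ≠ d₀ * c₀ := by
    by_contra! hab
    refine hx1 ?_
    have h1 : ⁅C, C⁆ = ⊥ := by
      rw [eq_bot_iff, Subgroup.commutator_le]
      intro c hc c' hc'
      rw [Subgroup.mem_bot, commutatorElement_eq_one_iff_mul_comm]
      exact congrArg Subtype.val (hab ⟨c, hc⟩ ⟨c', hc'⟩)
    exact (Subgroup.mem_bot.mp (h1 ▸ hcomm hx))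
  let σ : C →* C := (MulAut.conjNormal t : MulAut C).toMonoidHom
  have hσ : ∀ c : C, ((σ c : C) : G) = t * c * t⁻¹ := fun c => MulAut.conjNormal_apply t c
  obtain ⟨⟨a, haM, hσa⟩, b, hbM, hσb⟩ := exists_fixed_and_inverted hC hM hMc hcd σ
    (fun c => Subtype.ext (by
      rw [hσ, hσ]
      calc t * (t * c * t⁻¹) * t⁻¹ = (t * t) * c * (t * t)⁻¹ := by group
        _ = c := by rw [htt]; group))
    (fun y hy => Subtype.ext (by rw [hσ]; exact htN y hy))
  have hta : t * a = a * t := by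
    have h1 := hσ a
    rw [hσa] at h1
    exact (eq_mul_inv_iff_mul_eq.mp h1).symm
  have htb : t * b * t⁻¹ = (b : G)⁻¹ := by
    have h1 := hσ b
    rw [hσb] at h1
    exact h1.symm
  have ha1 : (a : G) ≠ 1 := fun h1 => haM (by
    rw [show a = 1 from Subtype.ext h1]; exact M.one_mem)
  have hcube := pow_three_mem_of_card_eq hC hM hMc hcd
  have hconj : ∀ y : G, y ∈ N → t * y = y * t → y = 1 := by
    intro y hy hty
    have h1 := htN y hy
    rw [hty, mul_inv_cancel_right, eq_inv_iff_mul_eq_one] at h1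
    have h3 := hM3 y hy
    rwa [pow_succ, pow_two, h1, one_mul] at h3
  have ha3 : (a : G) ^ 3 = 1 :=
    hconj _ (hcube a) ((show Commute t a from hta).pow_right 3).eq
  -- If `a` and `b` commuted, `a b` or `a b⁻¹` would lie in `N`. Conjugation by `t` interchanges the
  -- two, so both would, and `b²` and `b³` in `N` would give `b ∈ N`.
  have hab : (a : G) * b ≠ b * a := by
    intro hab
    have hboth : ∀ s : G, s ∈ N → (s = a * b ∨ s = a * (b : G)⁻¹) → False := by
      intro s hs hs'
      have h1 : (a : G) * b ∈ N ∧ (a : G) * (b : G)⁻¹ ∈ N := by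
        have h2 := hNn.conj_mem s hs t
        rcases hs' with rfl | rfl
        · refine ⟨hs, ?_⟩
          rw [← mul_assoc, hta, mul_assoc (a : G), mul_assoc (a : G), htb] at h2
          exact h2
        · refine ⟨?_, hs⟩
          rw [← mul_assoc, hta, mul_assoc (a : G), mul_assoc (a : G), ← conj_inv, htb, inv_inv] at h2
          exact h2
      have h2 := N.mul_mem (N.inv_mem h1.2) h1.1
      have h3 : (b : G) * b ∈ N := by
        convert h2 using 1
        group
      refine hbM ?_
      have h4 := N.mul_mem (N.inv_mem h3) (hcube b)
      change (b : G) ∈ N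
      convert h4 using 1
      change (b : G) = ((b : G) * b)⁻¹ * (b : G) ^ 3
      group
    rcases mul_mem_or_of_commute hC hM hMc hcd haM hbM (Subtype.ext hab) with h1 | h1
    · exact hboth _ h1 (Or.inl rfl)
    · exact hboth _ h1 (Or.inr rfl)
  obtain ⟨z, hz⟩ : ∃ z : G, z = a * b * (a : G)⁻¹ * (b : G)⁻¹ := ⟨_, rfl⟩
  have hzN : z ∈ N := hz ▸ commutator_mem_of_card_eq hC hM hMc hcd a b
  have hz1 : z ≠ 1 := by
    rw [hz, Ne, mul_inv_eq_one, mul_inv_eq_iff_eq_mul]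
    exact hab
  have hz3 := hM3 z hzN
  have hzle : Subgroup.zpowers z ≤ N := by rwa [Subgroup.zpowers_le]
  refine ⟨a, b, t, z, ht, orderOf_eq_prime ha3 ha1, orderOf_eq_prime hz3 hz1, hta, htb,
    htN z hzN, by rw [hz]; group, hNc z hzN a a.2, hNc z hzN b b.2, fun h1 => hbM (hzle h1), ?_⟩
  by_cases hb3 : (b : G) ^ 3 = 1
  · exact Or.inl hb3
  · rcases mul_eq_one_or_mul_inv_eq_one_of_mem hN3 (hcube b) hzN hb3 hz1 with h1 | h1
    · exact Or.inr (Or.inr (eq_inv_of_mul_eq_one_left h1))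
    · exact Or.inr (Or.inl (mul_inv_eq_one.mp h1))

end StructureConditions

theorem orderOf_eq_six {G : Type*} [Monoid G] {g : G} (h6 : g ^ 6 = 1) (h3 : g ^ 3 ≠ 1)
    (h2 : g ^ 2 ≠ 1) : orderOf g = 6 := by
  refine orderOf_eq_of_pow_and_pow_div_prime (by norm_num) h6 fun p hp hdvd => ?_
  have hle := Nat.le_of_dvd (by norm_num) hdvd
  interval_cases p
  · exact absurd hp (by norm_num)
  · exact absurd hp (by norm_num)
  · exact h3
  · exact h2
  all_goals first | omega | exact absurd hp (by norm_num)

/-! ### The affine groups of `ℤ/9` and of the dual numbers over `F₃` -/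

section ZModNine

/-- The primitive root `2` modulo `9`. -/
def unitTwo : (ZMod 9)ˣ := ⟨2, 5, by decide, by decide⟩

/-- The primitive root `5` modulo `9`. -/
def unitFive : (ZMod 9)ˣ := ⟨5, 2, by decide, by decide⟩

theorem orderOf_unitTwo : orderOf unitTwo = 6 := orderOf_eq_six (by decide) (by decide) (by decide)

theorem orderOf_unitFive : orderOf unitFive = 6 :=
  orderOf_eq_six (by decide) (by decide) (by decide)

theorem card_units_zmod_nine : Nat.card (ZMod 9)ˣ = 6 := by
  rw [Nat.card_eq_fintype_card, ZMod.card_units_eq_totient]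
  decide

theorem mem_zpowers_of_orderOf_eq_six {u : (ZMod 9)ˣ} (hu : orderOf u = 6) (v : (ZMod 9)ˣ) :
    v ∈ Subgroup.zpowers u := by
  rw [Subgroup.eq_top_of_card_eq (Subgroup.zpowers u)
    (by rw [Nat.card_zpowers, hu, card_units_zmod_nine])]
  exact Subgroup.mem_top v

theorem card_affineGroup_zmod_nine : Nat.card (AffineGroup (ZMod 9)) = 54 := by
  rw [AffineGroup.card, card_units_zmod_nine, Nat.card_zmod]

/-- A group of order `54` with an element `b` of order `9` and an element of order `6` acting on the
powers of `b` as a primitive root. -/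
theorem nonempty_mulEquiv_affineGroup_zmod_nine {G : Type*} [Group G] (hG : Nat.card G = 54)
    {b c : G} (hb : orderOf b = 9) (hc : orderOf c = 6) {u : (ZMod 9)ˣ} (hu : orderOf u = 6)
    (hu1 : IsUnit ((u : ZMod 9) - 1)) (n : ℕ) (hn : (n : ZMod 9) = u) (h : c * b * c⁻¹ = b ^ n) :
    Nonempty (G ≃* AffineGroup (ZMod 9)) := by
  have : Finite G := Nat.finite_of_card_ne_zero (by rw [hG]; norm_num)
  let f : ZMod 9 →+ Additive G := ZMod.lift 9 ⟨zmultiplesHom (Additive G) (.ofMul b), by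
    change b ^ ((9 : ℕ) : ℤ) = 1
    rw [zpow_natCast, ← hb, pow_orderOf_eq_one]⟩
  have hf : ∀ i : ℤ, f.toMultiplicativeLeft (.ofAdd (i : ZMod 9)) = b ^ i :=
    fun i => congrArg Additive.toMul (ZMod.lift_coe 9 _ i)
  refine AffineGroup.nonempty_mulEquiv (by rw [card_affineGroup_zmod_nine, hG])
    f.toMultiplicativeLeft ?_ (mem_zpowers_of_orderOf_eq_six hu) hu1 (hc.trans hu.symm) ?_
  · have hinj : Function.Injective f := by
      rw [ZMod.lift_injective]
      intro m hm
      rw [ZMod.intCast_zmod_eq_zero_iff_dvd]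
      change b ^ m = 1 at hm
      rwa [← orderOf_dvd_iff_zpow_eq_one, hb] at hm
    exact hinj
  · intro r
    obtain ⟨i, rfl⟩ := ZMod.intCast_surjective r
    have h1 : (u : ZMod 9) * (i : ZMod 9) = (((n : ℤ) * i : ℤ) : ZMod 9) := by
      rw [← hn]; push_cast; rfl
    rw [h1, hf, hf, ← conj_zpow, h, zpow_mul, zpow_natCast]

end ZModNine

section DualNumber

instance : Finite (ZMod 3)[ε] := inferInstanceAs (Finite (ZMod 3 × ZMod 3))

theorem card_dualNumber_zmod_three : Nat.card (ZMod 3)[ε] = 9 := by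
  change Nat.card (ZMod 3 × ZMod 3) = 9
  rw [Nat.card_prod, Nat.card_zmod]

/-- The unit `-1 - ε`. -/
def unitDual : (ZMod 3)[ε]ˣ where
  val := -1 - ε
  inv := -1 + ε
  val_inv := by ext <;> simp
  inv_val := by ext <;> simp

theorem unitDual_pow (n : ℕ) : (((unitDual ^ n : (ZMod 3)[ε]ˣ) : (ZMod 3)[ε]).fst = (-1) ^ n) ∧
    (((unitDual ^ n : (ZMod 3)[ε]ˣ) : (ZMod 3)[ε]).snd = (-1) ^ n * n) := by
  induction n with
  | zero => simp
  | succ n ih =>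
    have h1 : ((unitDual ^ (n + 1) : (ZMod 3)[ε]ˣ) : (ZMod 3)[ε]) =
      ((unitDual ^ n : (ZMod 3)[ε]ˣ) : (ZMod 3)[ε]) * (-1 - ε) := by rw [pow_succ]; rfl
    rw [h1]
    constructor
    · rw [TrivSqZeroExt.fst_mul, ih.1]
      change (-1) ^ n * (-1 - 0 : ZMod 3) = _
      ring
    · rw [TrivSqZeroExt.snd_mul, ih.1, ih.2]
      change (-1) ^ n * (-0 - 1 : ZMod 3) + ((-1) ^ n * n) * (-1 - 0) = _
      push_cast
      ring

/-- Since `(-1 - ε)^n = (-1)^n (1 + n ε)`, the parity of `n` and its residue modulo three can be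
prescribed independently. -/
theorem exists_unitDual_pow_eq (v : (ZMod 3)[ε]ˣ) : ∃ n ∈ Finset.range 6, unitDual ^ n = v := by
  have hv : (v : (ZMod 3)[ε]).fst ≠ 0 :=
    (TrivSqZeroExt.isUnit_iff_isUnit_fst.mp v.isUnit).ne_zero
  have key : ∀ p q : ZMod 3, p ≠ 0 →
      ∃ n ∈ Finset.range 6, (-1) ^ n = p ∧ (-1) ^ n * (n : ZMod 3) = q := by
    decide
  obtain ⟨n, hn, h1, h2⟩ := key _ (v : (ZMod 3)[ε]).snd hv
  refine ⟨n, hn, ?_⟩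
  ext
  · rw [(unitDual_pow n).1, h1]
  · rw [(unitDual_pow n).2, h2]

theorem mem_zpowers_unitDual (v : (ZMod 3)[ε]ˣ) : v ∈ Subgroup.zpowers unitDual := by
  obtain ⟨n, -, h⟩ := exists_unitDual_pow_eq v
  exact Subgroup.mem_zpowers_iff.mpr ⟨n, by rw [zpow_natCast, h]⟩

theorem orderOf_unitDual : orderOf unitDual = 6 := by
  refine orderOf_eq_six ?_ ?_ ?_
  · ext
    · rw [(unitDual_pow 6).1]; rfl
    · rw [(unitDual_pow 6).2]; rfl
  · intro h
    have h1 := (unitDual_pow 3).1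
    rw [h] at h1
    exact absurd h1 (by decide)
  · intro h
    have h1 := (unitDual_pow 2).2
    rw [h] at h1
    exact absurd h1 (by decide)

theorem card_units_dualNumber : Nat.card (ZMod 3)[ε]ˣ = 6 := by
  rw [← orderOf_eq_card_of_forall_mem_zpowers mem_zpowers_unitDual, orderOf_unitDual]

theorem card_affineGroup_dualNumber : Nat.card (AffineGroup (ZMod 3)[ε]) = 54 := by
  rw [AffineGroup.card, card_units_dualNumber, card_dualNumber_zmod_three]

theorem isUnit_unitDual_sub_one : IsUnit ((unitDual : (ZMod 3)[ε]) - 1) := by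
  rw [TrivSqZeroExt.isUnit_iff_isUnit_fst]
  have h1 : ((unitDual : (ZMod 3)[ε]) - 1).fst = 1 := by
    change (-1 - 0 - 1 : ZMod 3) = 1
    decide
  rw [h1]
  exact isUnit_one

/-- A group of order `54` with commuting elements `b, z` of order `3` and an element of order `6`
acting on them as the unit `-1 - ε` on the dual numbers over the field with three elements. -/
theorem nonempty_mulEquiv_affineGroup_dualNumber {G : Type*} [Group G] (hG : Nat.card G = 54)
    {b z c : G} (hb : b ^ 3 = 1) (hz : orderOf z = 3) (hbz : b * z = z * b)
    (hbn : b ∉ Subgroup.zpowers z) (hc : orderOf c = 6) (hcb : c * b * c⁻¹ = b⁻¹ * z⁻¹)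
    (hcz : c * z * c⁻¹ = z⁻¹) : Nonempty (G ≃* AffineGroup (ZMod 3)[ε]) := by
  have : Finite G := Nat.finite_of_card_ne_zero (by rw [hG]; norm_num)
  have hz3 : z ^ 3 = 1 := by rw [← hz, pow_orderOf_eq_one]
  have hb3 : orderOf b = 3 := by
    have : Fact (Nat.Prime 3) := ⟨Nat.prime_three⟩
    exact orderOf_eq_prime hb fun h => hbn (h ▸ Subgroup.one_mem _)
  let F (g : G) (hg : orderOf g = 3) : ZMod 3 →+ Additive G :=
    ZMod.lift 3 ⟨zmultiplesHom (Additive G) (.ofMul g), by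
      change g ^ ((3 : ℕ) : ℤ) = 1
      rw [zpow_natCast, ← hg, pow_orderOf_eq_one]⟩
  have hF : ∀ g hg (i : ℤ), (F g hg i).toMul = g ^ i := fun g hg i =>
    congrArg Additive.toMul (ZMod.lift_coe 3 _ i)
  have hcomm : ∀ i j : ZMod 3, Commute (F b hb3 i).toMul (F z hz j).toMul := by
    intro i j
    obtain ⟨i, rfl⟩ := ZMod.intCast_surjective i
    obtain ⟨j, rfl⟩ := ZMod.intCast_surjective j
    rw [hF b hb3, hF z hz]
    exact (show Commute b z from hbz).zpow_zpow i j
  let f : Multiplicative (ZMod 3)[ε] →* G :=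
    { toFun := fun r => (F b hb3 r.toAdd.fst).toMul * (F z hz r.toAdd.snd).toMul
      map_one' := by simp
      map_mul' := fun r s => by
        rw [toAdd_mul, TrivSqZeroExt.fst_add, TrivSqZeroExt.snd_add, map_add (F b hb3),
          map_add (F z hz), toMul_add, toMul_add, (hcomm _ _).mul_mul_mul_comm] }
  have hf : ∀ i j : ℤ, ∀ r : (ZMod 3)[ε], r.fst = i → r.snd = j →
      f (.ofAdd r) = b ^ i * z ^ j := by
    intro i j r hi hj
    change (F b hb3 r.fst).toMul * (F z hz r.snd).toMul = _
    rw [hi, hj, hF b hb3, hF z hz]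
  refine AffineGroup.nonempty_mulEquiv (by rw [card_affineGroup_dualNumber, hG]) f ?_
    mem_zpowers_unitDual isUnit_unitDual_sub_one (hc.trans orderOf_unitDual.symm) ?_
  · rw [injective_iff_map_eq_one]
    intro r hr
    obtain ⟨i, hi⟩ := ZMod.intCast_surjective r.toAdd.fst
    obtain ⟨j, hj⟩ := ZMod.intCast_surjective r.toAdd.snd
    have h1 := (hf i j r.toAdd hi.symm hj.symm).symm.trans hr
    -- If `3` did not divide `i`, a Bézout relation and `b³ = 1` would turn `b^i = z^(-j)` into an
    -- expression of `b` as a power of `z`.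
    have hi0 : (i : ZMod 3) = 0 := by
      by_contra hi0
      rw [ZMod.intCast_zmod_eq_zero_iff_dvd] at hi0
      obtain ⟨k, l, hkl⟩ := Int.prime_three.coprime_iff_not_dvd.mpr hi0
      refine hbn (Subgroup.mem_zpowers_iff.mpr ⟨-j * l, ?_⟩)
      calc z ^ (-j * l) = (b ^ (3 : ℤ)) ^ k * (b ^ i) ^ l := by
            rw [eq_inv_of_mul_eq_one_left h1, zpow_mul, zpow_neg,
              show b ^ (3 : ℤ) = 1 by exact_mod_cast hb, one_zpow, one_mul]
        _ = b ^ (k * 3 + l * i) := by rw [zpow_add, mul_comm k, mul_comm l, zpow_mul, zpow_mul]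
        _ = b := by rw [hkl, zpow_one]
    rw [ZMod.intCast_zmod_eq_zero_iff_dvd] at hi0
    rw [← hb3, orderOf_dvd_iff_zpow_eq_one] at hi0
    rw [hi0, one_mul, ← orderOf_dvd_iff_zpow_eq_one, hz, ← ZMod.intCast_zmod_eq_zero_iff_dvd, hj] at h1
    rw [← orderOf_dvd_iff_zpow_eq_one, hb3, ← ZMod.intCast_zmod_eq_zero_iff_dvd, hi] at hi0
    exact TrivSqZeroExt.ext hi0 h1
  · intro r
    obtain ⟨i, hi⟩ := ZMod.intCast_surjective r.fst
    obtain ⟨j, hj⟩ := ZMod.intCast_surjective r.snd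
    have h1 : ((unitDual : (ZMod 3)[ε]) * r).fst = ((-i : ℤ) : ZMod 3) := by
      change (-1 - 0 : ZMod 3) * r.fst = _
      rw [← hi]; push_cast; ring
    have h2 : ((unitDual : (ZMod 3)[ε]) * r).snd = ((-i - j : ℤ) : ZMod 3) := by
      rw [TrivSqZeroExt.snd_mul, ← hi, ← hj]
      change (-1 - 0 : ZMod 3) * (j : ZMod 3) + (-0 - 1) * (i : ZMod 3) = _
      push_cast; ring
    have hbz' : Commute b⁻¹ z⁻¹ := (show Commute b z from hbz).inv_inv
    rw [hf i j r hi.symm hj.symm, hf _ _ _ h1 h2, ← conj_mul, ← conj_zpow, ← conj_zpow, hcb, hcz,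
      hbz'.mul_zpow, inv_zpow', inv_zpow', inv_zpow', mul_assoc, ← zpow_add, sub_eq_add_neg]

/-- The six-term geometric sum of every unit vanishes. This separates the two groups, because
translation by `1` on `ℤ/9` does not have order dividing `6`. -/
theorem pow_six_affineGroup_dualNumber (x : AffineGroup (ZMod 3)[ε]) : x ^ 6 = 1 := by
  have key : ∀ n ∈ Finset.range 6,
      ∑ i ∈ Finset.range 6, ((-1) ^ (n * i) : ZMod 3) = 0 ∧
      ∑ i ∈ Finset.range 6, ((-1) ^ (n * i) * ((n * i : ℕ) : ZMod 3)) = 0 := by decide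
  obtain ⟨n, hn, h⟩ := exists_unitDual_pow_eq x.scale
  have hsum : ∑ i ∈ Finset.range 6, (x.scale : (ZMod 3)[ε]) ^ i = 0 := by
    have h1 : ∀ i, (x.scale : (ZMod 3)[ε]) ^ i = ((unitDual ^ (n * i) : (ZMod 3)[ε]ˣ) : (ZMod 3)[ε]) :=
      fun i => by rw [← h, pow_mul]; rfl
    simp only [h1]
    ext
    · rw [TrivSqZeroExt.fst_sum, Finset.sum_congr rfl fun i _ => (unitDual_pow (n * i)).1]
      exact (key n hn).1
    · rw [TrivSqZeroExt.snd_sum, Finset.sum_congr rfl fun i _ => (unitDual_pow (n * i)).2]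
      exact (key n hn).2
  ext1
  · rw [AffineGroup.shift_pow, hsum, zero_mul, AffineGroup.shift_one]
  · rw [AffineGroup.scale_pow, ← h, ← pow_mul, mul_comm, pow_mul, ← orderOf_unitDual,
      pow_orderOf_eq_one, one_pow, AffineGroup.scale_one]

theorem not_nonempty_mulEquiv_affineGroup :
    ¬ Nonempty (AffineGroup (ZMod 9) ≃* AffineGroup (ZMod 3)[ε]) := by
  rintro ⟨φ⟩
  have h1 : (⟨1, 1⟩ : AffineGroup (ZMod 9)) ^ 6 = 1 :=
    φ.injective (by rw [map_pow, pow_six_affineGroup_dualNumber, map_one])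
  have h2 := congrArg AffineGroup.shift h1
  rw [AffineGroup.shift_pow] at h2
  exact absurd h2 (by decide)

end DualNumber

/-! ### Irreducible representations of dimension six -/

namespace AffineGroup

variable {R : Type*} [CommRing R]

/-- The representation of the affine group of `R` on the functions on the units of `R` that is
induced from an additive character of `R`. -/
def unitsRepresentation (ψ : AddChar R ℂ) : Representation ℂ (AffineGroup R) (Rˣ → ℂ) where
  toFun g :=
    { toFun := fun f v => ψ (v * g.shift) * f (v * g.scale)
      map_add' := fun f f' => by ext v; simp [mul_add]
      map_smul' := fun c f => by ext v; simp [mul_left_comm] }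
  map_one' := by ext; simp
  map_mul' g h := by
    refine LinearMap.ext fun f => funext fun v => ?_
    change ψ (v * (g * h).shift) * f (v * (g * h).scale)
      = ψ (v * g.shift) * (ψ ((v * g.scale : Rˣ) * h.shift) * f (v * g.scale * h.scale))
    rw [shift_mul, scale_mul, mul_add, AddChar.map_add_eq_mul, mul_assoc, mul_assoc v]
    push_cast
    rw [mul_assoc]

theorem unitsRepresentation_apply (ψ : AddChar R ℂ) (g : AffineGroup R) (f : Rˣ → ℂ) (v : Rˣ) :
    unitsRepresentation ψ g f v = ψ (v * g.shift) * f (v * g.scale) := rfl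

/-- A dilation moves a nonzero value of `f` to any chosen unit `w`. Averaging translations against
the character `r ↦ ψ(w r)` then isolates that coordinate, because primitivity makes the characters
of distinct units orthogonal. So a nonzero subrepresentation contains all delta functions. -/
theorem isIrreducible_unitsRepresentation [Finite R] {ψ : AddChar R ℂ} (hψ : ψ.IsPrimitive) :
    (unitsRepresentation ψ).IsIrreducible := by
  classical
  cases nonempty_fintype R
  have : Fintype Rˣ := Fintype.ofFinite _
  have : Nontrivial (Subrepresentation (unitsRepresentation ψ)) := by
    refine ⟨⊥, ⊤, fun h => ?_⟩
    have h1 : (1 : Rˣ → ℂ) ∈ (⊥ : Subrepresentation (unitsRepresentation ψ)) := by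
      rw [h]; exact Submodule.mem_top (R := ℂ)
    exact one_ne_zero ((Submodule.mem_bot ℂ).mp h1)
  refine { eq_bot_or_eq_top := fun S => ?_ }
  by_cases hS : ∀ f ∈ S, f = 0
  · exact Or.inl (le_bot_iff.mp fun f hf => (Submodule.mem_bot ℂ).mpr (hS f hf))
  refine Or.inr (top_le_iff.mp fun f₀ _ => ?_)
  push Not at hS
  obtain ⟨f, hf, hf0⟩ := hS
  obtain ⟨v₀, hv₀⟩ := Function.ne_iff.mp hf0
  have hsingle : ∀ w : Rˣ, (Pi.single w 1 : Rˣ → ℂ) ∈ S.toSubmodule := by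
    intro w
    let f' := unitsRepresentation ψ ⟨0, w⁻¹ * v₀⟩ f
    have hf' : f' ∈ S.toSubmodule := S.apply_mem_toSubmodule _ hf
    have hf'w : f' w = f v₀ := by
      simp [f', unitsRepresentation_apply]
    have hsum : ∑ r : R, ψ (-(w * r)) • unitsRepresentation ψ ⟨r, 1⟩ f' ∈ S.toSubmodule :=
      Submodule.sum_mem _ fun r _ => Submodule.smul_mem _ _ (S.apply_mem_toSubmodule _ hf')
    have heq : ∑ r : R, ψ (-(w * r)) • unitsRepresentation ψ ⟨r, 1⟩ f'
        = ((Fintype.card R : ℂ) * f v₀) • (Pi.single w 1 : Rˣ → ℂ) := by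
      ext v
      rw [Finset.sum_apply]
      have h1 : ∀ r : R, (ψ (-(w * r)) • unitsRepresentation ψ ⟨r, 1⟩ f') v
          = ψ (r * (v - w)) * f' v := by
        intro r
        rw [Pi.smul_apply, unitsRepresentation_apply, smul_eq_mul, ← mul_assoc,
          ← AddChar.map_add_eq_mul, mul_one]
        congr 2
        ring
      rw [Finset.sum_congr rfl fun r _ => h1 r, ← Finset.sum_mul, AddChar.sum_mulShift _ hψ]
      by_cases hvw : v = w
      · subst hvw
        simp [hf'w]
      · have h2 : (v : R) - w ≠ 0 := fun h => hvw (Units.ext (sub_eq_zero.mp h))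
        simp [h2, hvw]
    rw [heq] at hsum
    have hne : (Fintype.card R : ℂ) * f v₀ ≠ 0 :=
      mul_ne_zero (Nat.cast_ne_zero.mpr Fintype.card_ne_zero) hv₀
    have h3 := S.toSubmodule.smul_mem ((Fintype.card R : ℂ) * f v₀)⁻¹ hsum
    rwa [smul_smul, inv_mul_cancel₀ hne, one_smul] at h3
  change f₀ ∈ S.toSubmodule
  rw [pi_eq_sum_univ' f₀]
  refine Submodule.sum_mem _ fun w _ => Submodule.smul_mem _ _ ?_
  convert hsingle w using 1

/-- A finite ring with a primitive additive character, six units and nine elements gives a group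
of order `54` with a simple module of dimension `6` satisfying the structure conditions. -/
theorem hasModuleWithStructure {R : Type} [CommRing R] [Finite R] {ψ : AddChar R ℂ}
    (hψ : ψ.IsPrimitive) (hR : Nat.card Rˣ = 6) (hcard : Nat.card (AffineGroup R) = 54) :
    HasModuleWithStructure (AffineGroup R) 6 3 := by
  have := isIrreducible_unitsRepresentation hψ
  have : Fintype Rˣ := Fintype.ofFinite _
  have hfin : finrank ℂ (unitsRepresentation ψ).asModule = 6 := by
    change finrank ℂ (Rˣ → ℂ) = 6
    rw [finrank_fintype_fun_eq_card, ← Nat.card_eq_fintype_card, hR]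
  obtain ⟨-, -, N, hN⟩ := exists_structureConditions (G := AffineGroup R)
    (unitsRepresentation ψ).asModule (by rw [hfin, hcard]) (by rw [hfin]; norm_num)
  exact ⟨(unitsRepresentation ψ).asModule, inferInstance, inferInstance, inferInstance,
    inferInstance, inferInstance, hfin, N, hN⟩

end AffineGroup

theorem hasModuleWithStructure_zmod_nine : HasModuleWithStructure (AffineGroup (ZMod 9)) 6 3 :=
  AffineGroup.hasModuleWithStructure (ZMod.isPrimitive_stdAddChar 9) card_units_zmod_nine
    card_affineGroup_zmod_nine

/-- The additive character `x + y ε ↦ exp (2 π i y / 3)` of the dual numbers. -/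
noncomputable def dualNumberAddChar : AddChar (ZMod 3)[ε] ℂ :=
  (ZMod.stdAddChar (N := 3)).compAddMonoidHom (TrivSqZeroExt.sndHom (ZMod 3) (ZMod 3)).toAddMonoidHom

/-- The `ε`-coordinates of `a ε` and `a` are the two coordinates of `a`, so a trivial shift forces
`a = 0`. -/
theorem isPrimitive_dualNumberAddChar : dualNumberAddChar.IsPrimitive := by
  intro a ha h
  apply ha
  have h1 : ∀ r : (ZMod 3)[ε], (a * r).snd = 0 := by
    intro r
    have h2 : ZMod.stdAddChar (N := 3) (a * r).snd = 1 := DFunLike.congr_fun h r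
    exact ZMod.injective_stdAddChar (by rw [h2, AddChar.map_zero_eq_one])
  ext
  · simpa using h1 ε
  · simpa using h1 1

theorem hasModuleWithStructure_dualNumber :
    HasModuleWithStructure (AffineGroup (ZMod 3)[ε]) 6 3 :=
  AffineGroup.hasModuleWithStructure isPrimitive_dualNumberAddChar card_units_dualNumber
    card_affineGroup_dualNumber

/-! ### Identification of the groups -/

/-- The groups of order `54` satisfying the structure conditions. -/
theorem StructureConditions.nonempty_mulEquiv {G : Type*} [Group G] {N : Subgroup G} {d e : ℕ}
    (h : StructureConditions N d e) (hG : Nat.card G = 54) :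
    Nonempty (G ≃* AffineGroup (ZMod 9)) ∨ Nonempty (G ≃* AffineGroup (ZMod 3)[ε]) := by
  obtain ⟨a, b, t, z, ht, ha, hz, hta, htb, htz, hab, haz, hbz, hbn, hb⟩ := h.exists_generators hG
  have hc : orderOf (a * t) = 6 := by
    rw [(show Commute a t from hta.symm).orderOf_mul_eq_mul_orderOf_of_coprime
      (by rw [ha, ht]; norm_num), ha, ht]
  have hcb : a * t * b * (a * t)⁻¹ = (z * b)⁻¹ := by
    rw [← hab]
    calc a * t * b * (a * t)⁻¹ = a * (t * b * t⁻¹) * a⁻¹ := by group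
      _ = (a * b * a⁻¹)⁻¹ := by rw [htb]; group
  have hcz : a * t * z * (a * t)⁻¹ = z⁻¹ := by
    calc a * t * z * (a * t)⁻¹ = a * (t * z * t⁻¹) * a⁻¹ := by group
      _ = (a * z * a⁻¹)⁻¹ := by rw [htz]; group
      _ = z⁻¹ := by rw [haz, mul_inv_cancel_right]
  have hz3 : z ^ 3 = 1 := by rw [← hz, pow_orderOf_eq_one]
  have hz1 : z ≠ 1 := fun h => by rw [h, orderOf_one] at hz; omega
  have hnine : b ^ 3 ≠ 1 → b ^ 9 = 1 → orderOf b = 9 := fun h1 h2 => by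
    have : Fact (Nat.Prime 3) := ⟨Nat.prime_three⟩
    exact orderOf_eq_prime_pow (p := 3) (n := 1) (by simpa using h1) (by simpa using h2)
  -- Always `a t` sends `b` to `(z b)⁻¹`. If `b³ = 1` this is the unit `-1 - ε` with `b, z` as `1,
  -- ε`; if `b³ = z` it is `b⁻⁴ = b⁵`; if `b³ = z⁻¹` it is `b²`.
  rcases hb with hb | hb | hb
  · exact Or.inr (nonempty_mulEquiv_affineGroup_dualNumber hG hb hz hbz hbn hc
      (by rw [hcb, mul_inv_rev]) hcz)
  · have h9 : b ^ 9 = 1 := by rw [show 9 = 3 * 3 from rfl, pow_mul, hb, hz3]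
    refine Or.inl (nonempty_mulEquiv_affineGroup_zmod_nine hG (hnine (by rwa [hb]) h9) hc
      orderOf_unitFive ⟨⟨4, 7, by decide, by decide⟩, by decide⟩ 5 (by decide) ?_)
    rw [hcb, ← hb, inv_eq_iff_mul_eq_one, ← pow_succ, ← pow_add, h9]
  · have h9 : b ^ 9 = 1 := by rw [show 9 = 3 * 3 from rfl, pow_mul, hb, inv_pow, hz3, inv_one]
    refine Or.inl (nonempty_mulEquiv_affineGroup_zmod_nine hG (hnine (by rwa [hb, inv_ne_one]) h9)
      hc orderOf_unitTwo ⟨1, by decide⟩ 2 (by decide) ?_)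
    rw [hcb, ← inv_inv z, ← hb]
    group

instance isKleinFour_multiplicative_zmod_two_prod :
    IsKleinFour (Multiplicative (ZMod 2 × ZMod 2)) where
  card_four := by
    change Nat.card (ZMod 2 × ZMod 2) = 4
    rw [Nat.card_prod, Nat.card_zmod]
  exponent_two := by
    refine Nat.dvd_antisymm (Monoid.exponent_dvd_of_forall_pow_eq_one (by decide)) ?_
    have h1 : orderOf (Multiplicative.ofAdd ((1, 0) : ZMod 2 × ZMod 2)) = 2 :=
      orderOf_eq_prime (by decide) (by decide)
    exact h1.symm.dvd.trans (Monoid.order_dvd_exponent _)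

/-- The groups of order four. -/
theorem nonempty_mulEquiv_of_card_eq_four {G : Type*} [Group G] (hG : Nat.card G = 4) :
    Nonempty (G ≃* Multiplicative (ZMod 4)) ∨ Nonempty (G ≃* Multiplicative (ZMod 2 × ZMod 2)) := by
  have : Finite G := Nat.finite_of_card_ne_zero (by rw [hG]; norm_num)
  by_cases hcyc : IsCyclic G
  · exact Or.inl ⟨mulEquivOfCyclicCardEq (by
      rw [hG]; exact (Nat.card_zmod 4).symm)⟩
  · have : IsKleinFour G :=
      ⟨hG, (not_isCyclic_iff_exponent_eq_prime Nat.prime_two (by rw [hG]; norm_num)).mp hcyc⟩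
    exact Or.inr IsKleinFour.nonempty_mulEquiv

/-- The nonabelian groups of order ten. -/
theorem nonempty_mulEquiv_dihedralGroup_five {G : Type*} [Group G] (hG : Nat.card G = 10)
    (hcomm : ¬ ∀ a b : G, a * b = b * a) : Nonempty (G ≃* DihedralGroup 5) := by
  have : Finite G := Nat.finite_of_card_ne_zero (by rw [hG]; norm_num)
  have : Fact (Nat.Prime 5) := ⟨Nat.prime_five⟩
  have : Fact (Nat.Prime 2) := ⟨Nat.prime_two⟩
  obtain ⟨r, hr⟩ := exists_prime_orderOf_dvd_card' (G := G) 5 (by rw [hG]; norm_num)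
  obtain ⟨s, hs⟩ := exists_prime_orderOf_dvd_card' (G := G) 2 (by rw [hG]; norm_num)
  have hindex : (Subgroup.zpowers r).index = 2 := by
    have h1 := (Subgroup.zpowers r).card_mul_index
    rw [Nat.card_zpowers, hr, hG] at h1
    omega
  -- The order of `g` is not `10`, as the group is not cyclic. It does not divide `5`, since then `g
  -- = (g²)³` would be a power of `r`. So it is `2`.
  have hinvol : ∀ g : G, g ∉ Subgroup.zpowers r → g * g = 1 := by
    intro g hg
    have hg2 : g ^ 2 ∈ Subgroup.zpowers r := Subgroup.sq_mem_of_index_two hindex g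
    have hdvd : orderOf g ∣ 10 := hG ▸ orderOf_dvd_natCard g
    have h10 : orderOf g ≠ 10 := by
      intro h
      have : IsCyclic G := isCyclic_of_orderOf_eq_card g (by rw [h, hG])
      exact hcomm (IsCyclic.isMulCommutative (α := G)).is_comm.comm
    have h5 : ¬ orderOf g ∣ 5 := by
      intro h
      refine hg ?_
      have h1 : g = (g ^ 2) ^ 3 := by
        rw [← pow_mul, show 2 * 3 = 5 + 1 from rfl, pow_succ, orderOf_dvd_iff_pow_eq_one.mp h,
          one_mul]
      rw [h1]
      exact Subgroup.pow_mem _ hg2 3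
    have h2 : orderOf g = 2 := by
      have hle := Nat.le_of_dvd (by norm_num) hdvd
      generalize orderOf g = n at *
      interval_cases n <;> omega
    rw [← pow_two, ← h2, pow_orderOf_eq_one]
  have hsr : s ∉ Subgroup.zpowers r := by
    intro h
    have h1 : orderOf (⟨s, h⟩ : Subgroup.zpowers r) ∣ Nat.card (Subgroup.zpowers r) :=
      orderOf_dvd_natCard _
    rw [Subgroup.orderOf_mk, hs, Nat.card_zpowers, hr] at h1
    omega
  have hss := hinvol s hsr
  have hinv : ∀ x ∈ Subgroup.zpowers r, x * s = s * x⁻¹ := by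
    intro x hx
    have h1 : s * x ∉ Subgroup.zpowers r := fun h => hsr (by
      simpa using Subgroup.mul_mem _ h (Subgroup.inv_mem _ hx))
    have h2 := hinvol _ h1
    have h3 : s * (x * s) = x⁻¹ := eq_inv_of_mul_eq_one_left (by simpa only [mul_assoc] using h2)
    rw [← h3, ← mul_assoc, hss, one_mul]
  let F : ZMod 5 →+ Additive G := ZMod.lift 5 ⟨zmultiplesHom (Additive G) (.ofMul r), by
    change r ^ ((5 : ℕ) : ℤ) = 1
    rw [zpow_natCast, ← hr, pow_orderOf_eq_one]⟩
  let f : ZMod 5 → G := fun i => (F i).toMul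
  have hf : ∀ i j, f (i + j) = f i * f j := fun i j => by
    change (F (i + j)).toMul = _
    rw [map_add F, toMul_add]
  have hf0 : f 0 = 1 := by
    change (F 0).toMul = _
    rw [map_zero F, toMul_zero]
  have hfneg : ∀ i, f (-i) = (f i)⁻¹ := fun i =>
    eq_inv_of_mul_eq_one_left (by rw [← hf, neg_add_cancel, hf0])
  have hfr : ∀ i, f i ∈ Subgroup.zpowers r := by
    intro i
    obtain ⟨i, rfl⟩ := ZMod.intCast_surjective i
    have h1 : f i = r ^ i := congrArg Additive.toMul (ZMod.lift_coe 5 _ i)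
    exact ⟨i, h1.symm⟩
  have hfinj : ∀ i, f i = 1 → i = 0 := by
    intro i
    obtain ⟨i, rfl⟩ := ZMod.intCast_surjective i
    intro h
    rw [show f i = r ^ i from congrArg Additive.toMul (ZMod.lift_coe 5 _ i),
      ← orderOf_dvd_iff_zpow_eq_one, hr] at h
    rwa [ZMod.intCast_zmod_eq_zero_iff_dvd]
  let φ : DihedralGroup 5 →* G :=
    { toFun := fun x => match x with
        | .r i => f i
        | .sr i => s * f i
      map_one' := hf0
      map_mul' := by
        rintro (i | i) (j | j)
        · exact hf i j
        · change s * f (j - i) = f i * (s * f j)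
          rw [← mul_assoc, hinv _ (hfr i), ← hfneg, mul_assoc, ← hf, neg_add_eq_sub]
        · change s * f (i + j) = s * f i * f j
          rw [hf, mul_assoc]
        · change f (j - i) = s * f i * (s * f j)
          rw [mul_assoc, ← mul_assoc (f i), hinv _ (hfr i), mul_assoc, ← mul_assoc s, hss, one_mul,
            ← hfneg, ← hf, neg_add_eq_sub] }
  have hinj : Function.Injective φ := by
    rw [injective_iff_map_eq_one]
    rintro (i | i) h
    · rw [hfinj i h, DihedralGroup.r_zero]
    · refine absurd (hfr i) fun h' => hsr ?_
      have h1 : s = (f i)⁻¹ := eq_inv_of_mul_eq_one_left h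
      rw [h1]
      exact Subgroup.inv_mem _ h'
  exact ⟨(MulEquiv.ofBijective φ ((Nat.bijective_iff_injective_and_card _).mpr
    ⟨hinj, by rw [DihedralGroup.nat_card, hG]⟩)).symm⟩

theorem mainTheorem8 :
    ∃ (A B : Type) (_ : Group A) (_ : Group B),
      -- two non-isomorphic groups of order 54 satisfying the conditions
      Nat.card A = 54 ∧ Nat.card B = 54 ∧
      HasModuleWithStructure A 6 3 ∧ HasModuleWithStructure B 6 3 ∧
      ¬ Nonempty (A ≃* B) ∧
      -- there are no others
      (∀ (G : Type u) [Group G], Nat.card G = 54 →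
        (∃ (N : Subgroup G) (d e : ℕ), StructureConditions N d e) →
        Nonempty (G ≃* A) ∨ Nonempty (G ≃* B)) ∧
      -- the classification
      (∀ (G : Type u) [Group G] [Finite G] (V : Type v) [AddCommGroup V] [Module ℂ V]
        [Module (MonoidAlgebra ℂ G) V] [IsScalarTower ℂ (MonoidAlgebra ℂ G) V]
        [IsSimpleModule (MonoidAlgebra ℂ G) V] (d : ℕ),
        Module.finrank ℂ V = d → d * (d + 3) = Nat.card G →
        (Nonempty (G ≃* Multiplicative (ZMod 4)) ∨
          Nonempty (G ≃* Multiplicative (ZMod 2 × ZMod 2))) ∨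
        Nonempty (G ≃* DihedralGroup 5) ∨
        (Nat.card G = 54 ∧
          (∃ N : Subgroup G, ActsTriviallyOffModule N V ∧ StructureConditions N d 3) ∧
          (Nonempty (G ≃* A) ∨ Nonempty (G ≃* B)))) := by
  refine ⟨AffineGroup (ZMod 9), AffineGroup (ZMod 3)[ε], inferInstance, inferInstance,
    card_affineGroup_zmod_nine, card_affineGroup_dualNumber, hasModuleWithStructure_zmod_nine,
    hasModuleWithStructure_dualNumber, not_nonempty_mulEquiv_affineGroup, ?_, ?_⟩
  · rintro G _ hG ⟨N, d, e, h⟩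
    exact h.nonempty_mulEquiv hG
  · intro G _ _ V _ _ _ _ _ d hd hcard
    cases nonempty_fintype G
    have hpos : 0 < d := hd ▸ finrank_pos_of_isSimpleModule (G := G) V
    by_cases hd3 : 3 ≤ d
    · rw [← hd] at hcard hd3
      obtain ⟨hG, h6, N, hN, hNs⟩ := exists_structureConditions V hcard hd3
      rw [← hd, h6]
      exact Or.inr (Or.inr ⟨hG, ⟨N, hN, hNs⟩, hNs.nonempty_mulEquiv hG⟩)
    -- The orders are `4` and `10`; in the latter case commutativity would force dimension at most
    -- `1`.
    · obtain rfl | rfl : d = 1 ∨ d = 2 := by omega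
      · exact Or.inl (nonempty_mulEquiv_of_card_eq_four hcard.symm)
      · refine Or.inr (Or.inl (nonempty_mulEquiv_dihedralGroup_five hcard.symm fun hcomm => ?_))
        have h1 := finrank_le_index_of_isMulCommutative (V := V) (⊤ : Subgroup G)
          fun a _ b _ => hcomm a b
        rw [hd, Subgroup.index_top] at h1
        omega
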